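/- Let $\mathfrak g$ be the split real form of a complex simple Lie algebra of type $A_3$, $B_2$, $G_2$ or $D_l$ with $l\ge 5$, with Iwasawa decomposition $\mathfrak g=\mathfrak k\oplus\mathfrak a\oplus\mathfrak n$, root system $\Pi=\Pi^+\cup\Pi^-$ of $(\mathfrak g,\mathfrak a)$ and root spaces $\mathfrak g_\alpha$. Let $K$ be the maximal compact subgroup, generated by $\mathrm{Exp}\,\mathrm{ad}(\mathfrak k)$, of the group of inner automorphisms of $\mathfrak g$, let $M$ be the centralizer of $\mathfrak a$ in $K$, and let $\mathbb F=K/M$ be the maximal real flag manifold of $\mathfrak g$, with $T_{b}\mathbb F=\mathfrak n^-=\sum_{\alpha\in\Pi^-}\mathfrak g_\alpha$ at the origin $b$. Two roots $\alpha,\beta$ are $M$-equivalent, $\alpha\sim_M\beta$, if the representations of $M$ on $\mathfrak g_\alpha$ and $\mathfrak g_\beta$ are equivalent; write $[\alpha]_M$ for the class of $\alpha$ in $\Pi^-$ and $V_{[\alpha]_M}=\sum_{\beta\in[\alpha]_M}\mathfrak g_\beta$. For a representation $V$ of $M$, consider the endomorphisms $\mathbb J$ of $V\oplus V^*$ with $\mathbb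 J^2=-1$ that are orthogonal for $\langle X+\xi,Y+\eta\rangle=\frac12(\xi(Y)+\eta(X))$ and commute with $M$, modulo the action $\mathbb J\mapsto e^{-B}\mathbb J e^{B}$ of the $M$-invariant $B\in\bigwedge^2V^*$, where $e^B(X+\xi)=X+\xi+i_XB$. For $V=\mathfrak n^-$ these $\mathbb J$ are the invariant generalized almost complex structures on $\mathbb F$ and the quotient is denoted $\mathfrak M_a(\mathbb F)$; for $V=V_{[\alpha]_M}$ the quotient is denoted $\mathfrak M_\alpha(\mathbb F)$. Let $\Pi^-=\bigcup_{j=1}^d[\alpha_j]_M$, where $d$ is the number of $M$-equivalence classes, and choose nonzero root vectors $X_\gamma\in\mathfrak g_\gamma$, $\gamma\in\Pi^-$. Then: (1) Each class has exactly two elements, $[\alpha_j]_M=\{\alpha_j,\beta_j\}$. (2) Every invariant $\mathbb J$ on $\mathfrak n^-\oplus(\mathfrak n^-)^*$ restricts to an invariant structure $\mathbb J_{[\alpha_j]_M}$ on $V_{[\alpha_j]_M}\oplus V_{[\alpha_j]_M}^*$ for every $j$, every invariant structure on $V_{[\alpha_j]_M}\oplus V_{[\alpha_j]_M}^*$ is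 such a restriction, and $\mathbb J\mapsto(\mathbb J_{[\alpha_j]_M})_j$ induces a bijection $\mathfrak M_a(\mathbb F)\to\prod_{j=1}^d\mathfrak M_{\alpha_j}(\mathbb F)$. (3) In the basis $(X_{\alpha_j},X_{\beta_j},X_{\alpha_j}^*,X_{\beta_j}^*)$, every invariant structure on $V_{[\alpha_j]_M}\oplus V_{[\alpha_j]_M}^*$ has a matrix of exactly one of the forms $$\begin{pmatrix}a&0&0&-x\\0&a&x&0\\0&-y&-a&0\\y&0&0&-a\end{pmatrix},\ a^2=xy-1\quad\text{(noncomplex type)},\qquad \begin{pmatrix}b&-\frac{1+b^2}{c}&0&0\\c&-b&0&0\\0&0&-b&-c\\0&0&\frac{1+b^2}{c}&b\end{pmatrix},\ c\ne0\quad\text{(complex type)},$$ and sending the former to $(0,x)$ and the latter to $(c,b)$ induces a bijection $\mathfrak M_{\alpha_j}(\mathbb F)\to(\{0\}\times\mathbb R^*)\cup(\mathbb R^*\times\mathbb R)\subset\mathbb R^2$. Hence $$\mathfrak M_a(\mathbb F)=\prod_{j=1}^d\mathfrak M_{\alpha_j}(\mathbb F)=\prod_{j=1}^d\bigl(\mathbb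 R^*\cup(\mathbb R^*\times\mathbb R)\bigr)_{\alpha_j}.$$ (4) With the topology induced from $\mathbb R^{2d}$ through these bijections, $\mathfrak M_a(\mathbb F)$ is homotopy equivalent to the $d$-torus $\mathbb T^d$. -/

import Mathlib

open scoped Matrix

attribute [local instance 100] LieRing.ofAssociativeRing

namespace RealFlag

noncomputable section

/-! ### The split real Lie algebras of type `A₃`, `B₂`, `G₂` and `D_l`, `l ≥ 5` -/

/-- The real matrices `X` with `Xᵀ J + J X = 0`, where `J` is the identity on `ℝ` plus the
hyperbolic form on `ℝ² ⊕ ℝ²`: the split real form `𝔰𝔬(3,2)` of type `B₂`. -/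
def splitB2 : LieSubalgebra ℝ (Matrix (Unit ⊕ (Fin 2 ⊕ Fin 2)) (Unit ⊕ (Fin 2 ⊕ Fin 2)) ℝ) :=
  skewAdjointMatricesLieSubalgebra
    (Matrix.fromBlocks (1 : Matrix Unit Unit ℝ) 0 0 (LieAlgebra.Orthogonal.JD (Fin 2) ℝ))

/-- The index set of the coordinates of the Zorn vector matrices `(a, u; v, b)`,
`a, b ∈ ℝ`, `u, v ∈ ℝ³`, listed as `(a, b), u, v`. -/
abbrev ZornIdx : Type := Fin 2 ⊕ (Fin 3 ⊕ Fin 3)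

/-- The product of the split octonions, in Zorn's vector-matrix form:
`(a, u; v, b) (a', u'; v', b') =
  (a a' + u·v', a u' + b' u - v × v'; a' v + b v' + u × u', b b' + v·u')`. -/
def zornMul (x y : ZornIdx → ℝ) : ZornIdx → ℝ :=
  let a := x (Sum.inl 0)
  let b := x (Sum.inl 1)
  let u : Fin 3 → ℝ := fun i => x (Sum.inr (Sum.inl i))
  let v : Fin 3 → ℝ := fun i => x (Sum.inr (Sum.inr i))
  let a' := y (Sum.inl 0)
  let b' := y (Sum.inl 1)
  let u' : Fin 3 → ℝ := fun i => y (Sum.inr (Sum.inl i))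
  let v' : Fin 3 → ℝ := fun i => y (Sum.inr (Sum.inr i))
  Sum.elim ![a * a' + u ⬝ᵥ v', b * b' + v ⬝ᵥ u']
    (Sum.elim (a • u' + b' • u - crossProduct v v') (a' • v + b • v' + crossProduct u u'))

theorem zornMul_add_left (x x' y : ZornIdx → ℝ) :
    zornMul (x + x') y = zornMul x y + zornMul x' y := by
  ext i
  rcases i with i | i | i <;> fin_cases i <;>
    simp [zornMul, crossProduct, dotProduct, Fin.sum_univ_three, Matrix.vecHead, Matrix.vecTail] <;> ring

theorem zornMul_add_right (x y y' : ZornIdx → ℝ) :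
    zornMul x (y + y') = zornMul x y + zornMul x y' := by
  ext i
  rcases i with i | i | i <;> fin_cases i <;>
    simp [zornMul, crossProduct, dotProduct, Fin.sum_univ_three, Matrix.vecHead, Matrix.vecTail] <;> ring

theorem zornMul_smul_left (c : ℝ) (x y : ZornIdx → ℝ) :
    zornMul (c • x) y = c • zornMul x y := by
  ext i
  rcases i with i | i | i <;> fin_cases i <;>
    simp [zornMul, crossProduct, dotProduct, Fin.sum_univ_three, Matrix.vecHead, Matrix.vecTail] <;> ring

theorem zornMul_smul_right (c : ℝ) (x y : ZornIdx → ℝ) :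
    zornMul x (c • y) = c • zornMul x y := by
  ext i
  rcases i with i | i | i <;> fin_cases i <;>
    simp [zornMul, crossProduct, dotProduct, Fin.sum_univ_three, Matrix.vecHead, Matrix.vecTail] <;> ring

/-- The Lie algebra of derivations of the split octonions: the split real form of type `G₂`. -/
def splitG2 : LieSubalgebra ℝ (Matrix ZornIdx ZornIdx ℝ) where
  carrier := {A | ∀ x y, A *ᵥ zornMul x y = zornMul (A *ᵥ x) y + zornMul x (A *ᵥ y)}
  zero_mem' := by
    intro x y
    have h0 : ∀ z, zornMul 0 z = 0 := fun z => by simpa using zornMul_smul_left 0 0 z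
    have h0' : ∀ z, zornMul z 0 = 0 := fun z => by simpa using zornMul_smul_right 0 z 0
    simp [h0, h0']
  add_mem' := by
    intro A B hA hB x y
    rw [Matrix.add_mulVec, Matrix.add_mulVec, Matrix.add_mulVec, zornMul_add_left,
      zornMul_add_right, hA x y, hB x y]
    abel
  smul_mem' := by
    intro c A hA x y
    rw [Matrix.smul_mulVec, Matrix.smul_mulVec, Matrix.smul_mulVec, zornMul_smul_left,
      zornMul_smul_right, hA x y, smul_add]
  lie_mem' := by
    intro A B hA hB x y
    have hs : ∀ u v w, zornMul (u - v) w = zornMul u w - zornMul v w := fun u v w => by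
      have := zornMul_add_left u ((-1 : ℝ) • v) w
      rw [zornMul_smul_left] at this
      simpa [sub_eq_add_neg] using this
    have hs' : ∀ u v w, zornMul u (v - w) = zornMul u v - zornMul u w := fun u v w => by
      have := zornMul_add_right u v ((-1 : ℝ) • w)
      rw [zornMul_smul_right] at this
      simpa [sub_eq_add_neg] using this
    simp only [LieRing.of_associative_ring_bracket, Matrix.sub_mulVec, ← Matrix.mulVec_mulVec,
      hs, hs']
    rw [hA x y, hB x y, Matrix.mulVec_add, Matrix.mulVec_add, hA, hA, hB, hB]
    abel

/-- `𝔤` is the split real form of type `A₃` (namely `𝔰𝔩(4,ℝ)`), `B₂` (namely `𝔰𝔬(3,2)`), `G₂`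
(the derivations of the split octonions) or `D_l` with `l ≥ 5` (namely `𝔰𝔬(l,l)`). Each of them is
realized as a Lie algebra of matrices which is closed under transposition, so that `X ↦ -Xᵀ` is a
Cartan involution, and whose diagonal matrices form a Cartan subalgebra of `𝔤`. -/
inductive IsSpecialType : (n : Type) → [Fintype n] → [DecidableEq n] →
    LieSubalgebra ℝ (Matrix n n ℝ) → Prop
  | A3 : IsSpecialType (Fin 4) (LieAlgebra.SpecialLinear.sl (Fin 4) ℝ)
  | B2 : IsSpecialType (Unit ⊕ (Fin 2 ⊕ Fin 2)) splitB2
  | G2 : IsSpecialType ZornIdx splitG2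
  | D (l : ℕ) (hl : 5 ≤ l) :
      IsSpecialType (Fin l ⊕ Fin l) (LieAlgebra.Orthogonal.typeD (Fin l) ℝ)

/-! ### Roots, the groups `K` and `M`, and the isotropy representation

In this section `𝔤` is a Lie algebra of real matrices closed under transposition, with Cartan
involution `X ↦ -Xᵀ`, such that the diagonal matrices in `𝔤` form a Cartan subalgebra. -/

section Flag

variable {n : Type} [Fintype n] [DecidableEq n] (𝔤 : LieSubalgebra ℝ (Matrix n n ℝ))

/-- The Cartan subalgebra `𝔞`: the diagonal matrices in `𝔤`. -/
def cartan : Submodule ℝ 𝔤 where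
  carrier := {H | (H : Matrix n n ℝ).IsDiag}
  zero_mem' := Matrix.isDiag_zero
  add_mem' := fun ha hb => Matrix.IsDiag.add ha hb
  smul_mem' := fun c _ ha => Matrix.IsDiag.smul c ha

/-- The root space `𝔤_α = {X ∈ 𝔤 | [H, X] = α(H) X for all H ∈ 𝔞}`. -/
def rootSpace (α : Module.Dual ℝ (cartan 𝔤)) : Submodule ℝ 𝔤 where
  carrier := {X | ∀ H : cartan 𝔤, ⁅(H : 𝔤), X⁆ = α H • X}
  zero_mem' := fun H => by simp
  add_mem' := fun hX hY H => by rw [lie_add, hX H, hY H, smul_add]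
  smul_mem' := fun c X hX H => by rw [lie_smul, hX H, smul_comm]

/-- The set `Π` of roots of the pair `(𝔤, 𝔞)`. -/
def roots : Set (Module.Dual ℝ (cartan 𝔤)) :=
  {α | α ≠ 0 ∧ rootSpace 𝔤 α ≠ ⊥}

/-- `P` is a choice of positive roots: `Π` is the disjoint union of `P` and `-P`, and a root that
is a sum of two elements of `P` is in `P`. -/
structure IsPositiveSystem (P : Set (Module.Dual ℝ (cartan 𝔤))) : Prop where
  mem_roots_iff : ∀ α, α ∈ roots 𝔤 ↔ (α ∈ P ∨ -α ∈ P)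
  not_both : ∀ α, ¬ (α ∈ P ∧ -α ∈ P)
  add_mem : ∀ α ∈ P, ∀ β ∈ P, α + β ∈ roots 𝔤 → α + β ∈ P

variable {𝔤} in
/-- The set `Π⁻ = -Π⁺` of negative roots, for the set `P = Π⁺` of positive roots. -/
def negRoots (P : Set (Module.Dual ℝ (cartan 𝔤))) : Set (Module.Dual ℝ (cartan 𝔤)) :=
  {α | -α ∈ P}

/-- The maximal compact subgroup `K ⊆ GL(𝔤)` of the group of inner automorphisms of `𝔤`: it is
generated by the automorphisms `Exp (ad X) = Ad (exp X) : Y ↦ exp(X) Y exp(-X)`, where `X` runs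
through the skew-symmetric matrices in `𝔤`, which are the fixed points `𝔨` of the Cartan
involution. -/
def groupK : Subgroup (𝔤 ≃ₗ[ℝ] 𝔤) :=
  Subgroup.closure {g | ∃ X : 𝔤, (X : Matrix n n ℝ)ᵀ = -(X : Matrix n n ℝ) ∧
    ∀ Y : 𝔤, ((g Y : 𝔤) : Matrix n n ℝ) =
      NormedSpace.exp (X : Matrix n n ℝ) * (Y : Matrix n n ℝ) *
        NormedSpace.exp (-(X : Matrix n n ℝ))}

/-- The group `M`: the centralizer of `𝔞` in `K`. The maximal real flag manifold of `𝔤` is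
`𝔽 = K / M`. -/
def groupM : Subgroup (𝔤 ≃ₗ[ℝ] 𝔤) :=
  groupK 𝔤 ⊓ fixingSubgroup (𝔤 ≃ₗ[ℝ] 𝔤) (cartan 𝔤 : Set 𝔤)

theorem groupK_lie {g : 𝔤 ≃ₗ[ℝ] 𝔤} (hg : g ∈ groupK 𝔤) :
    ∀ Y Z : 𝔤, g ⁅Y, Z⁆ = ⁅g Y, g Z⁆ := by
  induction hg using Subgroup.closure_induction with
  | mem g h =>
    obtain ⟨X, -, hX⟩ := h
    have he : NormedSpace.exp (-(X : Matrix n n ℝ)) * NormedSpace.exp (X : Matrix n n ℝ) = 1 := by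
      rw [← Matrix.exp_add_of_commute _ _ (Commute.neg_left (Commute.refl (X : Matrix n n ℝ)))]
      simp
    intro Y Z
    apply Subtype.ext
    rw [hX, LieSubalgebra.coe_bracket, LieSubalgebra.coe_bracket, hX, hX]
    simp only [LieRing.of_associative_ring_bracket]
    generalize NormedSpace.exp (-(X : Matrix n n ℝ)) = f at he ⊢
    generalize NormedSpace.exp (X : Matrix n n ℝ) = e at he ⊢
    have h2 : ∀ A B : Matrix n n ℝ, e * A * f * (e * B * f) = e * (A * B) * f := fun A B => by
      calc e * A * f * (e * B * f) = e * A * (f * e) * B * f := by noncomm_ring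
        _ = e * (A * B) * f := by rw [he]; noncomm_ring
    rw [h2, h2]
    noncomm_ring
  | one => intro Y Z; rfl
  | mul g h _ _ ihg ihh =>
    intro Y Z
    change g (h ⁅Y, Z⁆) = ⁅g (h Y), g (h Z)⁆
    rw [ihh, ihg]
  | inv g _ ih =>
    intro Y Z
    change g.symm ⁅Y, Z⁆ = ⁅g.symm Y, g.symm Z⁆
    apply g.injective
    rw [ih]
    simp

theorem groupM_mem_rootSpace (m : groupM 𝔤) (α : Module.Dual ℝ (cartan 𝔤)) {X : 𝔤}
    (hX : X ∈ rootSpace 𝔤 α) : (m : 𝔤 ≃ₗ[ℝ] 𝔤) X ∈ rootSpace 𝔤 α := by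
  intro H
  have hH : (m : 𝔤 ≃ₗ[ℝ] 𝔤) (H : 𝔤) = (H : 𝔤) :=
    (mem_fixingSubgroup_iff _).1 m.2.2 (H : 𝔤) H.2
  calc ⁅(H : 𝔤), (m : 𝔤 ≃ₗ[ℝ] 𝔤) X⁆
      = ⁅(m : 𝔤 ≃ₗ[ℝ] 𝔤) (H : 𝔤), (m : 𝔤 ≃ₗ[ℝ] 𝔤) X⁆ := by rw [hH]
    _ = (m : 𝔤 ≃ₗ[ℝ] 𝔤) ⁅(H : 𝔤), X⁆ := (groupK_lie 𝔤 m.2.1 _ _).symm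
    _ = α H • (m : 𝔤 ≃ₗ[ℝ] 𝔤) X := by rw [hX H, map_smul]

/-- The adjoint representation of `M` on `𝔤`. -/
def adM : Representation ℝ (groupM 𝔤) 𝔤 :=
  LinearEquiv.automorphismGroup.toLinearMapMonoidHom.comp (groupM 𝔤).subtype

/-- The sum of the root spaces `𝔤_β`, `β ∈ S`. -/
def rootSum (S : Set (Module.Dual ℝ (cartan 𝔤))) : Submodule ℝ 𝔤 :=
  ⨆ β ∈ S, rootSpace 𝔤 β

/-- The representation of `M` on the sum of the root spaces `𝔤_β`, `β ∈ S`. -/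
def rootSumRep (S : Set (Module.Dual ℝ (cartan 𝔤))) :
    Representation ℝ (groupM 𝔤) (rootSum 𝔤 S) :=
  (adM 𝔤).subrepresentation (rootSum 𝔤 S) (fun m => by
    refine iSup₂_le fun β hβ X hX => ?_
    exact (le_iSup₂ (f := fun β (_ : β ∈ S) => rootSpace 𝔤 β) β hβ)
      (groupM_mem_rootSpace 𝔤 m β hX))

/-- The representation of `M` on the root space `𝔤_α`. -/
def rootRep (α : Module.Dual ℝ (cartan 𝔤)) : Representation ℝ (groupM 𝔤) (rootSpace 𝔤 α) :=
  (adM 𝔤).subrepresentation (rootSpace 𝔤 α) (fun m _ hX => groupM_mem_rootSpace 𝔤 m α hX)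

/-- `M`-equivalence of roots: the representations of `M` on `𝔤_α` and `𝔤_β` are equivalent. -/
def MEquiv (α β : Module.Dual ℝ (cartan 𝔤)) : Prop :=
  Nonempty ((rootRep 𝔤 α).Equiv (rootRep 𝔤 β))

variable {𝔤} in
/-- The `M`-equivalence class `[α]_M` of `α` in `Π⁻`. -/
def mClass (P : Set (Module.Dual ℝ (cartan 𝔤))) (α : Module.Dual ℝ (cartan 𝔤)) :
    Set (Module.Dual ℝ (cartan 𝔤)) :=
  {β ∈ negRoots P | MEquiv 𝔤 β α}

variable {𝔤} in
/-- The tangent space `𝔫⁻ = ∑_{α ∈ Π⁻} 𝔤_α` of `𝔽 = K / M` at the origin. -/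
abbrev nMinus (P : Set (Module.Dual ℝ (cartan 𝔤))) : Submodule ℝ 𝔤 :=
  rootSum 𝔤 (negRoots P)

variable {𝔤} in
/-- The isotropy representation of `M` on `𝔫⁻`. -/
abbrev isotropyRep (P : Set (Module.Dual ℝ (cartan 𝔤))) :
    Representation ℝ (groupM 𝔤) (nMinus P) :=
  rootSumRep 𝔤 (negRoots P)

variable {𝔤} in
/-- The subspace `V_{[α]_M} = ∑_{β ∼_M α} 𝔤_β` of `𝔫⁻`. -/
abbrev classSpace (P : Set (Module.Dual ℝ (cartan 𝔤))) (α : Module.Dual ℝ (cartan 𝔤)) :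
    Submodule ℝ 𝔤 :=
  rootSum 𝔤 (mClass P α)

variable {𝔤} in
/-- The representation of `M` on `V_{[α]_M}`. -/
abbrev classRep (P : Set (Module.Dual ℝ (cartan 𝔤))) (α : Module.Dual ℝ (cartan 𝔤)) :
    Representation ℝ (groupM 𝔤) (classSpace P α) :=
  rootSumRep 𝔤 (mClass P α)

end Flag

/-! ### Invariant generalized complex structures and invariant `B`-transformations -/

section GeneralizedComplex

variable {Γ V : Type} [Group Γ] [AddCommGroup V] [Module ℝ V]

/-- The inner product `⟨X + ξ, Y + η⟩ = (ξ(Y) + η(X)) / 2` on `V ⊕ V*`. -/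
def genPairing (v w : V × Module.Dual ℝ V) : ℝ := (v.2 w.1 + w.2 v.1) / 2

/-- A `Γ`-invariant generalized complex structure on the representation `V` of `Γ`: an
endomorphism `𝕁` of `V ⊕ V*` with `𝕁² = -1`, orthogonal for the inner product above, and commuting
with the action of `Γ` on `V ⊕ V*`. For the isotropy representation of `M` on `𝔫⁻` these are the
`K`-invariant generalized almost complex structures on `𝔽 = K / M`, given by their values at the
origin. -/
structure InvariantGCS (ρ : Representation ℝ Γ V) where
  /-- the endomorphism `𝕁` -/
  toEnd : Module.End ℝ (V × Module.Dual ℝ V)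
  sq_eq : toEnd * toEnd = -1
  orthogonal : ∀ v w, genPairing (toEnd v) (toEnd w) = genPairing v w
  invariant : ∀ g, (ρ.prod ρ.dual) g * toEnd = toEnd * (ρ.prod ρ.dual) g

/-- `B` is a `Γ`-invariant alternating bilinear form on `V`, written as `X ↦ i_X B`. -/
structure IsInvariantTwoForm (ρ : Representation ℝ Γ V) (B : V →ₗ[ℝ] V →ₗ[ℝ] ℝ) : Prop where
  alternating : ∀ X, B X X = 0
  invariant : ∀ g X Y, B (ρ g X) (ρ g Y) = B X Y

/-- The `B`-transformation `e^B : X + ξ ↦ X + ξ + i_X B`. -/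
def expB (B : V →ₗ[ℝ] V →ₗ[ℝ] ℝ) : Module.End ℝ (V × Module.Dual ℝ V) :=
  LinearMap.prod (LinearMap.fst ℝ V (Module.Dual ℝ V))
    (LinearMap.snd ℝ V (Module.Dual ℝ V) + B ∘ₗ LinearMap.fst ℝ V (Module.Dual ℝ V))

theorem expB_add (B C : V →ₗ[ℝ] V →ₗ[ℝ] ℝ) : expB (B + C) = expB B * expB C := by
  refine LinearMap.ext fun v => Prod.ext rfl ?_
  change v.2 + (B v.1 + C v.1) = (v.2 + C v.1) + B v.1
  abel

theorem expB_zero : expB (0 : V →ₗ[ℝ] V →ₗ[ℝ] ℝ) = 1 := by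
  refine LinearMap.ext fun v => Prod.ext rfl ?_
  change v.2 + 0 = v.2
  simp

/-- Two invariant generalized complex structures `𝕁`, `𝕁'` are equivalent if they are in the same
orbit of the action of the invariant `B`-transformations: `𝕁' = e^{-B} 𝕁 e^B` for an invariant
`2`-form `B`. -/
def bSetoid (ρ : Representation ℝ Γ V) : Setoid (InvariantGCS ρ) where
  r J J' := ∃ B, IsInvariantTwoForm ρ B ∧ J'.toEnd = expB (-B) * J.toEnd * expB B
  iseqv := by
    refine ⟨fun J => ⟨0, ⟨by simp, by simp⟩, by
      have e : -(0 : V →ₗ[ℝ] V →ₗ[ℝ] ℝ) = 0 := LinearMap.ext fun x => LinearMap.ext fun y => by simp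
      rw [e, expB_zero, one_mul, mul_one]⟩, ?_, ?_⟩
    · rintro J J' ⟨B, hB, h⟩
      refine ⟨-B, ⟨fun X => by simp [hB.alternating], fun g X Y => by simp [hB.invariant]⟩, ?_⟩
      have h1 : expB B * expB (-B) = 1 := by
        have e : B + -B = 0 := add_neg_cancel B
        rw [← expB_add, e, expB_zero]
      have e : - -B = B := neg_neg B
      rw [h, e]
      calc J.toEnd = 1 * J.toEnd * 1 := by simp
        _ = _ := by rw [← h1]; simp only [mul_assoc]
    · rintro J J' J'' ⟨B, hB, h⟩ ⟨C, hC, h'⟩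
      refine ⟨B + C, ⟨fun X => by simp [hB.alternating, hC.alternating],
        fun g X Y => by simp [hB.invariant, hC.invariant]⟩, ?_⟩
      have e : -(B + C) = -C + -B := neg_add_rev B C
      rw [h', h, e, expB_add, expB_add]
      simp only [mul_assoc]

/-- The moduli space of invariant generalized complex structures on `V` modulo invariant
`B`-transformations. -/
def Moduli (ρ : Representation ℝ Γ V) : Type := Quotient (bSetoid ρ)

/-- The class of a structure in the moduli space. -/
def Moduli.mk {ρ : Representation ℝ Γ V} (J : InvariantGCS ρ) : Moduli ρ :=
  Quotient.mk (bSetoid ρ) J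

end GeneralizedComplex

/-! ### Restriction to `V_{[α]_M} ⊕ V_{[α]_M}*` and matrices -/

section Restriction

variable {n : Type} [Fintype n] [DecidableEq n] {𝔤 : LieSubalgebra ℝ (Matrix n n ℝ)}

/-- The element `w` of `𝔫⁻ ⊕ (𝔫⁻)*` is the image of the element `v` of
`V_{[α]_M} ⊕ V_{[α]_M}*` under the inclusion, where a linear form on `V_{[α]_M}` is extended by zero
on the root spaces `𝔤_γ` of the `γ ∈ Π⁻` which are not `M`-equivalent to `α`. -/
structure IsInclusion (P : Set (Module.Dual ℝ (cartan 𝔤))) (α : Module.Dual ℝ (cartan 𝔤))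
    (v : classSpace P α × Module.Dual ℝ (classSpace P α))
    (w : nMinus P × Module.Dual ℝ (nMinus P)) : Prop where
  fst_eq : (w.1 : 𝔤) = (v.1 : 𝔤)
  snd_eq : ∀ (Y : classSpace P α) (Y' : nMinus P), (Y' : 𝔤) = (Y : 𝔤) → w.2 Y' = v.2 Y
  snd_eq_zero : ∀ γ ∈ negRoots P, γ ∉ mClass P α → ∀ Y : nMinus P,
    (Y : 𝔤) ∈ rootSpace 𝔤 γ → w.2 Y = 0

/-- `J'` is the restriction `𝕁_{[α]_M}` of `𝕁 = J` to `V_{[α]_M} ⊕ V_{[α]_M}*`. -/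
def IsRestriction (P : Set (Module.Dual ℝ (cartan 𝔤))) (α : Module.Dual ℝ (cartan 𝔤))
    (J : InvariantGCS (isotropyRep P)) (J' : InvariantGCS (classRep P α)) : Prop :=
  ∀ v w, IsInclusion P α v w → IsInclusion P α (J'.toEnd v) (J.toEnd w)

/-- The matrix of an endomorphism of `V ⊕ V*` in the basis `(X_α, X_β, X_α*, X_β*)` given by a
basis `(X_α, X_β)` of `V` and its dual basis. -/
def genMatrix {V : Type} [AddCommGroup V] [Module ℝ V] (b : Module.Basis (Fin 2) ℝ V)
    (J : Module.End ℝ (V × Module.Dual ℝ V)) : Matrix (Fin 2 ⊕ Fin 2) (Fin 2 ⊕ Fin 2) ℝ :=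
  LinearMap.toMatrix (b.prod b.dualBasis) (b.prod b.dualBasis) J

/-- The structures of complex type. -/
def complexMatrix (b c : ℝ) : Matrix (Fin 2 ⊕ Fin 2) (Fin 2 ⊕ Fin 2) ℝ :=
  Matrix.fromBlocks !![b, -(1 + b ^ 2) / c; c, -b] 0 0 !![-b, -c; (1 + b ^ 2) / c, b]

/-- The structures of noncomplex type. -/
def noncomplexMatrix (a x y : ℝ) : Matrix (Fin 2 ⊕ Fin 2) (Fin 2 ⊕ Fin 2) ℝ :=
  Matrix.fromBlocks !![a, 0; 0, a] !![0, -x; x, 0] !![0, -y; y, 0] !![-a, 0; 0, -a]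

end Restriction

/-- The subspace `({0} × ℝ*) ∪ (ℝ* × ℝ)` of `ℝ²`. -/
abbrev ParamSpace : Type := {p : ℝ × ℝ // (p.1 = 0 ∧ p.2 ≠ 0) ∨ p.1 ≠ 0}

end

end RealFlag

/-!
All the algebras in question are realized by matrices with a diagonal Cartan subalgebra `𝔞`, so the
roots are differences of diagonal entries, and a matrix is a root vector exactly when the places of
its nonzero entries all have the same weight (`mem_rootSpace_iff`). The elements of `M` are
conjugations by orthogonal matrices commuting with `𝔞`, which are essentially diagonal sign
matrices. Hence `M` acts on every root space, a line, by a character with values `± 1`, and two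
roots are `M`-equivalent if and only if their characters agree.

In each of the four types a fibre of `α ↦ χ_α` consists of two pairs of opposite roots
(`HasPairedRoots`). That it contains these roots follows from an identity between the signs:
the determinant is `1` for `𝔰𝔩(4)`, the signs commute with the invariant form for `𝔰𝔬(l,l)`, with
the centre of `𝔨` for `𝔰𝔬(3,2)`, and with the cross products for `G₂`. That it contains no others is
seen from the elements `exp (π Z) = 1 + 2 Z²` of `M`, where `Z ∈ 𝔤` is skew-symmetric with
`Z³ = -Z`; for `𝔰𝔬(l,l)` this needs `l ≥ 5`. As a set of positive roots meets each pair of opposite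
roots once, the classes in `Π⁻` have two elements.

So `𝔫⁻` is the sum of its isotypic summands `V_{[α]_M}`, planes on which `M` acts by distinct sign
characters. As these characters are their own inverses, every `M`-equivariant endomorphism of
`𝔫⁻ ⊕ (𝔫⁻)*` is block diagonal, and so is every invariant `2`-form; hence the moduli space is the
product of those of the planes (`SignDecomposition.exists_moduli_equiv`). On a plane the invariance
condition is void. A `4 × 4` matrix that is skew for the pairing and has square `-1` is of
noncomplex or of complex type, the `B`-transformations fix the structures of complex type, and they
change only `a` and `y` in those of noncomplex type, transitively for given `x`
(`exists_moduli_equiv_paramSpace`). The parameter space is the punctured plane, which retracts to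
the circle (`homotopyEquiv_torus`).
-/

namespace RealFlag

noncomputable section

/-! ### Invariant structures on a direct sum of isotypic summands -/

section Block

variable {Γ V : Type} [Group Γ] [AddCommGroup V] [Module ℝ V]
  {d : Type} [Fintype d] {W : d → Type} [∀ j, AddCommGroup (W j)]
  [∀ j, Module ℝ (W j)]

/-- The representation `ρ` on `V` is the direct sum of the representations `σ j` on `W j`, with
inclusions `ι j` and projections `π j`, and `Γ` acts on `W j` by the sign character `χ j`; these
characters are pairwise distinct. -/
structure SignDecomposition (ρ : Representation ℝ Γ V) (σ : ∀ j, Representation ℝ Γ (W j))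
    (ι : ∀ j, W j →ₗ[ℝ] V) (π : ∀ j, V →ₗ[ℝ] W j) (χ : d → Γ → ℝ) : Prop where
  proj_incl : ∀ j x, π j (ι j x) = x
  proj_incl_ne : ∀ j k, j ≠ k → ∀ x, π k (ι j x) = 0
  sum_incl_proj : ∀ x, ∑ j, ι j (π j x) = x
  act : ∀ g j x, ρ g (ι j x) = χ j g • ι j x
  act_summand : ∀ g j x, σ j g x = χ j g • x
  mul_self : ∀ g j, χ j g * χ j g = 1
  inv : ∀ g j, χ j g⁻¹ = χ j g
  separate : ∀ j k, j ≠ k → ∃ g, χ j g ≠ χ k g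

/-- The inclusion `W ⊕ W* → V ⊕ V*` attached to an inclusion `ι` with left inverse `π`. -/
def genIncl {W V : Type} [AddCommGroup V] [Module ℝ V] [AddCommGroup W] [Module ℝ W]
    (ι : W →ₗ[ℝ] V) (π : V →ₗ[ℝ] W) : W × Module.Dual ℝ W →ₗ[ℝ] V × Module.Dual ℝ V :=
  ι.prodMap π.dualMap

theorem genIncl_fst {W V : Type} [AddCommGroup V] [Module ℝ V] [AddCommGroup W]
    [Module ℝ W] (ι : W →ₗ[ℝ] V) (π : V →ₗ[ℝ] W) (v : W × Module.Dual ℝ W) :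
    (genIncl ι π v).1 = ι v.1 := rfl

theorem genIncl_snd_apply {W V : Type} [AddCommGroup V] [Module ℝ V] [AddCommGroup W]
    [Module ℝ W] (ι : W →ₗ[ℝ] V) (π : V →ₗ[ℝ] W) (v : W × Module.Dual ℝ W) (x : V) :
    (genIncl ι π v).2 x = v.2 (π x) := rfl

theorem genPairing_genIncl {W V : Type} [AddCommGroup V] [Module ℝ V] [AddCommGroup W]
    [Module ℝ W] (ι : W →ₗ[ℝ] V) (π : V →ₗ[ℝ] W) (v : W × Module.Dual ℝ W)
    (w : V × Module.Dual ℝ V) :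
    genPairing (genIncl ι π v) w = genPairing v (genIncl π ι w) := by
  simp [genPairing, genIncl]

theorem genPairing_comm (v w : V × Module.Dual ℝ V) : genPairing v w = genPairing w v := by
  simp [genPairing, add_comm]

theorem InvariantGCS.ext' {ρ : Representation ℝ Γ V} {J J' : InvariantGCS ρ}
    (h : J.toEnd = J'.toEnd) : J = J' := by
  cases J; cases J'; cases h; rfl

theorem InvariantGCS.apply_apply {ρ : Representation ℝ Γ V} (J : InvariantGCS ρ)
    (v : V × Module.Dual ℝ V) : J.toEnd (J.toEnd v) = -v :=
  LinearMap.congr_fun J.sq_eq v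

/-- A map that acts on `V` by the scalar `s` and whose inverse does so too acts on `V ⊕ V*` by
`s`. -/
theorem prod_dual_apply_of_scalar {ρ : Representation ℝ Γ V} {g : Γ} {s : ℝ}
    (h : ∀ x, ρ g x = s • x) (h' : ∀ x, ρ g⁻¹ x = s • x) (v : V × Module.Dual ℝ V) :
    (ρ.prod ρ.dual) g v = s • v := by
  refine Prod.ext (h v.1) (LinearMap.ext fun x => ?_)
  change v.2 (ρ g⁻¹ x) = s • v.2 x
  rw [h', map_smul]

namespace SignDecomposition

variable {ρ : Representation ℝ Γ V} {σ : ∀ j, Representation ℝ Γ (W j)}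
    {ι : ∀ j, W j →ₗ[ℝ] V} {π : ∀ j, V →ₗ[ℝ] W j} {χ : d → Γ → ℝ}

theorem act_proj (h : SignDecomposition ρ σ ι π χ) (g : Γ) (j : d) (x : V) :
    π j (ρ g x) = χ j g • π j x := by
  conv_lhs => rw [← h.sum_incl_proj x]
  rw [map_sum, map_sum, Finset.sum_eq_single j]
  · rw [h.act, map_smul, h.proj_incl]
  · intro k _ hk
    rw [h.act, map_smul, h.proj_incl_ne _ _ hk, smul_zero]
  · simp

theorem genProj_genIncl (h : SignDecomposition ρ σ ι π χ) (j : d) (v) :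
    genIncl (π j) (ι j) (genIncl (ι j) (π j) v) = v := by
  refine Prod.ext (h.proj_incl j _) (LinearMap.ext fun x => ?_)
  exact congrArg v.2 (h.proj_incl j x)

theorem genProj_genIncl_ne (h : SignDecomposition ρ σ ι π χ) {j k : d} (hjk : j ≠ k) (v) :
    genIncl (π k) (ι k) (genIncl (ι j) (π j) v) = 0 := by
  refine Prod.ext (h.proj_incl_ne j k hjk _) (LinearMap.ext fun x => ?_)
  change v.2 (π j (ι k x)) = 0
  rw [h.proj_incl_ne k j hjk.symm, map_zero]

theorem sum_genIncl_genProj (h : SignDecomposition ρ σ ι π χ) (v : V × Module.Dual ℝ V) :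
    ∑ j, genIncl (ι j) (π j) (genIncl (π j) (ι j) v) = v := by
  refine Prod.ext ?_ (LinearMap.ext fun x => ?_)
  · rw [Prod.fst_sum]
    exact h.sum_incl_proj v.1
  · rw [Prod.snd_sum, LinearMap.sum_apply]
    conv_rhs => rw [← h.sum_incl_proj x, map_sum]
    rfl

theorem act_genIncl (h : SignDecomposition ρ σ ι π χ) (g : Γ) (j : d) (v) :
    (ρ.prod ρ.dual) g (genIncl (ι j) (π j) v) = χ j g • genIncl (ι j) (π j) v := by
  refine Prod.ext (h.act g j _) (LinearMap.ext fun x => ?_)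
  change v.2 (π j (ρ g⁻¹ x)) = χ j g • v.2 (π j x)
  rw [h.act_proj, map_smul, h.inv]

theorem act_genProj (h : SignDecomposition ρ σ ι π χ) (g : Γ) (j : d) (v) :
    genIncl (π j) (ι j) ((ρ.prod ρ.dual) g v) = χ j g • genIncl (π j) (ι j) v := by
  refine Prod.ext (h.act_proj g j _) (LinearMap.ext fun x => ?_)
  change v.2 (ρ g⁻¹ (ι j x)) = χ j g • v.2 (ι j x)
  rw [h.act, map_smul, h.inv]

theorem act_gen_summand (h : SignDecomposition ρ σ ι π χ) (g : Γ) (j : d) (v) :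
    ((σ j).prod (σ j).dual) g v = χ j g • v :=
  prod_dual_apply_of_scalar (h.act_summand g j)
    (fun x => by rw [h.act_summand, h.inv]) v

/-- An invariant structure has no component between different isotypic summands. -/
theorem genProj_toEnd_ne (h : SignDecomposition ρ σ ι π χ) (J : InvariantGCS ρ) {j k : d}
    (hjk : j ≠ k) (v) : genIncl (π k) (ι k) (J.toEnd (genIncl (ι j) (π j) v)) = 0 := by
  obtain ⟨g, hg⟩ := h.separate j k hjk
  have e := LinearMap.congr_fun (J.invariant g) (genIncl (ι j) (π j) v)
  change (ρ.prod ρ.dual) g (J.toEnd _) = J.toEnd ((ρ.prod ρ.dual) g _) at e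
  have e2 := congrArg (genIncl (π k) (ι k)) e
  rw [h.act_genProj, h.act_genIncl, map_smul, map_smul] at e2
  by_contra hne
  exact hg (smul_left_injective ℝ hne e2.symm)

theorem toEnd_genIncl (h : SignDecomposition ρ σ ι π χ) (J : InvariantGCS ρ) (j : d) (v) :
    J.toEnd (genIncl (ι j) (π j) v) =
      genIncl (ι j) (π j) (genIncl (π j) (ι j) (J.toEnd (genIncl (ι j) (π j) v))) := by
  conv_lhs => rw [← h.sum_genIncl_genProj (J.toEnd _)]
  rw [Finset.sum_eq_single j]
  · intro k _ hk
    rw [h.genProj_toEnd_ne J hk.symm, map_zero]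
  · simp

/-- The restriction of an invariant structure to the summand `W j ⊕ (W j)*`. -/
def restrict (h : SignDecomposition ρ σ ι π χ) (J : InvariantGCS ρ) (j : d) :
    InvariantGCS (σ j) where
  toEnd := genIncl (π j) (ι j) ∘ₗ J.toEnd ∘ₗ genIncl (ι j) (π j)
  sq_eq := by
    refine LinearMap.ext fun v => ?_
    change genIncl (π j) (ι j) (J.toEnd (genIncl (ι j) (π j) (genIncl (π j) (ι j)
      (J.toEnd (genIncl (ι j) (π j) v))))) = -v
    rw [← h.toEnd_genIncl, J.apply_apply, map_neg, h.genProj_genIncl]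
  orthogonal := by
    intro v w
    change genPairing (genIncl (π j) (ι j) (J.toEnd (genIncl (ι j) (π j) v)))
      (genIncl (π j) (ι j) (J.toEnd (genIncl (ι j) (π j) w))) = _
    rw [genPairing_genIncl, ← h.toEnd_genIncl, J.orthogonal, genPairing_genIncl,
      h.genProj_genIncl]
  invariant := by
    intro g
    refine LinearMap.ext fun v => ?_
    change ((σ j).prod (σ j).dual) g (genIncl (π j) (ι j) (J.toEnd (genIncl (ι j) (π j) v))) =
      genIncl (π j) (ι j) (J.toEnd (genIncl (ι j) (π j) (((σ j).prod (σ j).dual) g v)))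
    simp only [h.act_gen_summand, map_smul]

theorem genIncl_restrict (h : SignDecomposition ρ σ ι π χ) (J : InvariantGCS ρ) (j : d) (v) :
    genIncl (ι j) (π j) ((h.restrict J j).toEnd v) = J.toEnd (genIncl (ι j) (π j) v) :=
  (h.toEnd_genIncl J j v).symm

/-- Endomorphisms of `V ⊕ V*` are determined by their restrictions to the summands. -/
theorem end_ext (h : SignDecomposition ρ σ ι π χ) {F G : Module.End ℝ (V × Module.Dual ℝ V)}
    (e : ∀ j v, F (genIncl (ι j) (π j) v) = G (genIncl (ι j) (π j) v)) : F = G := by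
  refine LinearMap.ext fun v => ?_
  rw [← h.sum_genIncl_genProj v, map_sum, map_sum]
  exact Finset.sum_congr rfl fun j _ => e j _

/-- The summands `W j ⊕ (W j)*` are orthogonal to each other. -/
theorem genPairing_eq_sum (h : SignDecomposition ρ σ ι π χ) (v w : V × Module.Dual ℝ V) :
    genPairing v w = ∑ j, genPairing (genIncl (π j) (ι j) v) (genIncl (π j) (ι j) w) := by
  have e : ∀ j, genPairing (genIncl (π j) (ι j) v) (genIncl (π j) (ι j) w) =
      (v.2 (ι j (π j w.1)) + w.2 (ι j (π j v.1))) / 2 := fun j => rfl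
  simp only [e, ← Finset.sum_div, Finset.sum_add_distrib, ← map_sum, h.sum_incl_proj]
  rfl

/-- The block diagonal endomorphism with given blocks. -/
def glueEnd (ι : ∀ j, W j →ₗ[ℝ] V) (π : ∀ j, V →ₗ[ℝ] W j)
    (F : ∀ j, Module.End ℝ (W j × Module.Dual ℝ (W j))) :
    Module.End ℝ (V × Module.Dual ℝ V) :=
  ∑ j, genIncl (ι j) (π j) ∘ₗ F j ∘ₗ genIncl (π j) (ι j)

theorem glueEnd_apply (F : ∀ j, Module.End ℝ (W j × Module.Dual ℝ (W j))) (v) :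
    glueEnd ι π F v = ∑ j, genIncl (ι j) (π j) (F j (genIncl (π j) (ι j) v)) := by
  simp [glueEnd]

theorem glueEnd_genIncl (h : SignDecomposition ρ σ ι π χ)
    (F : ∀ j, Module.End ℝ (W j × Module.Dual ℝ (W j))) (j : d) (v) :
    glueEnd ι π F (genIncl (ι j) (π j) v) = genIncl (ι j) (π j) (F j v) := by
  rw [glueEnd_apply, Finset.sum_eq_single j]
  · rw [h.genProj_genIncl]
  · intro k _ hk
    rw [h.genProj_genIncl_ne hk.symm, map_zero, map_zero]
  · simp

theorem genProj_glueEnd (h : SignDecomposition ρ σ ι π χ)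
    (F : ∀ j, Module.End ℝ (W j × Module.Dual ℝ (W j))) (j : d) (v) :
    genIncl (π j) (ι j) (glueEnd ι π F v) = F j (genIncl (π j) (ι j) v) := by
  rw [glueEnd_apply, map_sum, Finset.sum_eq_single j]
  · rw [h.genProj_genIncl]
  · intro k _ hk
    rw [h.genProj_genIncl_ne hk]
  · simp

/-- The invariant structure on `V ⊕ V*` with given restrictions to the summands. -/
def glue (h : SignDecomposition ρ σ ι π χ) (J : ∀ j, InvariantGCS (σ j)) : InvariantGCS ρ where
  toEnd := glueEnd ι π fun j => (J j).toEnd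
  sq_eq := by
    refine h.end_ext fun j v => ?_
    change glueEnd ι π (fun j => (J j).toEnd) (glueEnd ι π (fun j => (J j).toEnd) _) =
      -genIncl (ι j) (π j) v
    rw [h.glueEnd_genIncl, h.glueEnd_genIncl, (J j).apply_apply, map_neg]
  orthogonal := by
    intro v w
    rw [h.genPairing_eq_sum, h.genPairing_eq_sum v w]
    refine Finset.sum_congr rfl fun j _ => ?_
    rw [h.genProj_glueEnd, h.genProj_glueEnd, (J j).orthogonal]
  invariant := by
    intro g
    refine h.end_ext fun j v => ?_
    change (ρ.prod ρ.dual) g (glueEnd ι π _ _) = glueEnd ι π _ ((ρ.prod ρ.dual) g _)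
    rw [h.act_genIncl, map_smul, h.glueEnd_genIncl, h.act_genIncl]

theorem restrict_glue (h : SignDecomposition ρ σ ι π χ) (J : ∀ j, InvariantGCS (σ j)) (j : d) :
    h.restrict (h.glue J) j = J j := by
  refine InvariantGCS.ext' (LinearMap.ext fun v => ?_)
  change genIncl (π j) (ι j) (glueEnd ι π _ (genIncl (ι j) (π j) v)) = _
  rw [h.genProj_glueEnd, h.genProj_genIncl]

/-- An invariant `2`-form on `V` is the orthogonal sum of its restrictions to the summands, so the
`B`-transformations are block diagonal. -/
theorem expB_genIncl (h : SignDecomposition ρ σ ι π χ) {B : V →ₗ[ℝ] V →ₗ[ℝ] ℝ}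
    (hB : IsInvariantTwoForm ρ B) (j : d) (v) :
    expB B (genIncl (ι j) (π j) v) =
      genIncl (ι j) (π j) (expB (B.compl₁₂ (ι j) (ι j)) v) := by
  refine Prod.ext rfl (LinearMap.ext fun x => ?_)
  change v.2 (π j x) + B (ι j v.1) x = v.2 (π j x) + B (ι j v.1) (ι j (π j x))
  congr 1
  conv_lhs => rw [← h.sum_incl_proj x]
  rw [map_sum, Finset.sum_eq_single j]
  · intro k _ hk
    obtain ⟨g, hg⟩ := h.separate k j hk
    have e := hB.invariant g (ι j v.1) (ι k (π k x))
    rw [h.act, h.act, map_smul, LinearMap.map_smul₂, smul_eq_mul, smul_eq_mul] at e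
    have h1 := h.mul_self g j
    have h2 := h.mul_self g k
    have e3 : (χ j g * χ k g - 1) * B (ι j v.1) (ι k (π k x)) = 0 := by linarith
    refine (mul_eq_zero.1 e3).resolve_left fun e4 => hg ?_
    calc χ k g = χ j g * χ j g * χ k g := by rw [h1, one_mul]
      _ = χ j g * (χ j g * χ k g) := by ring
      _ = χ j g := by rw [sub_eq_zero.1 e4, mul_one]
  · simp

theorem isInvariantTwoForm_restrict (h : SignDecomposition ρ σ ι π χ)
    {B : V →ₗ[ℝ] V →ₗ[ℝ] ℝ} (hB : IsInvariantTwoForm ρ B) (j : d) :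
    IsInvariantTwoForm (σ j) (B.compl₁₂ (ι j) (ι j)) := by
  refine ⟨fun X => hB.alternating _, fun g X Y => ?_⟩
  rw [LinearMap.compl₁₂_apply, LinearMap.compl₁₂_apply, h.act_summand, h.act_summand,
    map_smul (ι j), map_smul (ι j), ← h.act, ← h.act, hB.invariant]

theorem isInvariantTwoForm_sum (h : SignDecomposition ρ σ ι π χ)
    {B : ∀ j, W j →ₗ[ℝ] W j →ₗ[ℝ] ℝ} (hB : ∀ j, IsInvariantTwoForm (σ j) (B j)) :
    IsInvariantTwoForm ρ (∑ j, (B j).compl₁₂ (π j) (π j)) := by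
  refine ⟨fun X => ?_, fun g X Y => ?_⟩
  · simp [(hB _).alternating]
  · simp only [LinearMap.sum_apply, LinearMap.compl₁₂_apply, h.act_proj, ← h.act_summand,
      (hB _).invariant]

theorem compl_sum_compl (h : SignDecomposition ρ σ ι π χ)
    (B : ∀ j, W j →ₗ[ℝ] W j →ₗ[ℝ] ℝ) (j : d) :
    (∑ k, (B k).compl₁₂ (π k) (π k)).compl₁₂ (ι j) (ι j) = B j := by
  refine LinearMap.ext fun x => LinearMap.ext fun y => ?_
  simp only [LinearMap.sum_apply, LinearMap.compl₁₂_apply]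
  rw [Finset.sum_eq_single j]
  · rw [h.proj_incl, h.proj_incl]
  · intro k _ hk
    rw [h.proj_incl_ne _ _ hk.symm, map_zero, LinearMap.zero_apply]
  · simp

theorem rel_iff (h : SignDecomposition ρ σ ι π χ) (J J' : InvariantGCS ρ) :
    bSetoid ρ J J' ↔ ∀ j, bSetoid (σ j) (h.restrict J j) (h.restrict J' j) := by
  constructor
  · rintro ⟨B, hB, e⟩ j
    have hB' : IsInvariantTwoForm ρ (-B) :=
      ⟨fun X => by simp [hB.alternating], fun g X Y => by simp [hB.invariant]⟩
    refine ⟨B.compl₁₂ (ι j) (ι j), h.isInvariantTwoForm_restrict hB j, LinearMap.ext fun v => ?_⟩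
    change genIncl (π j) (ι j) (J'.toEnd (genIncl (ι j) (π j) v)) =
      expB (-B.compl₁₂ (ι j) (ι j)) ((h.restrict J j).toEnd (expB (B.compl₁₂ (ι j) (ι j)) v))
    rw [e]
    change genIncl (π j) (ι j) (expB (-B) (J.toEnd (expB B (genIncl (ι j) (π j) v)))) = _
    rw [h.expB_genIncl hB, ← h.genIncl_restrict, h.expB_genIncl hB', h.genProj_genIncl]
    rfl
  · intro H
    choose B hB e using H
    have hS := h.isInvariantTwoForm_sum hB
    have hS' : IsInvariantTwoForm ρ (-∑ j, (B j).compl₁₂ (π j) (π j)) :=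
      ⟨fun X => by simpa using hS.alternating X, fun g X Y => by simpa using hS.invariant g X Y⟩
    refine ⟨_, hS, h.end_ext fun j v => ?_⟩
    change _ = expB (-∑ k, (B k).compl₁₂ (π k) (π k))
      (J.toEnd (expB (∑ k, (B k).compl₁₂ (π k) (π k)) (genIncl (ι j) (π j) v)))
    have hneg : (-∑ k, (B k).compl₁₂ (π k) (π k)).compl₁₂ (ι j) (ι j) = -B j := by
      rw [← h.compl_sum_compl B j]
      rfl
    rw [h.expB_genIncl hS, ← h.genIncl_restrict J, h.expB_genIncl hS', hneg, h.compl_sum_compl,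
      ← h.genIncl_restrict, e]
    rfl

/-- Restriction to the summands identifies the moduli space of `V` with the product of the moduli
spaces of the summands. -/
theorem exists_moduli_equiv (h : SignDecomposition ρ σ ι π χ) :
    ∃ Φ : Moduli ρ ≃ ∀ j, Moduli (σ j),
      ∀ J j, Φ (Moduli.mk J) j = Moduli.mk (h.restrict J j) := by
  let f : Moduli ρ → ∀ j, Moduli (σ j) := fun q j =>
    Quotient.lift (fun J => Moduli.mk (h.restrict J j))
      (fun J J' hJ => Quotient.sound ((h.rel_iff J J').1 hJ j)) q
  refine ⟨Equiv.ofBijective f ⟨?_, ?_⟩, fun J j => rfl⟩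
  · intro q q'
    refine Quotient.inductionOn₂ q q' fun J J' e => ?_
    exact Quotient.sound ((h.rel_iff J J').2 fun j => Quotient.exact (congrFun e j))
  · intro q
    refine ⟨Moduli.mk (h.glue fun j => (q j).out), funext fun j => ?_⟩
    change Moduli.mk (h.restrict (h.glue _) j) = _
    rw [h.restrict_glue]
    exact Quotient.out_eq _

end SignDecomposition

end Block

/-! ### Planes on which a group acts by signs -/

section Plane

variable {W : Type} [AddCommGroup W] [Module ℝ W] (b : Module.Basis (Fin 2) ℝ W)

theorem genMatrix_mul (F G : Module.End ℝ (W × Module.Dual ℝ W)) :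
    genMatrix b (F * G) = genMatrix b F * genMatrix b G :=
  LinearMap.toMatrix_mul _ _ _

theorem genMatrix_neg_one : genMatrix b (-1) = -1 := by
  rw [genMatrix, ← LinearMap.toMatrix_one (b.prod b.dualBasis)]
  exact map_neg (LinearMap.toMatrix (b.prod b.dualBasis) (b.prod b.dualBasis)).toLinearMap 1

theorem genMatrix_injective : Function.Injective (genMatrix b) :=
  (LinearMap.toMatrix (b.prod b.dualBasis) (b.prod b.dualBasis)).injective

theorem repr_prod_dualBasis_inl (v : W × Module.Dual ℝ W) (i : Fin 2) :
    (b.prod b.dualBasis).repr v (Sum.inl i) = b.repr v.1 i := by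
  simp

theorem repr_prod_dualBasis_inr (v : W × Module.Dual ℝ W) (i : Fin 2) :
    (b.prod b.dualBasis).repr v (Sum.inr i) = v.2 (b i) := by
  simp

theorem genPairing_eq_sum_repr (v w : W × Module.Dual ℝ W) :
    genPairing v w = (∑ i, (b.prod b.dualBasis).repr v i.swap *
      (b.prod b.dualBasis).repr w i) / 2 := by
  have key : ∀ (f : Module.Dual ℝ W) (x : W), f x = ∑ i, f (b i) * b.repr x i := by
    intro f x
    conv_lhs => rw [← b.sum_repr x, map_sum]
    exact Finset.sum_congr rfl fun i _ => by rw [map_smul, smul_eq_mul, mul_comm]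
  rw [genPairing, key v.2 w.1, key w.2 v.1, Fintype.sum_sum_type]
  simp only [Sum.swap_inl, Sum.swap_inr, repr_prod_dualBasis_inl, repr_prod_dualBasis_inr]
  simp only [mul_comm]

theorem repr_apply_eq_mulVec (F : Module.End ℝ (W × Module.Dual ℝ W)) (v) (i) :
    (b.prod b.dualBasis).repr (F v) i =
      ∑ j, genMatrix b F i j * (b.prod b.dualBasis).repr v j :=
  (congrFun (LinearMap.toMatrix_mulVec_repr (b.prod b.dualBasis) (b.prod b.dualBasis) F v) i).symm

variable {Γ : Type} [Group Γ] {ρ : Representation ℝ Γ W}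

theorem genMatrix_sq (J : InvariantGCS ρ) : genMatrix b J.toEnd * genMatrix b J.toEnd = -1 := by
  rw [← genMatrix_mul, J.sq_eq, genMatrix_neg_one]

/-- An orthogonal map with square `-1` is skew. -/
theorem genMatrix_skew (J : InvariantGCS ρ) (i j) :
    genMatrix b J.toEnd i.swap j = -genMatrix b J.toEnd j.swap i := by
  classical
  set e := b.prod b.dualBasis with he
  have h1 : ∀ v w, genPairing (J.toEnd v) w = -genPairing v (J.toEnd w) := by
    intro v w
    have h := J.orthogonal v (J.toEnd w)
    rw [J.apply_apply] at h
    rw [← h]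
    simp [genPairing]
    ring
  have h2 : ∀ v j, genPairing v (e j) = e.repr v j.swap / 2 := by
    intro v j
    rw [genPairing_eq_sum_repr b, ← he, Finset.sum_eq_single j]
    · simp
    · intro k _ hk
      rw [e.repr_self, Finsupp.single_eq_of_ne hk, mul_zero]
    · simp
  have h3 : ∀ i j, genMatrix b J.toEnd i j = e.repr (J.toEnd (e j)) i := fun i j =>
    LinearMap.toMatrix_apply _ _ _ _ _
  have h := h1 (e j) (e i)
  rw [h2, genPairing_comm, h2] at h
  rw [h3, h3]
  linarith

/-- A skew matrix with square `-1` is the matrix of an invariant structure, if the group acts by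
signs. -/
theorem exists_genMatrix_eq (hρ : ∀ g, ∃ s : ℝ, (∀ x, ρ g x = s • x) ∧ ∀ x, ρ g⁻¹ x = s • x)
    (N : Matrix (Fin 2 ⊕ Fin 2) (Fin 2 ⊕ Fin 2) ℝ) (hN : N * N = -1)
    (hs : ∀ i j, N i.swap j = -N j.swap i) :
    ∃ J : InvariantGCS ρ, genMatrix b J.toEnd = N := by
  set e := b.prod b.dualBasis with he
  set F : Module.End ℝ (W × Module.Dual ℝ W) := Matrix.toLin e e N with hF
  have hFN : genMatrix b F = N := LinearMap.toMatrix_toLin _ _ _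
  have hsq : F * F = -1 := by
    apply genMatrix_injective b
    rw [genMatrix_mul, hFN, hN, genMatrix_neg_one]
  have hskew : ∀ v w, genPairing (F v) w = -genPairing v (F w) := by
    intro v w
    rw [genPairing_comm v, genPairing_eq_sum_repr b, genPairing_eq_sum_repr b, ← neg_div]
    simp only [repr_apply_eq_mulVec, hFN, Finset.sum_mul]
    rw [Finset.sum_comm, ← Finset.sum_neg_distrib]
    congr 1
    refine Finset.sum_congr rfl fun i _ => ?_
    rw [← Finset.sum_neg_distrib]
    refine Finset.sum_congr rfl fun j _ => ?_
    rw [hs]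
    ring
  refine ⟨⟨F, hsq, fun v w => ?_, fun g => ?_⟩, hFN⟩
  · have : F (F w) = -w := LinearMap.congr_fun hsq w
    rw [hskew, this]
    simp [genPairing]
    ring
  · obtain ⟨s, h1, h2⟩ := hρ g
    refine LinearMap.ext fun v => ?_
    change (ρ.prod ρ.dual) g (F v) = F ((ρ.prod ρ.dual) g v)
    rw [prod_dual_apply_of_scalar h1 h2, prod_dual_apply_of_scalar h1 h2, map_smul]

/-- A skew matrix with square `-1` is of noncomplex or of complex type. -/
theorem eq_noncomplexMatrix_or_complexMatrix {N : Matrix (Fin 2 ⊕ Fin 2) (Fin 2 ⊕ Fin 2) ℝ}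
    (hN : N * N = -1) (hs : ∀ i j, N i.swap j = -N j.swap i) :
    (∃ a x y : ℝ, a ^ 2 = x * y - 1 ∧ N = noncomplexMatrix a x y) ∨
      ∃ b c : ℝ, c ≠ 0 ∧ N = complexMatrix b c := by
  obtain ⟨p, hp⟩ : ∃ p, p = N (.inl 0) (.inl 0) := ⟨_, rfl⟩
  obtain ⟨q, hq⟩ : ∃ q, q = N (.inl 0) (.inl 1) := ⟨_, rfl⟩
  obtain ⟨r, hr⟩ : ∃ r, r = N (.inl 1) (.inl 0) := ⟨_, rfl⟩
  obtain ⟨s, hss⟩ : ∃ s, s = N (.inl 1) (.inl 1) := ⟨_, rfl⟩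
  obtain ⟨x, hx⟩ : ∃ x, x = N (.inl 1) (.inr 0) := ⟨_, rfl⟩
  obtain ⟨y, hy⟩ : ∃ y, y = N (.inr 1) (.inl 0) := ⟨_, rfl⟩
  have hM : N = Matrix.fromBlocks !![p, q; r, s] !![0, -x; x, 0] !![0, -y; y, 0]
      !![-p, -r; -q, -s] := by
    have h1 : ∀ i j, N (.inl i) (.inr j) = -N (.inl j) (.inr i) := fun i j => hs (.inr i) (.inr j)
    have h2 : ∀ i j, N (.inr i) (.inl j) = -N (.inr j) (.inl i) := fun i j => hs (.inl i) (.inl j)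
    have h3 : ∀ i j, N (.inr i) (.inr j) = -N (.inl j) (.inl i) := fun i j => hs (.inl i) (.inr j)
    ext i j
    rcases i with i | i <;> rcases j with j | j <;> fin_cases i <;> fin_cases j <;>
      simp [hp, hq, hr, hss, hx, hy, h3] <;>
      first
        | linarith [h1 0 0] | linarith [h1 0 1] | linarith [h1 1 1]
        | linarith [h2 0 0] | linarith [h2 0 1] | linarith [h2 1 1]
  clear hp hq hr hss hx hy hs
  subst hM
  have E : ∀ i j, _ = _ := fun i j => congrFun (congrFun hN i) j
  have e1 := E (.inl 0) (.inl 0)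
  have e2 := E (.inl 0) (.inl 1)
  have e3 := E (.inl 1) (.inl 0)
  have e4 := E (.inl 1) (.inl 1)
  have e5 := E (.inl 0) (.inr 0)
  have e6 := E (.inl 0) (.inr 1)
  have e7 := E (.inl 1) (.inr 1)
  have e8 := E (.inr 0) (.inl 0)
  have e9 := E (.inr 0) (.inl 1)
  have e10 := E (.inr 1) (.inl 1)
  clear E hN
  simp [Matrix.mul_apply, Fin.sum_univ_two] at e1 e2 e3 e4 e5 e6 e7 e8 e9 e10
  by_cases hxy : x = 0 ∧ y = 0
  · right
    obtain ⟨rfl, rfl⟩ := hxy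
    have hr0 : r ≠ 0 := by
      rintro rfl
      nlinarith [sq_nonneg p]
    have hsp : s = -p := by
      have : r * (p + s) = 0 := by linarith
      linarith [(mul_eq_zero.1 this).resolve_left hr0]
    have hq : q = -(1 + p ^ 2) / r := by
      field_simp
      linarith
    refine ⟨p, r, hr0, ?_⟩
    subst hsp
    ext i j
    rcases i with i | i <;> rcases j with j | j <;> fin_cases i <;> fin_cases j <;>
      simp [complexMatrix, hq]
    ring
  · left
    have hz : ∃ z, z ≠ 0 ∧ q * z = 0 ∧ r * z = 0 ∧ (p - s) * z = 0 := by
      by_cases hx : x = 0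
      · exact ⟨y, fun hy => hxy ⟨hx, hy⟩, by linarith, by linarith, by linarith⟩
      · exact ⟨x, hx, by linarith, by linarith, by linarith⟩
    obtain ⟨z, hz, hq, hr, hps⟩ := hz
    obtain rfl := (mul_eq_zero.1 hq).resolve_right hz
    obtain rfl := (mul_eq_zero.1 hr).resolve_right hz
    obtain rfl : s = p := by linarith [(mul_eq_zero.1 hps).resolve_right hz]
    exact ⟨s, x, y, by linarith, by simp [noncomplexMatrix]⟩

theorem noncomplexMatrix_sq {a x y : ℝ} (h : a ^ 2 = x * y - 1) :
    noncomplexMatrix a x y * noncomplexMatrix a x y = -1 := by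
  ext i j
  rcases i with i | i <;> rcases j with j | j <;> fin_cases i <;> fin_cases j <;>
    simp [noncomplexMatrix, Matrix.mul_apply, Fin.sum_univ_two] <;> linarith

theorem noncomplexMatrix_skew (a x y : ℝ) (i j) :
    noncomplexMatrix a x y i.swap j = -noncomplexMatrix a x y j.swap i := by
  rcases i with i | i <;> rcases j with j | j <;> fin_cases i <;> fin_cases j <;>
    simp [noncomplexMatrix]

theorem complexMatrix_sq {b c : ℝ} (h : c ≠ 0) : complexMatrix b c * complexMatrix b c = -1 := by
  ext i j
  rcases i with i | i <;> rcases j with j | j <;> fin_cases i <;> fin_cases j <;>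
    simp [complexMatrix, Matrix.mul_apply, Fin.sum_univ_two] <;> field_simp <;>
    ring

theorem complexMatrix_skew (b c : ℝ) (i j) :
    complexMatrix b c i.swap j = -complexMatrix b c j.swap i := by
  rcases i with i | i <;> rcases j with j | j <;> fin_cases i <;> fin_cases j <;>
    simp [complexMatrix] <;> ring

/-- The matrix of the `B`-transformation of the `2`-form with `B(X₀, X₁) = t`. -/
def expBMatrix (t : ℝ) : Matrix (Fin 2 ⊕ Fin 2) (Fin 2 ⊕ Fin 2) ℝ :=
  Matrix.fromBlocks 1 0 !![0, -t; t, 0] 1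

theorem genMatrix_expB {B : W →ₗ[ℝ] W →ₗ[ℝ] ℝ} (hB : ∀ X, B X X = 0) :
    genMatrix b (expB B) = expBMatrix (B (b 0) (b 1)) := by
  have hB' : B (b 1) (b 0) = -B (b 0) (b 1) := by
    have := hB (b 0 + b 1)
    simp [hB] at this
    linarith
  ext i j
  rcases i with i | i <;> rcases j with j | j <;> fin_cases i <;> fin_cases j <;>
    simp [genMatrix, LinearMap.toMatrix_apply, expB, expBMatrix, hB, hB', Module.Basis.prod_apply]

theorem expBMatrix_conj_noncomplexMatrix (a x y t : ℝ) :
    expBMatrix (-t) * noncomplexMatrix a x y * expBMatrix t =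
      noncomplexMatrix (a - t * x) x (y - 2 * t * a + t ^ 2 * x) := by
  ext i j
  rcases i with i | i <;> rcases j with j | j <;> fin_cases i <;> fin_cases j <;>
    simp [noncomplexMatrix, expBMatrix, Matrix.mul_apply, Fin.sum_univ_two, Matrix.one_apply] <;>
    ring

theorem expBMatrix_conj_complexMatrix (b c t : ℝ) :
    expBMatrix (-t) * complexMatrix b c * expBMatrix t = complexMatrix b c := by
  ext i j
  rcases i with i | i <;> rcases j with j | j <;> fin_cases i <;> fin_cases j <;>
    simp [complexMatrix, expBMatrix, Matrix.mul_apply, Fin.sum_univ_two, Matrix.one_apply] <;>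
    ring

open Classical in
/-- The parameter of a structure of noncomplex type is `(0, x)` and that of a structure of complex
type is `(c, b)`: both are read off from the same entries, because the entry at the place of `c`
vanishes for the noncomplex type and the entry at the place of `x` for the complex type. -/
def matrixParam (N : Matrix (Fin 2 ⊕ Fin 2) (Fin 2 ⊕ Fin 2) ℝ) : ℝ × ℝ :=
  (N (.inl 1) (.inl 0),
    if N (.inl 1) (.inr 0) = 0 then N (.inl 0) (.inl 0) else N (.inl 1) (.inr 0))

theorem matrixParam_noncomplexMatrix {a x y : ℝ} (h : a ^ 2 = x * y - 1) :
    x ≠ 0 ∧ matrixParam (noncomplexMatrix a x y) = (0, x) := by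
  have hx : x ≠ 0 := by
    rintro rfl
    nlinarith [sq_nonneg a]
  exact ⟨hx, by simp [matrixParam, noncomplexMatrix, hx]⟩

theorem matrixParam_complexMatrix (b c : ℝ) : matrixParam (complexMatrix b c) = (c, b) := by
  simp [matrixParam, complexMatrix]

theorem matrixParam_mem {N : Matrix (Fin 2 ⊕ Fin 2) (Fin 2 ⊕ Fin 2) ℝ}
    (hN : N * N = -1) (hs : ∀ i j, N i.swap j = -N j.swap i) :
    ((matrixParam N).1 = 0 ∧ (matrixParam N).2 ≠ 0) ∨ (matrixParam N).1 ≠ 0 := by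
  rcases eq_noncomplexMatrix_or_complexMatrix hN hs with ⟨a, x, y, h, rfl⟩ | ⟨b, c, h, rfl⟩
  · obtain ⟨hx, e⟩ := matrixParam_noncomplexMatrix h
    rw [e]
    exact Or.inl ⟨rfl, hx⟩
  · rw [matrixParam_complexMatrix]
    exact Or.inr h

/-- Two skew matrices with square `-1` are conjugate under `B`-transformations if and only if they
have the same parameter. -/
theorem matrixParam_eq_iff {N N' : Matrix (Fin 2 ⊕ Fin 2) (Fin 2 ⊕ Fin 2) ℝ}
    (hN : N * N = -1) (hs : ∀ i j, N i.swap j = -N j.swap i)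
    (hN' : N' * N' = -1) (hs' : ∀ i j, N' i.swap j = -N' j.swap i) :
    matrixParam N = matrixParam N' ↔ ∃ t, N' = expBMatrix (-t) * N * expBMatrix t := by
  constructor
  · intro e
    rcases eq_noncomplexMatrix_or_complexMatrix hN hs with ⟨a, x, y, h, rfl⟩ | ⟨b, c, h, rfl⟩ <;>
    rcases eq_noncomplexMatrix_or_complexMatrix hN' hs' with
      ⟨a', x', y', h', rfl⟩ | ⟨b', c', h', rfl⟩
    · obtain ⟨hx, e1⟩ := matrixParam_noncomplexMatrix h
      rw [e1, (matrixParam_noncomplexMatrix h').2] at e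
      obtain rfl : x = x' := congrArg Prod.snd e
      refine ⟨(a - a') / x, ?_⟩
      rw [expBMatrix_conj_noncomplexMatrix]
      have h1 : a - (a - a') / x * x = a' := by field_simp; ring
      have h2 : y - 2 * ((a - a') / x) * a + ((a - a') / x) ^ 2 * x = y' := by
        field_simp
        linarith
      rw [h1, h2]
    · rw [(matrixParam_noncomplexMatrix h).2, matrixParam_complexMatrix] at e
      exact absurd (congrArg Prod.fst e).symm h'
    · rw [(matrixParam_noncomplexMatrix h').2, matrixParam_complexMatrix] at e
      exact absurd (congrArg Prod.fst e) h
    · rw [matrixParam_complexMatrix, matrixParam_complexMatrix] at e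
      obtain ⟨rfl, rfl⟩ := Prod.ext_iff.1 e
      exact ⟨0, (expBMatrix_conj_complexMatrix _ _ _).symm⟩
  · rintro ⟨t, rfl⟩
    rcases eq_noncomplexMatrix_or_complexMatrix hN hs with ⟨a, x, y, h, rfl⟩ | ⟨b, c, h, rfl⟩
    · have h' : (a - t * x) ^ 2 = x * (y - 2 * t * a + t ^ 2 * x) - 1 := by linarith
      rw [expBMatrix_conj_noncomplexMatrix, (matrixParam_noncomplexMatrix h).2,
        (matrixParam_noncomplexMatrix h').2]
    · rw [expBMatrix_conj_complexMatrix]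

theorem exists_twoForm (t : ℝ) :
    ∃ B : W →ₗ[ℝ] W →ₗ[ℝ] ℝ, (∀ X, B X X = 0) ∧ B (b 0) (b 1) = t := by
  refine ⟨t • ((LinearMap.mul ℝ ℝ).compl₁₂ (b.coord 0) (b.coord 1) -
    (LinearMap.mul ℝ ℝ).compl₁₂ (b.coord 1) (b.coord 0)), fun X => ?_, ?_⟩
  · simp [mul_comm]
  · simp

theorem bSetoid_iff (hρ : ∀ g, ∃ s : ℝ, s * s = 1 ∧ (∀ x, ρ g x = s • x) ∧ ∀ x, ρ g⁻¹ x = s • x)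
    (J J' : InvariantGCS ρ) : bSetoid ρ J J' ↔
      matrixParam (genMatrix b J.toEnd) = matrixParam (genMatrix b J'.toEnd) := by
  rw [matrixParam_eq_iff (genMatrix_sq b J) (genMatrix_skew b J) (genMatrix_sq b J')
    (genMatrix_skew b J')]
  have key : ∀ B : W →ₗ[ℝ] W →ₗ[ℝ] ℝ, (∀ X, B X X = 0) →
      genMatrix b (expB (-B) * J.toEnd * expB B) =
      expBMatrix (-(B (b 0) (b 1))) * genMatrix b J.toEnd * expBMatrix (B (b 0) (b 1)) := by
    intro B hB
    rw [genMatrix_mul, genMatrix_mul, genMatrix_expB b hB,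
      genMatrix_expB b (B := -B) (fun X => by simp [hB])]
    rfl
  constructor
  · rintro ⟨B, hB, e⟩
    exact ⟨B (b 0) (b 1), by rw [e, key B hB.alternating]⟩
  · rintro ⟨t, e⟩
    obtain ⟨B, hB, rfl⟩ := exists_twoForm b t
    refine ⟨B, ⟨hB, fun g X Y => ?_⟩, genMatrix_injective b ?_⟩
    · obtain ⟨s, h1, h2, -⟩ := hρ g
      rw [h2, h2, map_smul, LinearMap.map_smul₂, smul_smul, h1, one_smul]
    · rw [e, key B hB]

/-- The moduli space of a plane on which the group acts by signs, with its two types of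
structures. -/
theorem exists_moduli_equiv_paramSpace
    (hρ : ∀ g, ∃ s : ℝ, s * s = 1 ∧ (∀ x, ρ g x = s • x) ∧ ∀ x, ρ g⁻¹ x = s • x) :
    ∃ Ψ : Moduli ρ ≃ ParamSpace, ∀ J : InvariantGCS ρ,
      (∃ a x y : ℝ, a ^ 2 = x * y - 1 ∧ genMatrix b J.toEnd = noncomplexMatrix a x y ∧
        (Ψ (Moduli.mk J)).1 = (0, x)) ∨
      (∃ b' c : ℝ, c ≠ 0 ∧ genMatrix b J.toEnd = complexMatrix b' c ∧
        (Ψ (Moduli.mk J)).1 = (c, b')) := by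
  let f : Moduli ρ → ParamSpace := Quotient.lift
    (fun J => ⟨matrixParam (genMatrix b J.toEnd),
      matrixParam_mem (genMatrix_sq b J) (genMatrix_skew b J)⟩)
    (fun J J' h => Subtype.ext ((bSetoid_iff b hρ J J').1 h))
  have hρ' : ∀ g, ∃ s : ℝ, (∀ x, ρ g x = s • x) ∧ ∀ x, ρ g⁻¹ x = s • x := fun g =>
    (hρ g).imp fun s hs => hs.2
  refine ⟨Equiv.ofBijective f ⟨?_, ?_⟩, fun J => ?_⟩
  · intro q q'
    refine Quotient.inductionOn₂ q q' fun J J' e => ?_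
    exact Quotient.sound ((bSetoid_iff b hρ J J').2 (congrArg Subtype.val e))
  · rintro ⟨⟨u, v⟩, huv⟩
    rcases huv with ⟨h1, h2⟩ | h
    · change u = 0 at h1
      change v ≠ 0 at h2
      subst h1
      have h0 : (0 : ℝ) ^ 2 = v * v⁻¹ - 1 := by rw [mul_inv_cancel₀ h2]; norm_num
      obtain ⟨J, hJ⟩ := exists_genMatrix_eq b hρ' _ (noncomplexMatrix_sq h0)
        (noncomplexMatrix_skew _ _ _)
      refine ⟨Moduli.mk J, Subtype.ext ?_⟩
      change matrixParam (genMatrix b J.toEnd) = _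
      rw [hJ, (matrixParam_noncomplexMatrix h0).2]
    · change u ≠ 0 at h
      obtain ⟨J, hJ⟩ := exists_genMatrix_eq b hρ' _ (complexMatrix_sq (b := v) h)
        (complexMatrix_skew _ _)
      refine ⟨Moduli.mk J, Subtype.ext ?_⟩
      change matrixParam (genMatrix b J.toEnd) = _
      rw [hJ, matrixParam_complexMatrix]
  · change (∃ a x y : ℝ, _ ∧ _ ∧ matrixParam (genMatrix b J.toEnd) = _) ∨
      (∃ b' c : ℝ, _ ∧ _ ∧ matrixParam (genMatrix b J.toEnd) = _)
    rcases eq_noncomplexMatrix_or_complexMatrix (genMatrix_sq b J) (genMatrix_skew b J) with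
      ⟨a, x, y, h, e⟩ | ⟨b', c, h, e⟩
    · exact Or.inl ⟨a, x, y, h, e, by rw [e, (matrixParam_noncomplexMatrix h).2]⟩
    · exact Or.inr ⟨b', c, h, e, by rw [e, matrixParam_complexMatrix]⟩

end Plane

/-! ### The homotopy type of the parameter space -/

section Topology

/-- The complex number `c + b i` attached to a parameter `(c, b)`. -/
def paramToComplex (p : ParamSpace) : ℂ := ⟨p.1.1, p.1.2⟩

theorem paramToComplex_ne_zero (p : ParamSpace) : paramToComplex p ≠ 0 := by
  intro h
  have h1 : p.1.1 = 0 := congrArg Complex.re h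
  have h2 : p.1.2 = 0 := congrArg Complex.im h
  rcases p.2 with h' | h'
  · exact h'.2 h2
  · exact h' h1

theorem continuous_paramToComplex : Continuous paramToComplex := by
  have : paramToComplex = fun p => Complex.equivRealProdCLM.symm p.1 := rfl
  rw [this]
  fun_prop

/-- The parameter space is the punctured plane. -/
def complexToParam (z : ℂ) (hz : z ≠ 0) : ParamSpace :=
  ⟨(z.re, z.im), by
    by_cases h : z.re = 0
    · exact Or.inl ⟨h, fun h' => hz (Complex.ext h h')⟩
    · exact Or.inr h⟩

/-- The parameter space retracts to the unit circle by the homotopy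
`(t, z) ↦ ((1 - t) / ‖z‖ + t) z`. -/
theorem paramSpace_homotopyEquiv_circle :
    Nonempty (ContinuousMap.HomotopyEquiv ParamSpace Circle) := by
  have hcont : Continuous fun p => (‖paramToComplex p‖⁻¹ : ℝ) :=
    continuous_paramToComplex.norm.inv₀ fun p => norm_ne_zero_iff.2 (paramToComplex_ne_zero p)
  have hmem : ∀ p,
      ((‖paramToComplex p‖⁻¹ : ℝ) : ℂ) * paramToComplex p ∈ Submonoid.unitSphere ℂ := by
    intro p
    refine mem_sphere_zero_iff_norm.2 ?_
    rw [norm_mul, Complex.norm_real, norm_inv, norm_norm]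
    exact inv_mul_cancel₀ (norm_ne_zero_iff.2 (paramToComplex_ne_zero p))
  let f : C(ParamSpace, Circle) :=
    ⟨fun p => ⟨_, hmem p⟩, Continuous.subtype_mk
      ((Complex.continuous_ofReal.comp hcont).mul continuous_paramToComplex) _⟩
  let g : C(Circle, ParamSpace) :=
    ⟨fun z => complexToParam z z.coe_ne_zero, by unfold complexToParam; fun_prop⟩
  have hpos : ∀ q : unitInterval × ParamSpace,
      0 < (1 - (q.1 : ℝ)) * ‖paramToComplex q.2‖⁻¹ + q.1 := by
    rintro ⟨t, p⟩
    have hn : 0 < ‖paramToComplex p‖⁻¹ :=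
      inv_pos.2 (norm_pos_iff.2 (paramToComplex_ne_zero p))
    rcases eq_or_lt_of_le t.2.1 with h | h
    · simp only [← h]
      linarith
    · have : 0 ≤ (1 - (t : ℝ)) * ‖paramToComplex p‖⁻¹ :=
        mul_nonneg (sub_nonneg.2 t.2.2) hn.le
      change 0 < (1 - (t : ℝ)) * ‖paramToComplex p‖⁻¹ + t
      linarith
  let H : unitInterval × ParamSpace → ℂ := fun q =>
    (((1 - (q.1 : ℝ)) * ‖paramToComplex q.2‖⁻¹ + q.1 : ℝ) : ℂ) * paramToComplex q.2
  have hH : Continuous H := by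
    refine (Complex.continuous_ofReal.comp ?_).mul (continuous_paramToComplex.comp continuous_snd)
    exact ((continuous_const.sub (continuous_subtype_val.comp continuous_fst)).mul
      (hcont.comp continuous_snd)).add (continuous_subtype_val.comp continuous_fst)
  have hH0 : ∀ q, H q ≠ 0 := fun q =>
    mul_ne_zero (Complex.ofReal_ne_zero.2 (hpos q).ne') (paramToComplex_ne_zero q.2)
  refine ⟨⟨f, g, ⟨⟨⟨fun q => complexToParam (H q) (hH0 q), ?_⟩, fun p => ?_, fun p => ?_⟩⟩, ?_⟩⟩
  · unfold complexToParam
    fun_prop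
  · refine Subtype.ext ?_
    change ((H (0, p)).re, (H (0, p)).im) = ((f p : ℂ).re, (f p : ℂ).im)
    have : H (0, p) = (f p : ℂ) := by
      change (((1 - 0) * ‖paramToComplex p‖⁻¹ + 0 : ℝ) : ℂ) * paramToComplex p =
        ((‖paramToComplex p‖⁻¹ : ℝ) : ℂ) * paramToComplex p
      rw [sub_zero, one_mul, add_zero]
    rw [this]
  · refine Subtype.ext ?_
    change ((H (1, p)).re, (H (1, p)).im) = _
    have : H (1, p) = paramToComplex p := by simp [H]
    rw [this]
    rfl
  · have : f.comp g = ContinuousMap.id Circle := by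
      refine ContinuousMap.ext fun z => Circle.ext ?_
      have e : paramToComplex (g z) = z := rfl
      change ((‖paramToComplex (g z)‖⁻¹ : ℝ) : ℂ) * paramToComplex (g z) = z
      rw [e, Circle.norm_coe]
      simp
    rw [this]

/-- A space that carries the topology induced by a bijection to a power of the parameter space is
homotopy equivalent to a torus. -/
theorem homotopyEquiv_torus {M : Type} {d : ℕ} (e : M ≃ (Fin d → ParamSpace)) :
    Nonempty (@ContinuousMap.HomotopyEquiv M (Fin d → Circle)
      (TopologicalSpace.induced (fun q j => (e q j : ℝ × ℝ)) inferInstance) inferInstance) := by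
  let _ : TopologicalSpace M :=
    TopologicalSpace.induced (fun q j => (e q j : ℝ × ℝ)) inferInstance
  have h1 : Topology.IsInducing fun (q : M) (j : Fin d) => (e q j : ℝ × ℝ) := ⟨rfl⟩
  have h2 : Topology.IsInducing fun (p : Fin d → ParamSpace) (j : Fin d) => (p j : ℝ × ℝ) :=
    Topology.IsInducing.piMap fun _ => Topology.IsInducing.subtypeVal
  have h3 : Topology.IsInducing e := (h2.of_comp_iff (f := e)).1 h1
  obtain ⟨c⟩ := paramSpace_homotopyEquiv_circle
  exact ⟨(e.toHomeomorphOfIsInducing h3).toHomotopyEquiv.trans (.piCongrRight fun _ => c)⟩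

end Topology

/-! ### Root vectors and `M`-equivalence classes -/

section RootVectors

variable {n : Type} [Fintype n] [DecidableEq n] (𝔤 : LieSubalgebra ℝ (Matrix n n ℝ))

/-- The linear form `H ↦ H i i - H j j` on `𝔞`: the only possible root of a matrix with nonzero
entry at `(i, j)`. -/
def entryRoot (i j : n) : Module.Dual ℝ (cartan 𝔤) where
  toFun H := (H : Matrix n n ℝ) i i - (H : Matrix n n ℝ) j j
  map_add' H H' := by
    change ((H : Matrix n n ℝ) i i + (H' : Matrix n n ℝ) i i) -
      ((H : Matrix n n ℝ) j j + (H' : Matrix n n ℝ) j j) = _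
    ring
  map_smul' c H := by
    change c * (H : Matrix n n ℝ) i i - c * (H : Matrix n n ℝ) j j = c * _
    ring

theorem entryRoot_apply (i j : n) (H : cartan 𝔤) :
    entryRoot 𝔤 i j H = (H : Matrix n n ℝ) i i - (H : Matrix n n ℝ) j j := rfl

theorem neg_entryRoot (i j : n) : -entryRoot 𝔤 i j = entryRoot 𝔤 j i := by
  refine LinearMap.ext fun H => ?_
  rw [LinearMap.neg_apply, entryRoot_apply, entryRoot_apply, neg_sub]

variable {𝔤}

theorem bracket_cartan_apply (H : cartan 𝔤) (X : 𝔤) (i j : n) :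
    ((⁅(H : 𝔤), X⁆ : 𝔤) : Matrix n n ℝ) i j =
      entryRoot 𝔤 i j H * (X : Matrix n n ℝ) i j := by
  have hH : ((H : 𝔤) : Matrix n n ℝ) = Matrix.diagonal (fun i => (H : Matrix n n ℝ) i i) :=
    (Matrix.IsDiag.diagonal_diag H.2).symm
  rw [LieSubalgebra.coe_bracket, LieRing.of_associative_ring_bracket, Matrix.sub_apply]
  conv_lhs => rw [hH]
  rw [Matrix.diagonal_mul, Matrix.mul_diagonal, entryRoot_apply]
  ring

theorem mem_rootSpace_iff (α : Module.Dual ℝ (cartan 𝔤)) (X : 𝔤) :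
    X ∈ rootSpace 𝔤 α ↔ ∀ i j, (X : Matrix n n ℝ) i j ≠ 0 → entryRoot 𝔤 i j = α := by
  constructor
  · intro hX i j hij
    refine LinearMap.ext fun H => ?_
    have h := congrFun (congrFun (congrArg Subtype.val (hX H)) i) j
    rw [bracket_cartan_apply] at h
    exact mul_right_cancel₀ hij h
  · intro h H
    refine Subtype.ext (Matrix.ext fun i j => ?_)
    rw [bracket_cartan_apply]
    change _ = α H * (X : Matrix n n ℝ) i j
    by_cases hij : (X : Matrix n n ℝ) i j = 0
    · rw [hij, mul_zero, mul_zero]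
    · rw [h i j hij]

theorem exists_entry_ne_zero {X : 𝔤} (hX : X ≠ 0) : ∃ i j, (X : Matrix n n ℝ) i j ≠ 0 := by
  by_contra! h
  exact hX (Subtype.ext (Matrix.ext h))

/-- Root vectors of distinct roots are linearly independent: they have disjoint supports. -/
theorem linearIndependent_rootVectors {κ : Type} {e : κ → Module.Dual ℝ (cartan 𝔤)}
    (he : Function.Injective e) {X : κ → 𝔤} (hX : ∀ k, X k ∈ rootSpace 𝔤 (e k))
    (hX0 : ∀ k, X k ≠ 0) : LinearIndependent ℝ X := by
  rw [linearIndependent_iff']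
  intro s c hs k hk
  obtain ⟨i, j, hij⟩ := exists_entry_ne_zero (hX0 k)
  let entry : 𝔤 →ₗ[ℝ] ℝ :=
    (Matrix.entryLinearMap ℝ ℝ i j) ∘ₗ 𝔤.toSubmodule.subtype
  have h1 := congrArg entry hs
  rw [map_sum, map_zero, Finset.sum_eq_single k] at h1
  · rw [map_smul, smul_eq_mul] at h1
    exact (mul_eq_zero.1 h1).resolve_right hij
  · intro l _ hl
    rw [map_smul]
    have : (X l : Matrix n n ℝ) i j = 0 := by
      by_contra h
      exact hl (he (((mem_rootSpace_iff _ _).1 (hX l) i j h).symm.trans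
        ((mem_rootSpace_iff _ _).1 (hX k) i j hij)))
    change c l * (X l : Matrix n n ℝ) i j = 0
    rw [this, mul_zero]
  · exact fun h => absurd hk h

/-- The roots of `𝔤` have multiplicity one, `M` acts on the root space of `α` by the sign
character `χ α`, and every fibre of `χ` consists of two pairs of opposite roots. -/
structure HasPairedRoots (𝔤 : LieSubalgebra ℝ (Matrix n n ℝ))
    (χ : Module.Dual ℝ (cartan 𝔤) → groupM 𝔤 → ℝ) : Prop where
  exists_smul_eq : ∀ α ∈ roots 𝔤, ∀ X ∈ rootSpace 𝔤 α, X ≠ 0 → ∀ Y ∈ rootSpace 𝔤 α,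
    ∃ c : ℝ, c • X = Y
  act : ∀ α ∈ roots 𝔤, ∀ m : groupM 𝔤, ∀ X ∈ rootSpace 𝔤 α,
    (m : 𝔤 ≃ₗ[ℝ] 𝔤) X = χ α m • X
  mul_self : ∀ α ∈ roots 𝔤, ∀ m, χ α m * χ α m = 1
  partner : ∀ α ∈ roots 𝔤, ∃ α' ∈ roots 𝔤, α' ≠ α ∧ α' ≠ -α ∧
    ∀ β ∈ roots 𝔤, χ β = χ α ↔ β = α ∨ β = -α ∨ β = α' ∨ β = -α'

/-- A basis of the sum of the root spaces of a set of roots, made of root vectors. -/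
theorem exists_basis_rootSum {κ : Type} {e : κ → Module.Dual ℝ (cartan 𝔤)}
    (he : Function.Injective e) {S : Set (Module.Dual ℝ (cartan 𝔤))} (hS : Set.range e = S)
    (h1 : ∀ α ∈ S, ∀ X ∈ rootSpace 𝔤 α, X ≠ 0 → ∀ Y ∈ rootSpace 𝔤 α, ∃ c : ℝ, c • X = Y)
    {X : κ → 𝔤} (hX : ∀ k, X k ∈ rootSpace 𝔤 (e k)) (hX0 : ∀ k, X k ≠ 0) :
    ∃ b : Module.Basis κ ℝ (rootSum 𝔤 S), ∀ k, (b k : 𝔤) = X k := by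
  have hspan : Submodule.span ℝ (Set.range X) = rootSum 𝔤 S := by
    apply le_antisymm
    · rw [Submodule.span_le]
      rintro _ ⟨k, rfl⟩
      exact (le_iSup₂ (f := fun β (_ : β ∈ S) => rootSpace 𝔤 β) (e k) (hS ▸ ⟨k, rfl⟩)) (hX k)
    · refine iSup₂_le fun β hβ Y hY => ?_
      obtain ⟨k, rfl⟩ : β ∈ Set.range e := hS ▸ hβ
      obtain ⟨c, rfl⟩ := h1 _ hβ _ (hX k) (hX0 k) Y hY
      exact Submodule.smul_mem _ _ (Submodule.subset_span ⟨k, rfl⟩)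
  refine ⟨(Module.Basis.span (linearIndependent_rootVectors he hX hX0)).map
    (LinearEquiv.ofEq _ _ hspan), fun k => ?_⟩
  rw [Module.Basis.map_apply, LinearEquiv.coe_ofEq_apply, Module.Basis.span_apply]

theorem rootSumRep_apply (S : Set (Module.Dual ℝ (cartan 𝔤))) (m : groupM 𝔤)
    (x : rootSum 𝔤 S) : ((rootSumRep 𝔤 S m x : rootSum 𝔤 S) : 𝔤) = (m : 𝔤 ≃ₗ[ℝ] 𝔤) x := rfl

theorem exists_ne_zero_mem_rootSpace {α : Module.Dual ℝ (cartan 𝔤)} (h : α ∈ roots 𝔤) :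
    ∃ X ∈ rootSpace 𝔤 α, X ≠ 0 :=
  (Submodule.ne_bot_iff _).1 h.2

namespace HasPairedRoots

variable {χ : Module.Dual ℝ (cartan 𝔤) → groupM 𝔤 → ℝ}

theorem act_inv (h : HasPairedRoots 𝔤 χ) {α : Module.Dual ℝ (cartan 𝔤)} (hα : α ∈ roots 𝔤)
    (m : groupM 𝔤) : χ α m⁻¹ = χ α m := by
  obtain ⟨X, hX, hX0⟩ := exists_ne_zero_mem_rootSpace hα
  have e : ((m⁻¹ : groupM 𝔤) : 𝔤 ≃ₗ[ℝ] 𝔤) ((m : 𝔤 ≃ₗ[ℝ] 𝔤) X) = X :=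
    (m : 𝔤 ≃ₗ[ℝ] 𝔤).symm_apply_apply X
  rw [h.act α hα m X hX, map_smul, h.act α hα _ X hX, smul_smul] at e
  have e2 : χ α m * χ α m⁻¹ = 1 := by
    refine smul_left_injective ℝ hX0 ?_
    change (χ α m * χ α m⁻¹) • X = (1 : ℝ) • X
    rw [e, one_smul]
  calc χ α m⁻¹ = (χ α m * χ α m) * χ α m⁻¹ := by rw [h.mul_self α hα, one_mul]
    _ = χ α m * (χ α m * χ α m⁻¹) := by ring
    _ = χ α m := by rw [e2, mul_one]

theorem mEquiv_iff (h : HasPairedRoots 𝔤 χ) {α β : Module.Dual ℝ (cartan 𝔤)}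
    (hα : α ∈ roots 𝔤) (hβ : β ∈ roots 𝔤) : MEquiv 𝔤 α β ↔ χ α = χ β := by
  obtain ⟨X, hX, hX0⟩ := exists_ne_zero_mem_rootSpace hα
  obtain ⟨Y, hY, hY0⟩ := exists_ne_zero_mem_rootSpace hβ
  constructor
  · rintro ⟨φ⟩
    funext m
    have e : φ (rootRep 𝔤 α m ⟨X, hX⟩) = rootRep 𝔤 β m (φ ⟨X, hX⟩) :=
      LinearMap.congr_fun (φ.isIntertwining' m) _
    have e1 : rootRep 𝔤 α m ⟨X, hX⟩ = χ α m • ⟨X, hX⟩ := Subtype.ext (h.act α hα m X hX)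
    have e2 : rootRep 𝔤 β m (φ ⟨X, hX⟩) = χ β m • φ ⟨X, hX⟩ :=
      Subtype.ext (h.act β hβ m _ (φ ⟨X, hX⟩).2)
    rw [e1, e2, map_smul] at e
    refine smul_left_injective ℝ (m := φ ⟨X, hX⟩) (fun h0 => hX0 ?_) e
    exact congrArg Subtype.val ((map_eq_zero_iff φ (EquivLike.injective φ)).1 h0)
  · intro e
    have f1 : Module.finrank ℝ (rootSpace 𝔤 α) = 1 :=
      finrank_eq_one (⟨X, hX⟩ : rootSpace 𝔤 α) (fun h0 => hX0 (congrArg Subtype.val h0))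
        fun Y => (h.exists_smul_eq α hα X hX hX0 Y Y.2).imp fun c hc => Subtype.ext hc
    have f2 : Module.finrank ℝ (rootSpace 𝔤 β) = 1 :=
      finrank_eq_one (⟨Y, hY⟩ : rootSpace 𝔤 β) (fun h0 => hY0 (congrArg Subtype.val h0))
        fun Z => (h.exists_smul_eq β hβ Y hY hY0 Z Z.2).imp fun c hc => Subtype.ext hc
    have l := LinearEquiv.ofFinrankEq (rootSpace 𝔤 α) (rootSpace 𝔤 β) (f1.trans f2.symm)
    refine ⟨Representation.Equiv.mk l fun m => LinearMap.ext fun x => ?_⟩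
    have e1 : rootRep 𝔤 α m x = χ α m • x := Subtype.ext (h.act α hα m x x.2)
    have e2 : rootRep 𝔤 β m (l x) = χ β m • l x := Subtype.ext (h.act β hβ m _ (l x).2)
    change l (rootRep 𝔤 α m x) = rootRep 𝔤 β m (l x)
    rw [e1, e2, map_smul, e]

variable {P : Set (Module.Dual ℝ (cartan 𝔤))}

/-- Every `M`-equivalence class of negative roots has exactly two elements. -/
theorem exists_mClass_eq (h : HasPairedRoots 𝔤 χ) (hP : IsPositiveSystem 𝔤 P)
    {α : Module.Dual ℝ (cartan 𝔤)} (hα : α ∈ negRoots P) :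
    ∃ β, β ≠ α ∧ mClass P α = {α, β} := by
  have hneg : ∀ γ ∈ negRoots P, γ ∈ roots 𝔤 := fun γ hγ => (hP.mem_roots_iff γ).2 (Or.inr hγ)
  have hopp : ∀ γ ∈ negRoots P, -γ ∉ negRoots P := by
    intro γ hγ hγ'
    exact hP.not_both (-γ) ⟨hγ, hγ'⟩
  obtain ⟨α', hα', h1, h2, h3⟩ := h.partner α (hneg α hα)
  -- exactly one of the roots `α'` and `-α'` is negative
  obtain ⟨β, hβ, hβα'⟩ : ∃ β ∈ negRoots P, β = α' ∨ β = -α' := by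
    rcases (hP.mem_roots_iff α').1 hα' with h | h
    · exact ⟨-α', by change - -α' ∈ P; rwa [neg_neg], Or.inr rfl⟩
    · exact ⟨α', h, Or.inl rfl⟩
  have hset : ∀ γ, (γ = α' ∨ γ = -α') ↔ (γ = β ∨ γ = -β) := by
    intro γ
    rcases hβα' with rfl | rfl
    · exact Iff.rfl
    · rw [neg_neg]
      exact or_comm
  refine ⟨β, ?_, Set.ext fun γ => ?_⟩
  · rintro rfl
    rcases hβα' with h | h
    · exact h1 h.symm
    · exact h2 (by rw [h, neg_neg])
  · have key : ∀ hγ : γ ∈ negRoots P, MEquiv 𝔤 γ α ↔ γ = α ∨ γ = -α ∨ γ = β ∨ γ = -β := by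
      intro hγ
      rw [h.mEquiv_iff (hneg γ hγ) (hneg α hα), h3 γ (hneg γ hγ), hset]
    constructor
    · rintro ⟨hγ, hm⟩
      rcases (key hγ).1 hm with rfl | rfl | rfl | rfl
      · exact Or.inl rfl
      · exact absurd hγ (hopp α hα)
      · exact Or.inr rfl
      · exact absurd hγ (hopp β hβ)
    · rintro (rfl | rfl)
      · exact ⟨hα, (key hα).2 (Or.inl rfl)⟩
      · exact ⟨hβ, (key hβ).2 (Or.inr (Or.inr (Or.inl rfl)))⟩

end HasPairedRoots

end RootVectors

/-! ### The moduli space of an algebra with paired roots -/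

section Assembly

variable {n : Type} [Fintype n] [DecidableEq n] {𝔤 : LieSubalgebra ℝ (Matrix n n ℝ)}

theorem rootSum_mono {S T : Set (Module.Dual ℝ (cartan 𝔤))} (h : S ⊆ T) :
    rootSum 𝔤 S ≤ rootSum 𝔤 T :=
  iSup₂_le fun β hβ => le_iSup₂ (f := fun β (_ : β ∈ T) => rootSpace 𝔤 β) β (h hβ)

/-- The inclusion of `V_{[α]_M}` into `𝔫⁻`. -/
def classIncl (P : Set (Module.Dual ℝ (cartan 𝔤))) (α : Module.Dual ℝ (cartan 𝔤)) :
    classSpace P α →ₗ[ℝ] nMinus P :=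
  Submodule.inclusion (rootSum_mono (Set.sep_subset _ _))

theorem coe_classIncl (P : Set (Module.Dual ℝ (cartan 𝔤))) (α : Module.Dual ℝ (cartan 𝔤))
    (x : classSpace P α) : (classIncl P α x : 𝔤) = (x : 𝔤) :=
  Submodule.coe_inclusion _ x

section

variable {d : ℕ}

/-- The projection of `𝔫⁻` onto the summand with index `j`, in bases adapted to the summands. -/
def blockProj {V : Type} [AddCommGroup V] [Module ℝ V] {W : Fin d → Type}
    [∀ j, AddCommGroup (W j)] [∀ j, Module ℝ (W j)]
    (c : Module.Basis (Fin d × Fin 2) ℝ V) (b : ∀ j, Module.Basis (Fin 2) ℝ (W j)) (j : Fin d) :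
    V →ₗ[ℝ] W j :=
  c.constr ℝ fun kt => if kt.1 = j then b j kt.2 else 0

variable {V : Type} [AddCommGroup V] [Module ℝ V] {W : Fin d → Type}
  [∀ j, AddCommGroup (W j)] [∀ j, Module ℝ (W j)]
  (c : Module.Basis (Fin d × Fin 2) ℝ V) (b : ∀ j, Module.Basis (Fin 2) ℝ (W j))

theorem blockProj_self (j : Fin d) (t : Fin 2) : blockProj c b j (c (j, t)) = b j t := by
  rw [blockProj, Module.Basis.constr_basis, if_pos rfl]

theorem blockProj_ne {j k : Fin d} (h : k ≠ j) (t : Fin 2) : blockProj c b j (c (k, t)) = 0 := by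
  rw [blockProj, Module.Basis.constr_basis, if_neg h]

/-- A sign decomposition from adapted bases. -/
theorem signDecomposition_of_basis {Γ : Type} [Group Γ] {ρ : Representation ℝ Γ V}
    {σ : ∀ j, Representation ℝ Γ (W j)} {ι : ∀ j, W j →ₗ[ℝ] V} {χ : Fin d → Γ → ℝ}
    (hι : ∀ j t, ι j (b j t) = c (j, t)) (hρ : ∀ g j t, ρ g (c (j, t)) = χ j g • c (j, t))
    (hσ : ∀ g j t, σ j g (b j t) = χ j g • b j t) (hsq : ∀ g j, χ j g * χ j g = 1)
    (hinv : ∀ g j, χ j g⁻¹ = χ j g) (hsep : ∀ j k, j ≠ k → ∃ g, χ j g ≠ χ k g) :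
    SignDecomposition ρ σ ι (blockProj c b) χ where
  proj_incl j := by
    refine LinearMap.congr_fun (f := blockProj c b j ∘ₗ ι j) (g := LinearMap.id) ?_
    refine (b j).ext fun t => ?_
    rw [LinearMap.comp_apply, hι, blockProj_self, LinearMap.id_apply]
  proj_incl_ne j k hjk := by
    refine LinearMap.congr_fun (f := blockProj c b k ∘ₗ ι j) (g := 0) ?_
    refine (b j).ext fun t => ?_
    rw [LinearMap.comp_apply, hι, blockProj_ne c b hjk, LinearMap.zero_apply]
  sum_incl_proj x := by
    have : ∑ j, ι j ∘ₗ blockProj c b j = LinearMap.id := by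
      refine c.ext fun ⟨k, t⟩ => ?_
      rw [LinearMap.sum_apply, Finset.sum_eq_single k, LinearMap.comp_apply, blockProj_self, hι,
        LinearMap.id_apply]
      · intro j _ hj
        rw [LinearMap.comp_apply, blockProj_ne c b hj.symm, map_zero]
      · simp
    simpa using LinearMap.congr_fun this x
  act g j := by
    refine LinearMap.congr_fun (f := ρ g ∘ₗ ι j) (g := χ j g • ι j) ?_
    refine (b j).ext fun t => ?_
    rw [LinearMap.comp_apply, LinearMap.smul_apply, hι, hρ]
  act_summand g j := by
    refine LinearMap.congr_fun (f := σ j g) (g := χ j g • LinearMap.id) ?_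
    refine (b j).ext fun t => ?_
    rw [LinearMap.smul_apply, LinearMap.id_apply, hσ]
  mul_self := hsq
  inv := hinv
  separate := hsep

end

variable {χ : Module.Dual ℝ (cartan 𝔤) → groupM 𝔤 → ℝ}

/-- The description of the moduli space of invariant structures, for an algebra whose
`M`-equivalence classes of roots are paired. -/
theorem HasPairedRoots.moduli (h : HasPairedRoots 𝔤 χ)
    (P : Set (Module.Dual ℝ (cartan 𝔤))) (hP : IsPositiveSystem 𝔤 P)
    (X : Module.Dual ℝ (cartan 𝔤) → 𝔤)
    (hX : ∀ γ ∈ negRoots P, X γ ∈ rootSpace 𝔤 γ ∧ X γ ≠ 0)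
    (d : ℕ) (α : Fin d → Module.Dual ℝ (cartan 𝔤)) (hα : ∀ j, α j ∈ negRoots P)
    (hd : ∀ γ ∈ negRoots P, ∃! j, γ ∈ mClass P (α j)) :
    ∃ (β : Fin d → Module.Dual ℝ (cartan 𝔤))
      (b : ∀ j, Module.Basis (Fin 2) ℝ (classSpace P (α j)))
      (Φ : Moduli (isotropyRep P) ≃ ∀ j, Moduli (classRep P (α j)))
      (Ψ : ∀ j, Moduli (classRep P (α j)) ≃ ParamSpace),
      (∀ j, β j ≠ α j ∧ mClass P (α j) = {α j, β j}) ∧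
      (∀ j, (b j 0 : 𝔤) = X (α j) ∧ (b j 1 : 𝔤) = X (β j)) ∧
      (∀ J j, ∃! J', IsRestriction P (α j) J J') ∧
      (∀ j J', ∃ J, IsRestriction P (α j) J J') ∧
      (∀ J j J', IsRestriction P (α j) J J' → Φ (Moduli.mk J) j = Moduli.mk J') ∧
      (∀ j (J' : InvariantGCS (classRep P (α j))),
        (∃ a x y : ℝ, a ^ 2 = x * y - 1 ∧
          genMatrix (b j) J'.toEnd = noncomplexMatrix a x y ∧
          (Ψ j (Moduli.mk J')).1 = (0, x)) ∨
        (∃ b' c : ℝ, c ≠ 0 ∧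
          genMatrix (b j) J'.toEnd = complexMatrix b' c ∧
          (Ψ j (Moduli.mk J')).1 = (c, b'))) ∧
      Nonempty (@ContinuousMap.HomotopyEquiv (Moduli (isotropyRep P)) (Fin d → Circle)
        (TopologicalSpace.induced
          (fun (q : Moduli (isotropyRep P)) (j : Fin d) => ((Ψ j (Φ q j) : ParamSpace) : ℝ × ℝ))
          inferInstance)
        inferInstance) := by
  have hroot : ∀ γ ∈ negRoots P, γ ∈ roots 𝔤 := fun γ hγ => (hP.mem_roots_iff γ).2 (Or.inr hγ)
  choose β hβα hβ using fun j => h.exists_mClass_eq hP (hα j)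
  let e : Fin d → Fin 2 → Module.Dual ℝ (cartan 𝔤) := fun j => ![α j, β j]
  have he_range : ∀ j, Set.range (e j) = mClass P (α j) := by
    intro j
    rw [hβ j]
    exact Matrix.range_cons_cons_empty _ _ _
  have he_mem : ∀ j t, e j t ∈ mClass P (α j) := fun j t => he_range j ▸ ⟨t, rfl⟩
  have he_inj : ∀ j, Function.Injective (e j) := by
    intro j s t hst
    fin_cases s <;> fin_cases t
    · rfl
    · exact absurd hst.symm (hβα j)
    · exact absurd hst (hβα j)
    · rfl
  have hc_inj : Function.Injective fun jt : Fin d × Fin 2 => e jt.1 jt.2 := by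
    rintro ⟨j, s⟩ ⟨k, t⟩ hst
    change e j s = e k t at hst
    obtain rfl : j = k := (hd _ (he_mem j s).1).unique (he_mem j s) (hst ▸ he_mem k t)
    rw [he_inj j hst]
  have hc_range : Set.range (fun jt : Fin d × Fin 2 => e jt.1 jt.2) = negRoots P := by
    refine Set.Subset.antisymm ?_ fun γ hγ => ?_
    · rintro _ ⟨⟨j, t⟩, rfl⟩
      exact (he_mem j t).1
    · obtain ⟨j, hj, -⟩ := hd γ hγ
      rw [← he_range j] at hj
      obtain ⟨t, rfl⟩ := hj
      exact ⟨(j, t), rfl⟩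
  have hb : ∀ j, ∃ b : Module.Basis (Fin 2) ℝ (classSpace P (α j)), ∀ t, (b t : 𝔤) = X (e j t) :=
    fun j => exists_basis_rootSum (he_inj j) (he_range j)
      (fun γ hγ => h.exists_smul_eq γ (hroot γ hγ.1)) (fun t => (hX _ (he_mem j t).1).1)
      (fun t => (hX _ (he_mem j t).1).2)
  choose b hb using hb
  obtain ⟨c, hc⟩ : ∃ c : Module.Basis (Fin d × Fin 2) ℝ (nMinus P),
      ∀ jt, (c jt : 𝔤) = X (e jt.1 jt.2) :=
    exists_basis_rootSum hc_inj hc_range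
      (fun γ hγ => h.exists_smul_eq γ (hroot γ hγ)) (fun jt => (hX _ (he_mem jt.1 jt.2).1).1)
      (fun jt => (hX _ (he_mem jt.1 jt.2).1).2)
  have hχ : ∀ j t, χ (e j t) = χ (α j) := fun j t =>
    (h.mEquiv_iff (hroot _ (he_mem j t).1) (hroot _ (hα j))).1 (he_mem j t).2
  have hact : ∀ (m : groupM 𝔤) (j : Fin d) (t : Fin 2),
      (m : 𝔤 ≃ₗ[ℝ] 𝔤) (X (e j t)) = χ (α j) m • X (e j t) := by
    intro m j t
    rw [h.act _ (hroot _ (he_mem j t).1) m _ (hX _ (he_mem j t).1).1, hχ]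
  have hι : ∀ j t, classIncl P (α j) (b j t) = c (j, t) := fun j t =>
    Subtype.ext (by rw [coe_classIncl, hb, hc])
  have D : SignDecomposition (isotropyRep P) (fun j => classRep P (α j))
      (fun j => classIncl P (α j)) (blockProj c b) (fun j => χ (α j)) := by
    refine signDecomposition_of_basis c b hι ?_ ?_ (fun g j => h.mul_self _ (hroot _ (hα j)) g)
      (fun g j => h.act_inv (hroot _ (hα j)) g) ?_
    · intro g j t
      refine Subtype.ext ?_
      rw [rootSumRep_apply, Submodule.coe_smul, hc, hact]
    · intro g j t
      refine Subtype.ext ?_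
      rw [rootSumRep_apply, Submodule.coe_smul, hb, hact]
    · intro j k hjk
      by_contra! H
      exact hjk ((hd (α j) (hα j)).unique ⟨hα j, (h.mEquiv_iff (hroot _ (hα j))
        (hroot _ (hα j))).2 rfl⟩ ⟨hα j, (h.mEquiv_iff (hroot _ (hα j))
        (hroot _ (hα k))).2 (funext H)⟩)
  have hincl : ∀ j v w, IsInclusion P (α j) v w ↔
      w = genIncl (classIncl P (α j)) (blockProj c b j) v := by
    intro j v w
    constructor
    · rintro ⟨h1, h2, h3⟩
      have h1' : w.1 = classIncl P (α j) v.1 := by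
        refine Subtype.ext ?_
        rw [h1, coe_classIncl]
      refine Prod.ext h1' (c.ext fun ⟨k, t⟩ => ?_)
      rw [genIncl_snd_apply]
      by_cases hk : k = j
      · subst hk
        rw [blockProj_self]
        exact h2 _ _ (by rw [hc, hb])
      · rw [blockProj_ne c b hk, map_zero]
        refine h3 (e k t) (he_mem k t).1 (fun h' => hk ?_) _ ?_
        · exact (hd _ (he_mem k t).1).unique (he_mem k t) h'
        · rw [hc]
          exact (hX _ (he_mem k t).1).1
    · rintro rfl
      refine ⟨by rw [genIncl_fst, coe_classIncl], fun Y Y' hY => ?_, fun γ hγ hγ' Y hY => ?_⟩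
      · have hY' : Y' = classIncl P (α j) Y := by
          refine Subtype.ext ?_
          rw [hY, coe_classIncl]
        rw [genIncl_snd_apply, hY', D.proj_incl j Y]
      · obtain ⟨⟨k, t⟩, rfl⟩ : γ ∈ Set.range (fun jt : Fin d × Fin 2 => e jt.1 jt.2) :=
          hc_range.symm ▸ hγ
        change e k t ∉ _ at hγ'
        have hk : k ≠ j := by
          rintro rfl
          exact hγ' (he_mem k t)
        obtain ⟨r, hr⟩ := h.exists_smul_eq _ (hroot _ hγ) _ (hX _ hγ).1 (hX _ hγ).2 _ hY
        obtain rfl : r • c (k, t) = Y := by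
          refine Subtype.ext ?_
          rw [Submodule.coe_smul, hc, ← hr]
        rw [genIncl_snd_apply, map_smul, blockProj_ne c b hk, smul_zero, map_zero]
  have hrestr : ∀ J j J', IsRestriction P (α j) J J' ↔ J' = D.restrict J j := by
    intro J j J'
    constructor
    · intro H
      refine InvariantGCS.ext' (LinearMap.ext fun v => ?_)
      have e := (hincl j _ _).1 (H v _ ((hincl j v _).2 rfl))
      have e' := D.genIncl_restrict J j v
      rw [e] at e'
      rw [← D.genProj_genIncl j (J'.toEnd v), ← e', D.genProj_genIncl]
    · rintro rfl v w hw
      rw [hincl] at hw ⊢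
      rw [hw, D.genIncl_restrict]
  obtain ⟨Φ, hΦ⟩ := D.exists_moduli_equiv
  have hΨ : ∀ j, _ := fun j => exists_moduli_equiv_paramSpace (ρ := classRep P (α j)) (b j)
    fun g => ⟨χ (α j) g, D.mul_self g j, D.act_summand g j, fun x => by
      rw [D.act_summand, D.inv]⟩
  choose Ψ hΨ using hΨ
  refine ⟨β, b, Φ, Ψ, fun j => ⟨hβα j, hβ j⟩, fun j => ⟨hb j 0, hb j 1⟩, fun J j =>
    ⟨D.restrict J j, (hrestr J j _).2 rfl, fun J' hJ' => (hrestr J j J').1 hJ'⟩, fun j J' => ?_,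
    fun J j J' hJ' => ?_, hΨ, homotopyEquiv_torus (Φ.trans (Equiv.piCongrRight Ψ))⟩
  · refine ⟨D.glue (Function.update (fun k => ((Ψ k).symm ⟨(1, 0), Or.inr one_ne_zero⟩).out) j J'),
      (hrestr _ _ _).2 ?_⟩
    rw [D.restrict_glue, Function.update_self]
  · rw [hΦ, ← (hrestr J j J').1 hJ']

end Assembly

/-! ### The elements of `M` as conjugations -/

section Conjugation

theorem conj_apply_of_row {n : Type} [Fintype n] {k Y : Matrix n n ℝ} {i j : n}
    (hi : ∀ a, a ≠ i → k i a = 0)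
    (hj : ∀ a, a ≠ j → k j a = 0) : (k * Y * kᵀ) i j = k i i * k j j * Y i j := by
  rw [Matrix.mul_apply, Finset.sum_eq_single j, Matrix.mul_apply, Finset.sum_eq_single i,
    Matrix.transpose_apply]
  · ring
  · intro a _ ha
    rw [hi a ha, zero_mul]
  · simp
  · intro a _ ha
    rw [Matrix.transpose_apply, hj a ha, mul_zero]
  · simp

variable {n : Type} [Fintype n] [DecidableEq n] {𝔤 : LieSubalgebra ℝ (Matrix n n ℝ)}

theorem transpose_exp_of_skew {X : Matrix n n ℝ} (hX : Xᵀ = -X) :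
    (NormedSpace.exp X)ᵀ = NormedSpace.exp (-X) := by
  rw [← Matrix.exp_transpose, hX]

theorem exp_mul_transpose_of_skew {X : Matrix n n ℝ} (hX : Xᵀ = -X) :
    NormedSpace.exp X * (NormedSpace.exp X)ᵀ = 1 := by
  rw [transpose_exp_of_skew hX,
    ← Matrix.exp_add_of_commute _ _ (Commute.neg_right (Commute.refl X)), add_neg_cancel,
    NormedSpace.exp_zero]

/-- The elements of `K` are the conjugations by certain orthogonal matrices; these have every
multiplicative property `Q` shared by the exponentials of the skew-symmetric matrices in `𝔤`. -/
theorem exists_matrix_of_mem_groupK (Q : Matrix n n ℝ → Prop) (h1 : Q 1)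
    (hmul : ∀ k l, Q k → Q l → Q (k * l)) (htr : ∀ k, k * kᵀ = 1 → Q k → Q kᵀ)
    (hexp : ∀ X : 𝔤, (X : Matrix n n ℝ)ᵀ = -(X : Matrix n n ℝ) →
      Q (NormedSpace.exp (X : Matrix n n ℝ)))
    {g : 𝔤 ≃ₗ[ℝ] 𝔤} (hg : g ∈ groupK 𝔤) :
    ∃ k : Matrix n n ℝ, k * kᵀ = 1 ∧ Q k ∧
      ∀ Y : 𝔤, ((g Y : 𝔤) : Matrix n n ℝ) = k * (Y : Matrix n n ℝ) * kᵀ := by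
  induction hg using Subgroup.closure_induction with
  | mem g h =>
    obtain ⟨X, hX, h⟩ := h
    refine ⟨NormedSpace.exp (X : Matrix n n ℝ), exp_mul_transpose_of_skew hX, hexp X hX,
      fun Y => ?_⟩
    rw [h, transpose_exp_of_skew hX]
  | one => exact ⟨1, by simp, h1, fun Y => by simp⟩
  | mul g g' _ _ ih ih' =>
    obtain ⟨k, h, hQ, hk⟩ := ih
    obtain ⟨k', h', hQ', hk'⟩ := ih'
    refine ⟨k * k', ?_, hmul k k' hQ hQ', fun Y => ?_⟩
    · rw [Matrix.transpose_mul]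
      calc k * k' * (k'ᵀ * kᵀ) = k * (k' * k'ᵀ) * kᵀ := by noncomm_ring
        _ = 1 := by rw [h', mul_one, h]
    · change ((g (g' Y) : 𝔤) : Matrix n n ℝ) = _
      rw [hk, hk', Matrix.transpose_mul]
      noncomm_ring
  | inv g _ ih =>
    obtain ⟨k, h, hQ, hk⟩ := ih
    have h' : kᵀ * k = 1 := mul_eq_one_comm.1 h
    refine ⟨kᵀ, by rw [Matrix.transpose_transpose, h'], htr k h hQ, fun Y => ?_⟩
    have e : g (g.symm Y) = Y := g.apply_symm_apply Y
    have e' := congrArg (fun Z : 𝔤 => kᵀ * (Z : Matrix n n ℝ) * k) e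
    simp only [hk] at e'
    rw [Matrix.transpose_transpose, ← e']
    change ((g.symm Y : 𝔤) : Matrix n n ℝ) = _
    calc ((g.symm Y : 𝔤) : Matrix n n ℝ)
        = (kᵀ * k) * ((g.symm Y : 𝔤) : Matrix n n ℝ) * (kᵀ * k) := by
          rw [h', one_mul, mul_one]
      _ = _ := by noncomm_ring

/-- An element of `M` is the conjugation by an orthogonal matrix `k` which commutes with `𝔞`, so
that its entries vanish wherever two diagonal places are separated by `𝔞`. -/
theorem exists_matrix_of_groupM (Q : Matrix n n ℝ → Prop) (h1 : Q 1)
    (hmul : ∀ k l, Q k → Q l → Q (k * l)) (htr : ∀ k, k * kᵀ = 1 → Q k → Q kᵀ)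
    (hexp : ∀ X : 𝔤, (X : Matrix n n ℝ)ᵀ = -(X : Matrix n n ℝ) →
      Q (NormedSpace.exp (X : Matrix n n ℝ))) (m : groupM 𝔤) :
    ∃ k : Matrix n n ℝ, k * kᵀ = 1 ∧ Q k ∧
      (∀ Y : 𝔤, (((m : 𝔤 ≃ₗ[ℝ] 𝔤) Y : 𝔤) : Matrix n n ℝ) = k * (Y : Matrix n n ℝ) * kᵀ) ∧
      ∀ i j, (∃ H : cartan 𝔤, (H : Matrix n n ℝ) i i ≠ (H : Matrix n n ℝ) j j) → k i j = 0 := by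
  obtain ⟨k, hk, hQ, hY⟩ := exists_matrix_of_mem_groupK Q h1 hmul htr hexp m.2.1
  refine ⟨k, hk, hQ, hY, ?_⟩
  rintro i j ⟨H, hH⟩
  have hfix : (m : 𝔤 ≃ₗ[ℝ] 𝔤) (H : 𝔤) = (H : 𝔤) :=
    (mem_fixingSubgroup_iff _).1 m.2.2 (H : 𝔤) H.2
  have e : k * (H : Matrix n n ℝ) * kᵀ = (H : Matrix n n ℝ) := by rw [← hY, hfix]
  have e2 : k * (H : Matrix n n ℝ) = (H : Matrix n n ℝ) * k := by
    calc k * (H : Matrix n n ℝ) = k * (H : Matrix n n ℝ) * (kᵀ * k) := by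
          rw [mul_eq_one_comm.1 hk, mul_one]
      _ = (k * (H : Matrix n n ℝ) * kᵀ) * k := by noncomm_ring
      _ = _ := by rw [e]
  have hd : ((H : 𝔤) : Matrix n n ℝ) = Matrix.diagonal (fun i => (H : Matrix n n ℝ) i i) :=
    (Matrix.IsDiag.diagonal_diag H.2).symm
  rw [hd] at e2
  have e3 := congrFun (congrFun e2 i) j
  rw [Matrix.mul_diagonal, Matrix.diagonal_mul, mul_comm] at e3
  by_contra h0
  exact hH (mul_right_cancel₀ h0 e3).symm

theorem mul_self_of_row {k : Matrix n n ℝ} (hk : k * kᵀ = 1) {i : n}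
    (hi : ∀ a, a ≠ i → k i a = 0) : k i i * k i i = 1 := by
  have e := congrFun (congrFun hk i) i
  rw [Matrix.mul_apply, Finset.sum_eq_single i, Matrix.transpose_apply, Matrix.one_apply_eq] at e
  · exact e
  · intro a _ ha
    rw [hi a ha, zero_mul]
  · simp

/-- The exponential of `π Z`, if `Z` acts as a complex structure on its range: the map
`(w, r) ↦ r (1 + Z²) - Re(w) Z² + Im(w) Z` is a homomorphism from `ℂ × ℝ`. -/
theorem exp_pi_smul {Z : Matrix n n ℝ} (hZ : Z * Z * Z = -Z) :
    NormedSpace.exp (Real.pi • Z) = 1 + (2 : ℝ) • (Z * Z) := by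
  have h4 : Z * Z * (Z * Z) = -(Z * Z) := by rw [← mul_assoc, hZ, neg_mul]
  have h3 : Z * (Z * Z) = -Z := by rw [← mul_assoc, hZ]
  let f : ℂ × ℝ →+* Matrix n n ℝ :=
    { toFun := fun w => w.2 • (1 + Z * Z) - w.1.re • (Z * Z) + w.1.im • Z
      map_one' := by simp
      map_zero' := by simp
      map_add' := fun v w => by
        simp only [Prod.fst_add, Prod.snd_add, Complex.add_re, Complex.add_im, add_smul]
        abel
      map_mul' := fun v w => by
        simp only [Prod.fst_mul, Prod.snd_mul, Complex.mul_re, Complex.mul_im, mul_add, add_mul,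
          mul_sub, sub_mul, smul_mul_assoc, mul_smul_comm, smul_smul, smul_add, one_mul, mul_one,
          h3, h4, hZ, smul_neg, add_smul, sub_smul]
        module }
  have hf : Continuous f := by
    change Continuous fun w : ℂ × ℝ => w.2 • (1 + Z * Z) - w.1.re • (Z * Z) + w.1.im • Z
    fun_prop
  have h1 : f ((Real.pi : ℂ) * Complex.I, 0) = Real.pi • Z := by
    change (0 : ℝ) • (1 + Z * Z) - ((Real.pi : ℂ) * Complex.I).re • (Z * Z) +
      ((Real.pi : ℂ) * Complex.I).im • Z = _
    simp
  have hmap : ∀ x, f (NormedSpace.exp x) = NormedSpace.exp (f x) := by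
    intro x
    rw [NormedSpace.exp_eq_tsum ℝ, NormedSpace.exp_eq_tsum ℝ]
    refine ((NormedSpace.expSeries_summable' (𝕂 := ℝ) x).hasSum.map f hf).tsum_eq.symm.trans ?_
    simp only [Function.comp_def, map_inv_natCast_smul f ℝ ℝ, map_pow]
  rw [← h1, ← hmap]
  have h2 : NormedSpace.exp (((Real.pi : ℂ) * Complex.I, 0) : ℂ × ℝ) = (-1, 1) := by
    have e1 := NormedSpace.map_exp (RingHom.fst ℂ ℝ) continuous_fst
      ((Real.pi : ℂ) * Complex.I, 0)
    have e2 := NormedSpace.map_exp (RingHom.snd ℂ ℝ) continuous_snd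
      ((Real.pi : ℂ) * Complex.I, 0)
    refine Prod.ext (e1.trans ?_) (e2.trans ?_)
    · rw [← Complex.exp_eq_exp_ℂ]
      exact Complex.exp_pi_mul_I
    · exact NormedSpace.exp_zero
  rw [h2]
  change (1 : ℝ) • (1 + Z * Z) - (-1 : ℂ).re • (Z * Z) + (-1 : ℂ).im • Z = _
  simp
  module

/-- Conjugation by the sign matrix `1 + 2 Z²` is an element of `M`, if `Z ∈ 𝔤` is skew-symmetric
with `Z³ = -Z`. -/
theorem exists_groupM_of_skew {Z : Matrix n n ℝ} (hZ𝔤 : Z ∈ 𝔤) (hZt : Zᵀ = -Z)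
    (hZ : Z * Z * Z = -Z) {ε : n → ℝ} (hε : 1 + (2 : ℝ) • (Z * Z) = Matrix.diagonal ε) :
    ∃ m : groupM 𝔤, ∀ (Y : 𝔤) i j, (((m : 𝔤 ≃ₗ[ℝ] 𝔤) Y : 𝔤) : Matrix n n ℝ) i j =
      ε i * ε j * (Y : Matrix n n ℝ) i j := by
  set e : Matrix n n ℝ := 1 + (2 : ℝ) • (Z * Z) with he
  have h3 : Z * (Z * Z) = -Z := by rw [← mul_assoc, hZ]
  have h4 : Z * Z * (Z * Z) = -(Z * Z) := by rw [← mul_assoc, hZ, neg_mul]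
  have hee : e * e = 1 := by
    rw [he]
    simp only [mul_add, add_mul, one_mul, mul_one, smul_mul_assoc, mul_smul_comm, h4, smul_neg]
    module
  -- conjugation by `e` is a polynomial in `ad Z`, and so preserves `𝔤`
  have hconj : ∀ Y : 𝔤, e * (Y : Matrix n n ℝ) * e ∈ 𝔤 := by
    intro Y
    let Z' : 𝔤 := ⟨Z, hZ𝔤⟩
    have key : e * (Y : Matrix n n ℝ) * e = ((Y + (8 / 3 : ℝ) • ⁅Z', ⁅Z', Y⁆⁆ +
        (2 / 3 : ℝ) • ⁅Z', ⁅Z', ⁅Z', ⁅Z', Y⁆⁆⁆⁆ : 𝔤) : Matrix n n ℝ) := by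
      change e * (Y : Matrix n n ℝ) * e = (Y : Matrix n n ℝ) + (8 / 3 : ℝ) • (Z * (Z * Y - Y * Z) -
        (Z * Y - Y * Z) * Z) + (2 / 3 : ℝ) • (Z * (Z * (Z * (Z * Y - Y * Z) -
        (Z * Y - Y * Z) * Z) - (Z * (Z * Y - Y * Z) - (Z * Y - Y * Z) * Z) * Z) -
        (Z * (Z * (Z * Y - Y * Z) - (Z * Y - Y * Z) * Z) -
        (Z * (Z * Y - Y * Z) - (Z * Y - Y * Z) * Z) * Z) * Z)
      generalize (Y : Matrix n n ℝ) = y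
      have r1 : ∀ a : Matrix n n ℝ, Z * (Z * (Z * a)) = -(Z * a) := fun a => by
        rw [← mul_assoc Z Z, ← mul_assoc, hZ, neg_mul]
      rw [he]
      simp only [mul_add, add_mul, mul_sub, sub_mul, one_mul, mul_one, smul_mul_assoc,
        mul_smul_comm, mul_assoc, r1, h3, mul_neg, neg_mul]
      module
    rw [key]
    exact SetLike.coe_mem _
  let φ : 𝔤 →ₗ[ℝ] 𝔤 :=
    { toFun := fun Y => ⟨e * (Y : Matrix n n ℝ) * e, hconj Y⟩
      map_add' := fun Y Y' => Subtype.ext (by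
        change e * ((Y : Matrix n n ℝ) + (Y' : Matrix n n ℝ)) * e =
          e * (Y : Matrix n n ℝ) * e + e * (Y' : Matrix n n ℝ) * e
        rw [mul_add e, add_mul _ _ e])
      map_smul' := fun c Y => Subtype.ext (by
        change e * (c • (Y : Matrix n n ℝ)) * e = c • (e * (Y : Matrix n n ℝ) * e)
        rw [mul_smul_comm, smul_mul_assoc]) }
  have hφ : φ ∘ₗ φ = LinearMap.id := by
    refine LinearMap.ext fun Y => Subtype.ext ?_
    change e * (e * (Y : Matrix n n ℝ) * e) * e = Y
    calc e * (e * (Y : Matrix n n ℝ) * e) * e = e * e * (Y : Matrix n n ℝ) * (e * e) := by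
          noncomm_ring
      _ = Y := by rw [hee, one_mul, mul_one]
  let g : 𝔤 ≃ₗ[ℝ] 𝔤 := LinearEquiv.ofLinearMap φ φ hφ hφ
  have hg : ∀ (Y : 𝔤) i j, ((g Y : 𝔤) : Matrix n n ℝ) i j = ε i * ε j * (Y : Matrix n n ℝ) i j := by
    intro Y i j
    change (e * (Y : Matrix n n ℝ) * e) i j = _
    rw [hε, Matrix.mul_diagonal, Matrix.diagonal_mul]
    ring
  have hεε : ∀ i, ε i * ε i = 1 := by
    intro i
    have h := congrFun (congrFun hee i) i
    rwa [hε, Matrix.diagonal_mul_diagonal, Matrix.diagonal_apply_eq, Matrix.one_apply_eq] at h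
  refine ⟨⟨g, Subgroup.subset_closure ⟨Real.pi • ⟨Z, hZ𝔤⟩, ?_, fun Y => ?_⟩, ?_⟩, hg⟩
  · change (Real.pi • Z)ᵀ = -(Real.pi • Z)
    rw [Matrix.transpose_smul, hZt, smul_neg]
  · change e * (Y : Matrix n n ℝ) * e = NormedSpace.exp (Real.pi • Z) * (Y : Matrix n n ℝ) *
      NormedSpace.exp (-(Real.pi • Z))
    rw [← smul_neg, exp_pi_smul hZ, exp_pi_smul (by simp [hZ]), neg_mul_neg]
  · refine (mem_fixingSubgroup_iff _).2 fun H hH => Subtype.ext (Matrix.ext fun i j => ?_)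
    change ((g H : 𝔤) : Matrix n n ℝ) i j = _
    rw [hg]
    by_cases hij : i = j
    · rw [hij, hεε, one_mul]
    · have : (H : Matrix n n ℝ) i j = 0 := hH hij
      rw [this, mul_zero]

end Conjugation

/-! ### Roots as weights of matrix entries -/

section Entries

variable {n : Type} [Fintype n] [DecidableEq n] {𝔤 : LieSubalgebra ℝ (Matrix n n ℝ)}

/-- A criterion for paired roots in terms of matrix entries. The roots are the weights of the
entries at the places `(r i, r j)` with `T i j`, where `M` acts by `s m i * s m j`. The set `E`
consists of sign vectors of elements of `M`, and it separates the roots which are not in the same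
class. -/
theorem exists_hasPairedRoots {N : Type} (r : N → n) (T : N → N → Prop)
    (hT : ∀ i j, T i j → T j i) (s : groupM 𝔤 → N → ℝ) (hs : ∀ m i, s m i * s m i = 1)
    (hact : ∀ (m : groupM 𝔤) i j, T i j → ∀ Y : 𝔤,
      (((m : 𝔤 ≃ₗ[ℝ] 𝔤) Y : 𝔤) : Matrix n n ℝ) (r i) (r j) =
      s m i * s m j * (Y : Matrix n n ℝ) (r i) (r j))
    (hsupp : ∀ α ≠ 0, ∀ X ∈ rootSpace 𝔤 α, X ≠ 0 →
      ∃ i j, T i j ∧ (X : Matrix n n ℝ) (r i) (r j) ≠ 0)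
    (hone : ∀ i j, T i j → ∀ X ∈ rootSpace 𝔤 (entryRoot 𝔤 (r i) (r j)),
      (X : Matrix n n ℝ) (r i) (r j) = 0 → X = 0)
    (hroot : ∀ i j, T i j → entryRoot 𝔤 (r i) (r j) ∈ roots 𝔤)
    (E : (N → ℤ) → Prop) (hE : ∀ ε, E ε → ∃ m : groupM 𝔤, ∀ (Y : 𝔤) i j,
      (((m : 𝔤 ≃ₗ[ℝ] 𝔤) Y : 𝔤) : Matrix n n ℝ) (r i) (r j) =
        ε i * ε j * (Y : Matrix n n ℝ) (r i) (r j))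
    (hpair : ∀ i j, T i j → ∃ i' j', T i' j' ∧
      entryRoot 𝔤 (r i') (r j') ≠ entryRoot 𝔤 (r i) (r j) ∧
      entryRoot 𝔤 (r i') (r j') ≠ entryRoot 𝔤 (r j) (r i) ∧
      (∀ m, s m i' * s m j' = s m i * s m j) ∧
      ∀ k l, T k l → (∀ ε, E ε → ε k * ε l = ε i * ε j) →
        entryRoot 𝔤 (r k) (r l) = entryRoot 𝔤 (r i) (r j) ∨
        entryRoot 𝔤 (r k) (r l) = entryRoot 𝔤 (r j) (r i) ∨
        entryRoot 𝔤 (r k) (r l) = entryRoot 𝔤 (r i') (r j') ∨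
        entryRoot 𝔤 (r k) (r l) = entryRoot 𝔤 (r j') (r i')) :
    ∃ χ, HasPairedRoots 𝔤 χ := by
  classical
  have hex : ∀ α ∈ roots 𝔤, ∃ i j, T i j ∧ entryRoot 𝔤 (r i) (r j) = α := by
    rintro α ⟨h0, hne⟩
    obtain ⟨X, hX, hX0⟩ := (Submodule.ne_bot_iff _).1 hne
    obtain ⟨i, j, hij, hne⟩ := hsupp α h0 X hX hX0
    exact ⟨i, j, hij, (mem_rootSpace_iff _ _).1 hX _ _ hne⟩
  have hsmul : ∀ i j, T i j → ∀ X ∈ rootSpace 𝔤 (entryRoot 𝔤 (r i) (r j)), X ≠ 0 →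
      ∀ Y ∈ rootSpace 𝔤 (entryRoot 𝔤 (r i) (r j)),
      ((Y : Matrix n n ℝ) (r i) (r j) / (X : Matrix n n ℝ) (r i) (r j)) • X = Y := by
    intro i j hij X hX hX0 Y hY
    have hne : (X : Matrix n n ℝ) (r i) (r j) ≠ 0 := fun h => hX0 (hone i j hij X hX h)
    rw [← sub_eq_zero]
    refine hone i j hij _ (Submodule.sub_mem _ (Submodule.smul_mem _ _ hX) hY) ?_
    change (Y : Matrix n n ℝ) (r i) (r j) / (X : Matrix n n ℝ) (r i) (r j) *
      (X : Matrix n n ℝ) (r i) (r j) - (Y : Matrix n n ℝ) (r i) (r j) = 0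
    rw [div_mul_cancel₀ _ hne, sub_self]
  have hscal : ∀ i j, T i j → ∀ m : groupM 𝔤, ∀ X ∈ rootSpace 𝔤 (entryRoot 𝔤 (r i) (r j)),
      (m : 𝔤 ≃ₗ[ℝ] 𝔤) X = (s m i * s m j) • X := by
    intro i j hij m X hX
    rw [← sub_eq_zero]
    refine hone i j hij _ (Submodule.sub_mem _ (groupM_mem_rootSpace 𝔤 m _ hX)
      (Submodule.smul_mem _ _ hX)) ?_
    change (((m : 𝔤 ≃ₗ[ℝ] 𝔤) X : 𝔤) : Matrix n n ℝ) (r i) (r j) -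
      s m i * s m j * (X : Matrix n n ℝ) (r i) (r j) = 0
    rw [hact m i j hij, sub_self]
  let χ : Module.Dual ℝ (cartan 𝔤) → groupM 𝔤 → ℝ := fun α m =>
    if h : ∃ ij : N × N, T ij.1 ij.2 ∧ entryRoot 𝔤 (r ij.1) (r ij.2) = α then
      s m h.choose.1 * s m h.choose.2 else 0
  have hχ : ∀ i j, T i j → ∀ m, χ (entryRoot 𝔤 (r i) (r j)) m = s m i * s m j := by
    intro i j hij m
    have h : ∃ ij : N × N, T ij.1 ij.2 ∧
        entryRoot 𝔤 (r ij.1) (r ij.2) = entryRoot 𝔤 (r i) (r j) := ⟨(i, j), hij, rfl⟩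
    have e : χ (entryRoot 𝔤 (r i) (r j)) m = s m h.choose.1 * s m h.choose.2 := dif_pos h
    rw [e]
    obtain ⟨h1, h2⟩ := h.choose_spec
    obtain ⟨X, hX, hX0⟩ := exists_ne_zero_mem_rootSpace (hroot i j hij)
    refine smul_left_injective ℝ hX0 ?_
    change (s m h.choose.1 * s m h.choose.2) • X = (s m i * s m j) • X
    rw [← hscal i j hij m X hX, hscal _ _ h1 m X (by rw [h2]; exact hX)]
  have hE' : ∀ ε, E ε → ∃ m : groupM 𝔤, ∀ i j, T i j → s m i * s m j = ε i * ε j := by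
    intro ε hε
    obtain ⟨m, hm⟩ := hE ε hε
    refine ⟨m, fun i j hij => ?_⟩
    obtain ⟨X, hX, hX0⟩ := exists_ne_zero_mem_rootSpace (hroot i j hij)
    have hne : (X : Matrix n n ℝ) (r i) (r j) ≠ 0 := fun h => hX0 (hone i j hij X hX h)
    refine mul_right_cancel₀ hne ?_
    rw [← hact m i j hij, hm]
  refine ⟨χ, ⟨fun α hα X hX hX0 Y hY => ?_, fun α hα m X hX => ?_, fun α hα m => ?_,
    fun α hα => ?_⟩⟩ <;> obtain ⟨i, j, hij, rfl⟩ := hex α hα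
  · exact ⟨_, hsmul i j hij X hX hX0 Y hY⟩
  · rw [hscal i j hij m X hX, hχ i j hij]
  · rw [hχ i j hij]
    calc s m i * s m j * (s m i * s m j) = (s m i * s m i) * (s m j * s m j) := by ring
      _ = 1 := by rw [hs, hs, one_mul]
  · obtain ⟨i', j', hij', h1, h2, h3, h4⟩ := hpair i j hij
    refine ⟨_, hroot i' j' hij', h1, by rwa [neg_entryRoot], fun β hβ => ?_⟩
    obtain ⟨k, l, hkl, rfl⟩ := hex β hβ
    rw [neg_entryRoot, neg_entryRoot]
    constructor
    · intro e
      refine h4 k l hkl fun ε hε => ?_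
      obtain ⟨m, hm⟩ := hE' ε hε
      have e2 := congrFun e m
      rw [hχ k l hkl, hχ i j hij, hm k l hkl, hm i j hij] at e2
      exact_mod_cast e2
    · rintro (e | e | e | e) <;> rw [e] <;> funext m
      · rw [hχ j i (hT _ _ hij), hχ i j hij, mul_comm]
      · rw [hχ i' j' hij', hχ i j hij, h3]
      · rw [hχ j' i' (hT _ _ hij'), hχ i j hij, mul_comm, h3]

/-- The sign vector which is `-1` at `a` and `b` and `1` elsewhere. -/
def flipSign {ι : Type} [DecidableEq ι] (a b : ι) (i : ι) : ℤ := if i = a ∨ i = b then -1 else 1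

/-- The generator of the rotations in the plane of the coordinates `a` and `b`. -/
def rotGen {ι : Type} [DecidableEq ι] (a b : ι) : Matrix ι ι ℝ :=
  Matrix.single a b 1 - Matrix.single b a 1

theorem transpose_rotGen {ι : Type} [DecidableEq ι] (a b : ι) : (rotGen a b)ᵀ = -rotGen a b := by
  simp [rotGen]

theorem rotGen_sq {ι : Type} [Fintype ι] [DecidableEq ι] {a b : ι} (h : a ≠ b) :
    rotGen a b * rotGen a b = -(Matrix.single a a 1 + Matrix.single b b 1) := by
  simp [rotGen, sub_mul, mul_sub, Matrix.single_mul_single_of_ne, h, h.symm]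
  abel

theorem rotGen_cube {ι : Type} [Fintype ι] [DecidableEq ι] {a b : ι} (h : a ≠ b) :
    rotGen a b * rotGen a b * rotGen a b = -rotGen a b := by
  rw [rotGen_sq h]
  simp [rotGen, add_mul, mul_sub, Matrix.single_mul_single_of_ne, h, h.symm]
  exact neg_add_eq_sub _ _

theorem one_add_rotGen_sq {ι : Type} [Fintype ι] [DecidableEq ι] {a b : ι} (h : a ≠ b) :
    1 + (2 : ℝ) • (rotGen a b * rotGen a b) =
      Matrix.diagonal fun i => ((flipSign a b i : ℤ) : ℝ) := by
  rw [rotGen_sq h]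
  ext i j
  by_cases hij : i = j
  · subst hij
    by_cases ha : i = a
    · subst ha
      simp [flipSign, h.symm]
      norm_num
    · by_cases hb : i = b
      · subst hb
        simp [flipSign, h]
        norm_num
      · simp [flipSign, ha, hb, Ne.symm ha, Ne.symm hb]
  · have h1 : ¬ (a = i ∧ a = j) := fun h => hij (h.1.symm.trans h.2)
    have h2 : ¬ (b = i ∧ b = j) := fun h => hij (h.1.symm.trans h.2)
    simp [hij, h1, h2]

end Entries

section Mirror

variable {n : Type} [Fintype n] [DecidableEq n] {𝔤 : LieSubalgebra ℝ (Matrix n n ℝ)}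

/-- If every matrix in `𝔤` satisfies `X (r i) (r j) = -X (r (σ j)) (r (σ i))`, and these two are the
only places of weight `entryRoot (r i) (r j)`, then the root spaces are lines. -/
theorem eq_zero_of_entry_eq_zero {N : Type} {r : N → n} {σ : N → N} {T : N → N → Prop}
    (hX : ∀ (X : 𝔤) i j, (X : Matrix n n ℝ) (r i) (r j) =
      -(X : Matrix n n ℝ) (r (σ j)) (r (σ i)))
    (huniq : ∀ i j k l, T i j → T k l →
      entryRoot 𝔤 (r k) (r l) = entryRoot 𝔤 (r i) (r j) → (k = i ∧ l = j) ∨ (k = σ j ∧ l = σ i))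
    (hsupp : ∀ α ≠ 0, ∀ X ∈ rootSpace 𝔤 α, X ≠ 0 →
      ∃ i j, T i j ∧ (X : Matrix n n ℝ) (r i) (r j) ≠ 0)
    (hroot : ∀ i j, T i j → entryRoot 𝔤 (r i) (r j) ∈ roots 𝔤) (i j : N) (hij : T i j)
    (X : 𝔤) (hXmem : X ∈ rootSpace 𝔤 (entryRoot 𝔤 (r i) (r j)))
    (h0 : (X : Matrix n n ℝ) (r i) (r j) = 0) : X = 0 := by
  by_contra hne
  obtain ⟨k, l, hkl, hkl0⟩ := hsupp _ (hroot i j hij).1 X hXmem hne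
  rcases huniq i j k l hij hkl ((mem_rootSpace_iff _ _).1 hXmem _ _ hkl0) with
    ⟨rfl, rfl⟩ | ⟨rfl, rfl⟩
  · exact hkl0 h0
  · rw [hX X i j] at h0
    exact hkl0 (neg_eq_zero.1 h0)

/-- The weights of the places `(± i, ± j)` and `(± j, ± i)`, where `σ` is the change of sign. -/
theorem entryRoot_mem_class {N : Type} {r : N → n} {σ : N → N} (hσ : ∀ i, σ (σ i) = i)
    (hmir : ∀ i j, entryRoot 𝔤 (r (σ j)) (r (σ i)) = entryRoot 𝔤 (r i) (r j)) {i j k l : N}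
    (h : ((k = i ∨ k = σ i) ∧ (l = j ∨ l = σ j)) ∨ ((k = j ∨ k = σ j) ∧ (l = i ∨ l = σ i))) :
    entryRoot 𝔤 (r k) (r l) = entryRoot 𝔤 (r i) (r j) ∨
    entryRoot 𝔤 (r k) (r l) = entryRoot 𝔤 (r j) (r i) ∨
    entryRoot 𝔤 (r k) (r l) = entryRoot 𝔤 (r i) (r (σ j)) ∨
    entryRoot 𝔤 (r k) (r l) = entryRoot 𝔤 (r (σ j)) (r i) := by
  have h1 := hmir i (σ j)
  have h2 := hmir (σ j) i
  rw [hσ] at h1 h2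
  rcases h with ⟨rfl | rfl, rfl | rfl⟩ | ⟨rfl | rfl, rfl | rfl⟩
  · exact Or.inl rfl
  · exact Or.inr (Or.inr (Or.inl rfl))
  · exact Or.inr (Or.inr (Or.inr h2))
  · exact Or.inr (Or.inl (hmir _ _))
  · exact Or.inr (Or.inl rfl)
  · exact Or.inr (Or.inr (Or.inl h1))
  · exact Or.inr (Or.inr (Or.inr rfl))
  · exact Or.inl (hmir _ _)

/-- The map that identifies the paired coordinates `i` and `i.swap`. -/
def foldSum {ι : Type} : ι ⊕ ι → ι := Sum.elim id id

theorem foldSum_eq_iff {ι : Type} (i j : ι ⊕ ι) : foldSum i = foldSum j ↔ i = j ∨ i = j.swap := by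
  rcases i with i | i <;> rcases j with j | j <;> simp [foldSum]

/-- Classes of roots for the indices `Fin l ⊕ Fin l`: the class of the weight of `(i, j)` consists
of the weights of `(± i, ± j)` and `(± j, ± i)`. -/
theorem exists_partner_of_swap {l : ℕ} {r : Fin l ⊕ Fin l → n}
    (hmir : ∀ i j, entryRoot 𝔤 (r j.swap) (r i.swap) = entryRoot 𝔤 (r i) (r j))
    (huniq : ∀ i j k m, (j ≠ i ∧ j ≠ i.swap) → (m ≠ k ∧ m ≠ k.swap) →
      entryRoot 𝔤 (r k) (r m) = entryRoot 𝔤 (r i) (r j) →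
      (k = i ∧ m = j) ∨ (k = j.swap ∧ m = i.swap))
    {s : groupM 𝔤 → Fin l ⊕ Fin l → ℝ} (hs : ∀ m i, s m i.swap = s m i)
    (hsep : ∀ x y u v : Fin l, x ≠ y → u ≠ v →
      (∀ a b, a ≠ b → flipSign a b u * flipSign a b v = flipSign a b x * flipSign a b y) →
      (u = x ∧ v = y) ∨ (u = y ∧ v = x))
    (i j : Fin l ⊕ Fin l) (hij : j ≠ i ∧ j ≠ i.swap) :
    ∃ i' j', (j' ≠ i' ∧ j' ≠ i'.swap) ∧
      entryRoot 𝔤 (r i') (r j') ≠ entryRoot 𝔤 (r i) (r j) ∧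
      entryRoot 𝔤 (r i') (r j') ≠ entryRoot 𝔤 (r j) (r i) ∧
      (∀ m, s m i' * s m j' = s m i * s m j) ∧
      ∀ k m, (m ≠ k ∧ m ≠ k.swap) →
        (∀ ε, (∃ a b, a ≠ b ∧ ε = flipSign a b ∘ foldSum) → ε k * ε m = ε i * ε j) →
        entryRoot 𝔤 (r k) (r m) = entryRoot 𝔤 (r i) (r j) ∨
        entryRoot 𝔤 (r k) (r m) = entryRoot 𝔤 (r j) (r i) ∨
        entryRoot 𝔤 (r k) (r m) = entryRoot 𝔤 (r i') (r j') ∨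
        entryRoot 𝔤 (r k) (r m) = entryRoot 𝔤 (r j') (r i') := by
  obtain ⟨h1, h2⟩ := hij
  have hsw : ∀ a : Fin l ⊕ Fin l, a.swap ≠ a := by rintro (a | a) <;> simp
  have hT : j.swap ≠ i ∧ j.swap ≠ i.swap :=
    ⟨fun h => h2 (by rw [← h, Sum.swap_swap]), fun h => h1 (Sum.swap_leftInverse.injective h)⟩
  have hne : ∀ k m : Fin l ⊕ Fin l, (m ≠ k ∧ m ≠ k.swap) → foldSum k ≠ foldSum m := by
    intro k m hkm h
    rcases (foldSum_eq_iff _ _).1 h.symm with h | h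
    · exact hkm.1 h
    · exact hkm.2 h
  refine ⟨i, j.swap, hT, fun h => ?_, fun h => ?_, fun m => by rw [hs], fun k m hkm hε => ?_⟩
  · rcases huniq i j i j.swap ⟨h1, h2⟩ hT h with ⟨-, h⟩ | ⟨h, -⟩
    · exact hsw j h
    · exact hT.1 h.symm
  · have hT' : i ≠ j ∧ i ≠ j.swap := ⟨h1.symm, hT.1.symm⟩
    rcases huniq j i i j.swap hT' hT h with ⟨h, -⟩ | ⟨h, -⟩
    · exact h1 h.symm
    · exact hsw i h.symm
  · refine entryRoot_mem_class (σ := Sum.swap) Sum.swap_swap hmir ?_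
    rcases hsep (foldSum i) (foldSum j) (foldSum k) (foldSum m) (hne _ _ ⟨h1, h2⟩) (hne _ _ hkm)
      (fun a b hab => hε _ ⟨a, b, hab, rfl⟩) with ⟨h, h'⟩ | ⟨h, h'⟩
    · exact Or.inl ⟨(foldSum_eq_iff _ _).1 h, (foldSum_eq_iff _ _).1 h'⟩
    · exact Or.inr ⟨(foldSum_eq_iff _ _).1 h, (foldSum_eq_iff _ _).1 h'⟩

end Mirror

/-! ### Orthogonal algebras -/

section Orthogonal

variable {n : Type} [Fintype n] [DecidableEq n] {𝔤 : LieSubalgebra ℝ (Matrix n n ℝ)} {σ : n → n}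

/-- The matrix of the form that pairs the coordinates `i` and `σ i`. -/
def formMatrix (σ : n → n) : Matrix n n ℝ := Matrix.of fun i j => if j = σ i then 1 else 0

theorem mul_formMatrix (hσ : ∀ i, σ (σ i) = i) (X : Matrix n n ℝ) (i j : n) :
    (X * formMatrix σ) i j = X i (σ j) := by
  rw [Matrix.mul_apply, Finset.sum_eq_single (σ j)]
  · simp [formMatrix, hσ]
  · intro a _ ha
    have : j ≠ σ a := fun e => ha (by rw [e, hσ])
    simp [formMatrix, this]
  · simp

theorem formMatrix_mul (X : Matrix n n ℝ) (i j : n) :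
    (formMatrix σ * X) i j = X (σ i) j := by
  rw [Matrix.mul_apply, Finset.sum_eq_single (σ i)]
  · simp [formMatrix]
  · intro a _ ha
    simp [formMatrix, ha]
  · simp

/-- `𝔤` is the orthogonal Lie algebra of the form that pairs the coordinates `i` and `σ i`, where
`σ` is an involution with at most one fixed point. -/
structure IsOrthogonalFor (𝔤 : LieSubalgebra ℝ (Matrix n n ℝ)) (σ : n → n) : Prop where
  involutive : ∀ i, σ (σ i) = i
  fixed : ∀ i j, σ i = i → σ j = j → i = j
  mem_iff : ∀ X : Matrix n n ℝ, X ∈ 𝔤 ↔ ∀ i j, X i j = -X (σ j) (σ i)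

theorem isOrthogonalFor_skewAdjoint (hσ : ∀ i, σ (σ i) = i)
    (hfix : ∀ i j, σ i = i → σ j = j → i = j) :
    IsOrthogonalFor (skewAdjointMatricesLieSubalgebra (formMatrix σ)) σ where
  involutive := hσ
  fixed := hfix
  mem_iff X := by
    rw [mem_skewAdjointMatricesLieSubalgebra, mem_skewAdjointMatricesSubmodule,
      Matrix.IsSkewAdjoint, Matrix.IsAdjointPair]
    constructor
    · intro e i j
      have := congrFun (congrFun e j) (σ i)
      rw [mul_formMatrix hσ, hσ, formMatrix_mul] at this
      exact this
    · intro e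
      refine Matrix.ext fun i j => ?_
      rw [mul_formMatrix hσ, formMatrix_mul, Matrix.transpose_apply, e, hσ]
      rfl

namespace IsOrthogonalFor

theorem mirror (h : IsOrthogonalFor 𝔤 σ) (X : 𝔤) (i j : n) :
    (X : Matrix n n ℝ) i j = -(X : Matrix n n ℝ) (σ j) (σ i) :=
  (h.mem_iff _).1 X.2 i j

theorem entryRoot_mirror (h : IsOrthogonalFor 𝔤 σ) (i j : n) :
    entryRoot 𝔤 (σ j) (σ i) = entryRoot 𝔤 i j := by
  refine LinearMap.ext fun H => ?_
  rw [entryRoot_apply, entryRoot_apply, h.mirror H i i, h.mirror H j j]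
  ring

theorem exists_cartan (h : IsOrthogonalFor 𝔤 σ) (a : n) : ∃ H : cartan 𝔤, ∀ i,
    (H : Matrix n n ℝ) i i = (if i = a then 1 else 0) - (if i = σ a then 1 else 0) := by
  have hmem : Matrix.diagonal (fun i : n =>
      ((if i = a then 1 else 0) - (if i = σ a then 1 else 0) : ℝ)) ∈ 𝔤 := by
    refine (h.mem_iff _).2 fun i j => ?_
    have h1 : ∀ i, σ i = a ↔ i = σ a := fun i =>
      ⟨fun e => by rw [← e, h.involutive], fun e => by rw [e, h.involutive]⟩
    have h2 : ∀ i, σ i = σ a ↔ i = a := fun i =>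
      ⟨fun e => by rw [← h.involutive i, e, h.involutive], fun e => by rw [e]⟩
    by_cases hij : i = j
    · subst hij
      rw [Matrix.diagonal_apply_eq, Matrix.diagonal_apply_eq]
      simp only [h1, h2]
      ring
    · rw [Matrix.diagonal_apply_ne _ hij, Matrix.diagonal_apply_ne, neg_zero]
      exact fun e => hij (by rw [← h.involutive i, ← e, h.involutive])
  exact ⟨⟨⟨_, hmem⟩, Matrix.isDiag_diagonal _⟩, fun i => Matrix.diagonal_apply_eq _ _⟩

theorem exists_separating (h : IsOrthogonalFor 𝔤 σ) {i j : n} (hij : i ≠ j) :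
    ∃ H : cartan 𝔤, (H : Matrix n n ℝ) i i ≠ (H : Matrix n n ℝ) j j := by
  by_cases hi : σ i = i
  · have hj : σ j ≠ j := fun hj => hij (h.fixed i j hi hj)
    obtain ⟨H, hH⟩ := h.exists_cartan j
    refine ⟨H, ?_⟩
    rw [hH, hH, if_neg hij, if_pos rfl, if_neg hj.symm, if_neg]
    · norm_num
    · exact fun e => hij (by rw [← hi, e, h.involutive])
  · obtain ⟨H, hH⟩ := h.exists_cartan i
    refine ⟨H, ?_⟩
    rw [hH, hH, if_neg hij.symm, if_pos rfl, if_neg (Ne.symm hi)]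
    split_ifs <;> norm_num

theorem entryRoot_unique (h : IsOrthogonalFor 𝔤 σ) (i j k l : n) (hij : j ≠ i ∧ j ≠ σ i)
    (hkl : l ≠ k ∧ l ≠ σ k) (e : entryRoot 𝔤 k l = entryRoot 𝔤 i j) :
    (k = i ∧ l = j) ∨ (k = σ j ∧ l = σ i) := by
  have hinv := h.involutive
  have hfix := h.fixed
  have key : ∀ a : n, (((if k = a then 1 else 0) - (if k = σ a then 1 else 0)) -
      ((if l = a then 1 else 0) - (if l = σ a then 1 else 0)) : ℝ) =
      ((if i = a then 1 else 0) - (if i = σ a then 1 else 0)) -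
      ((if j = a then 1 else 0) - (if j = σ a then 1 else 0)) := by
    intro a
    obtain ⟨H, hH⟩ := h.exists_cartan a
    have := LinearMap.congr_fun e H
    rwa [entryRoot_apply, entryRoot_apply, hH, hH, hH, hH] at this
  have key' : ∀ a : n, (((if k = a then 1 else 0) - (if k = σ a then 1 else 0)) -
      ((if l = a then 1 else 0) - (if l = σ a then 1 else 0)) : ℤ) =
      ((if i = a then 1 else 0) - (if i = σ a then 1 else 0)) -
      ((if j = a then 1 else 0) - (if j = σ a then 1 else 0)) := by
    intro a
    exact_mod_cast key a
  clear key e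
  have ki := key' i
  have kj := key' j
  have kk := key' k
  have kl := key' l
  grind

theorem entryRoot_mem_roots (h : IsOrthogonalFor 𝔤 σ) (i j : n) (hij : j ≠ i ∧ j ≠ σ i) :
    entryRoot 𝔤 i j ∈ roots 𝔤 := by
  have hinv := h.involutive
  constructor
  · intro e
    have hT : i ≠ j ∧ i ≠ σ j := ⟨hij.1.symm, fun e => hij.2 (by rw [e, hinv])⟩
    -- a vanishing root would coincide with its negative
    rcases h.entryRoot_unique i j j i hij hT (by rw [← neg_entryRoot, e, neg_zero]) with
      ⟨e, -⟩ | ⟨e1, e2⟩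
    · exact hij.1 e
    · exact hij.1 (h.fixed j i e1.symm e2.symm)
  · have hmem : Matrix.single i j (1 : ℝ) - Matrix.single (σ j) (σ i) 1 ∈ 𝔤 := by
      refine (h.mem_iff _).2 fun a b => ?_
      have h1 : (σ j = a ∧ σ i = b) ↔ (i = σ b ∧ j = σ a) := by grind
      have h2 : (σ j = σ b ∧ σ i = σ a) ↔ (i = a ∧ j = b) := by grind
      simp only [Matrix.sub_apply, Matrix.single_apply, h1, h2]
      ring
    refine (Submodule.ne_bot_iff _).2 ⟨⟨_, hmem⟩, (mem_rootSpace_iff _ _).2 fun a b hab => ?_, ?_⟩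
    · change (Matrix.single i j (1 : ℝ) - Matrix.single (σ j) (σ i) 1 : Matrix n n ℝ) a b ≠ 0 at hab
      rw [Matrix.sub_apply, Matrix.single_apply, Matrix.single_apply] at hab
      by_cases h1 : i = a ∧ j = b
      · rw [← h1.1, ← h1.2]
      · by_cases h2 : σ j = a ∧ σ i = b
        · rw [← h2.1, ← h2.2, h.entryRoot_mirror]
        · rw [if_neg h1, if_neg h2, sub_zero] at hab
          exact absurd rfl hab
    · intro e
      have e2 := congrFun (congrFun (congrArg Subtype.val e) i) j
      change (Matrix.single i j (1 : ℝ) - Matrix.single (σ j) (σ i) 1 : Matrix n n ℝ) i j = 0 at e2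
      rw [Matrix.sub_apply, Matrix.single_apply, Matrix.single_apply, if_pos ⟨rfl, rfl⟩,
        if_neg (fun h => hij.2 h.2.symm)] at e2
      norm_num at e2

theorem exists_entry (h : IsOrthogonalFor 𝔤 σ) (α : Module.Dual ℝ (cartan 𝔤)) (hα : α ≠ 0)
    (X : 𝔤)
    (hX : X ∈ rootSpace 𝔤 α) (hX0 : X ≠ 0) :
    ∃ i j, (j ≠ i ∧ j ≠ σ i) ∧ (X : Matrix n n ℝ) i j ≠ 0 := by
  obtain ⟨i, j, hij⟩ := exists_entry_ne_zero hX0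
  have e := (mem_rootSpace_iff _ _).1 hX i j hij
  refine ⟨i, j, ⟨?_, ?_⟩, hij⟩
  · rintro rfl
    exact hα (by rw [← e]; exact LinearMap.ext fun H => sub_self _)
  · rintro rfl
    have := h.mirror X i (σ i)
    rw [h.involutive] at this
    exact hij (by linarith)

theorem commute_formMatrix_iff (h : IsOrthogonalFor 𝔤 σ) (X : Matrix n n ℝ) :
    Commute X (formMatrix σ) ↔ ∀ i j, X (σ i) (σ j) = X i j := by
  constructor
  · intro e i j
    have := congrFun (congrFun e.eq i) (σ j)
    rw [mul_formMatrix h.involutive, formMatrix_mul, h.involutive] at this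
    exact this.symm
  · intro e
    refine Matrix.ext fun i j => ?_
    rw [mul_formMatrix h.involutive, formMatrix_mul, ← e, h.involutive]

/-- The elements of `M` are conjugations by diagonal sign matrices which are invariant under `σ` and
commute with every matrix `C` that commutes with the skew-symmetric part of `𝔤`. -/
theorem exists_signs (h : IsOrthogonalFor 𝔤 σ) {C : Matrix n n ℝ}
    (hC : ∀ X : 𝔤, (X : Matrix n n ℝ)ᵀ = -(X : Matrix n n ℝ) → Commute (X : Matrix n n ℝ) C)
    (hCt : Cᵀ = C ∨ Cᵀ = -C) (m : groupM 𝔤) :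
    ∃ s : n → ℝ, (∀ i, s i * s i = 1) ∧ (∀ i, s (σ i) = s i) ∧
      (∀ i j, C i j ≠ 0 → s i = s j) ∧
      ∀ (Y : 𝔤) i j, (((m : 𝔤 ≃ₗ[ℝ] 𝔤) Y : 𝔤) : Matrix n n ℝ) i j =
        s i * s j * (Y : Matrix n n ℝ) i j := by
  have hJ : (formMatrix σ)ᵀ = formMatrix σ := by
    ext i j
    have : i = σ j ↔ j = σ i :=
      ⟨fun e => by rw [e, h.involutive], fun e => by rw [e, h.involutive]⟩
    simp [formMatrix, this]
  obtain ⟨k, hk, ⟨hkJ, hkC⟩, hY, hk0⟩ := exists_matrix_of_groupM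
    (fun k => Commute k (formMatrix σ) ∧ Commute k C) ⟨Commute.one_left _, Commute.one_left _⟩
    (fun k l hk hl => ⟨hk.1.mul_left hl.1, hk.2.mul_left hl.2⟩)
    (fun k _ hk' => by
      have htr : ∀ A B : Matrix n n ℝ, Commute A B → Commute Aᵀ Bᵀ := fun A B hAB => by
        change Aᵀ * Bᵀ = Bᵀ * Aᵀ
        rw [← Matrix.transpose_mul, ← Matrix.transpose_mul, hAB.eq]
      refine ⟨hJ ▸ htr _ _ hk'.1, ?_⟩
      rcases hCt with e | e
      · exact e ▸ htr _ _ hk'.2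
      · have := htr _ _ hk'.2
        rw [e] at this
        simpa using this.neg_right)
    (fun X hX => ⟨by
      have hXJ : Commute (X : Matrix n n ℝ) (formMatrix σ) := by
        refine (h.commute_formMatrix_iff _).2 fun i j => ?_
        have e := congrFun (congrFun hX j) i
        rw [Matrix.transpose_apply, Matrix.neg_apply] at e
        rw [e, h.mirror X j i, neg_neg]
      exact hXJ.exp_left, (hC X hX).exp_left⟩) m
  have hk0' : ∀ i a, a ≠ i → k i a = 0 := fun i a ha => hk0 i a (h.exists_separating ha.symm)
  have hkd : k = Matrix.diagonal fun i => k i i := by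
    ext i j
    by_cases hij : i = j
    · rw [hij, Matrix.diagonal_apply_eq]
    · rw [Matrix.diagonal_apply_ne _ hij, hk0' i j (Ne.symm hij)]
  refine ⟨fun i => k i i, fun i => mul_self_of_row hk (hk0' i),
    fun i => (h.commute_formMatrix_iff k).1 hkJ i i, fun i j hij => ?_, fun Y i j => ?_⟩
  · have e := congrFun (congrFun hkC.eq i) j
    rw [hkd, Matrix.diagonal_mul, Matrix.mul_diagonal, mul_comm] at e
    exact mul_left_cancel₀ hij e
  · rw [hY, conj_apply_of_row (hk0' i) (hk0' j)]

end IsOrthogonalFor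

end Orthogonal

/-! ### Type `D_l` -/

section DoubleRotation

variable {ι : Type} [DecidableEq ι]

/-- The rotation generator acting in the same way on both summands of `ι ⊕ ι`. -/
def doubleRotGen (a b : ι) : Matrix (ι ⊕ ι) (ι ⊕ ι) ℝ :=
  Matrix.fromBlocks (rotGen a b) 0 0 (rotGen a b)

theorem transpose_doubleRotGen (a b : ι) : (doubleRotGen a b)ᵀ = -doubleRotGen a b := by
  rw [doubleRotGen, Matrix.fromBlocks_transpose, transpose_rotGen, Matrix.transpose_zero,
    Matrix.fromBlocks_neg, neg_zero]

theorem doubleRotGen_cube [Fintype ι] {a b : ι} (h : a ≠ b) :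
    doubleRotGen a b * doubleRotGen a b * doubleRotGen a b = -doubleRotGen a b := by
  simp [doubleRotGen, Matrix.fromBlocks_multiply, Matrix.fromBlocks_neg, rotGen_cube h]

theorem one_add_doubleRotGen_sq [Fintype ι] {a b : ι} (h : a ≠ b) :
    1 + (2 : ℝ) • (doubleRotGen a b * doubleRotGen a b) =
      Matrix.diagonal fun i => ((flipSign a b (foldSum i) : ℤ) : ℝ) := by
  have e := one_add_rotGen_sq h
  simp only [doubleRotGen, Matrix.fromBlocks_multiply, ← Matrix.fromBlocks_one,
    Matrix.fromBlocks_smul, Matrix.fromBlocks_add, zero_mul, mul_zero, add_zero, zero_add,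
    smul_zero, e, Matrix.fromBlocks_diagonal]
  congr 1
  ext (i | i) <;> rfl

theorem doubleRotGen_mirror (a b : ι) (i j : ι ⊕ ι) :
    doubleRotGen a b i j = -doubleRotGen a b j.swap i.swap := by
  have h : ∀ i j, rotGen a b i j = -rotGen a b j i := fun i j =>
    congrFun (congrFun (transpose_rotGen a b) j) i
  rcases i with i | i <;> rcases j with j | j <;> simp [doubleRotGen] <;> exact h i j

end DoubleRotation

section TypeD

/-- Pairs of indices are separated by the sign changes of two coordinates. For `l = 4` a pair could
not be told from its complement. -/
theorem flipSign_separates {l : ℕ} (hl : 5 ≤ l) (x y u v : Fin l) (hxy : x ≠ y)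
    (h : ∀ a b, a ≠ b → flipSign a b u * flipSign a b v = flipSign a b x * flipSign a b y) :
    (u = x ∧ v = y) ∨ (u = y ∧ v = x) := by
  -- the sign changes at `c` and one of `x`, `y` detect whether `x` and `y` are among `u`, `v`
  obtain ⟨c, hc⟩ : ∃ c : Fin l, c ∉ ({x, y, u, v} : Finset (Fin l)) := by
    by_contra! H
    have h1 : Finset.univ ⊆ ({x, y, u, v} : Finset (Fin l)) := fun c _ => H c
    have h2 := Finset.card_le_card h1
    have h3 : ({x, y, u, v} : Finset (Fin l)).card ≤ 4 := Finset.card_le_four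
    rw [Finset.card_univ, Fintype.card_fin] at h2
    omega
  simp only [Finset.mem_insert, Finset.mem_singleton, not_or] at hc
  obtain ⟨h1, h2, h3, h4⟩ := hc
  have hx := h x c (Ne.symm h1)
  have hy := h y c (Ne.symm h2)
  simp only [flipSign] at hx hy
  grind

theorem typeD_eq (l : ℕ) : LieAlgebra.Orthogonal.typeD (Fin l) ℝ =
    skewAdjointMatricesLieSubalgebra (formMatrix (Sum.swap : Fin l ⊕ Fin l → Fin l ⊕ Fin l)) := by
  rw [LieAlgebra.Orthogonal.typeD]
  congr 1
  ext i j
  rcases i with i | i <;> rcases j with j | j <;>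
    simp [LieAlgebra.Orthogonal.JD, formMatrix, Matrix.one_apply, eq_comm]

theorem isOrthogonalFor_typeD (l : ℕ) :
    IsOrthogonalFor (LieAlgebra.Orthogonal.typeD (Fin l) ℝ) Sum.swap := by
  rw [typeD_eq]
  exact isOrthogonalFor_skewAdjoint Sum.swap_swap (by rintro (i | i) j h <;> simp at h)

/-- The class of the root `ε_i - ε_j` consists, up to sign, of `ε_i - ε_j` and `ε_i + ε_j`. -/
theorem exists_hasPairedRoots_typeD {l : ℕ} (hl : 5 ≤ l) :
    ∃ χ, HasPairedRoots (LieAlgebra.Orthogonal.typeD (Fin l) ℝ) χ := by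
  have h := isOrthogonalFor_typeD l
  choose s hs hσ _hC hact using fun m =>
    h.exists_signs (C := 1) (fun X _ => Commute.one_right _) (Or.inl Matrix.transpose_one) m
  refine exists_hasPairedRoots id (fun i j => j ≠ i ∧ j ≠ i.swap) ?_ s hs
    (fun m i j _ Y => hact m Y i j) h.exists_entry ?_ h.entryRoot_mem_roots
    (fun ε => ∃ a b, a ≠ b ∧ ε = flipSign a b ∘ foldSum) ?_ ?_
  · exact fun i j hij => ⟨hij.1.symm, fun e => hij.2 (by rw [e, Sum.swap_swap])⟩
  · exact eq_zero_of_entry_eq_zero (r := id) (σ := Sum.swap) h.mirror h.entryRoot_unique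
      h.exists_entry h.entryRoot_mem_roots
  · rintro ε ⟨a, b, hab, rfl⟩
    exact exists_groupM_of_skew ((h.mem_iff _).2 (doubleRotGen_mirror a b))
      (transpose_doubleRotGen a b) (doubleRotGen_cube hab) (one_add_doubleRotGen_sq hab)
  · exact exists_partner_of_swap (r := id) h.entryRoot_mirror h.entryRoot_unique hσ
      (fun x y u v hxy _ => flipSign_separates hl x y u v hxy)

end TypeD

/-! ### Type `B₂` -/

section TypeB2

/-- The involution of the coordinates of `𝔰𝔬(3,2)`. -/
def swapB2 : Unit ⊕ (Fin 2 ⊕ Fin 2) → Unit ⊕ (Fin 2 ⊕ Fin 2) := Sum.map id Sum.swap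

theorem isOrthogonalFor_splitB2 : IsOrthogonalFor splitB2 swapB2 := by
  have e : splitB2 = skewAdjointMatricesLieSubalgebra (formMatrix swapB2) := by
    rw [splitB2]
    congr 1
    ext i j
    rcases i with i | i | i <;> rcases j with j | j | j <;>
      simp [LieAlgebra.Orthogonal.JD, formMatrix, swapB2, Matrix.one_apply, eq_comm]
  rw [e]
  exact isOrthogonalFor_skewAdjoint (by decide) (by decide)

/-- The generator of the centre `𝔰𝔬(2)` of the maximal compact subalgebra `𝔰𝔬(3) ⊕ 𝔰𝔬(2)`. -/
def centerB2 : Matrix (Unit ⊕ (Fin 2 ⊕ Fin 2)) (Unit ⊕ (Fin 2 ⊕ Fin 2)) ℝ :=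
  Matrix.fromBlocks 0 0 0
    (Matrix.fromBlocks (rotGen 0 1) (-rotGen 0 1) (-rotGen 0 1) (rotGen 0 1))

theorem transpose_centerB2 : centerB2ᵀ = -centerB2 := by
  simp [centerB2, Matrix.fromBlocks_transpose, Matrix.fromBlocks_neg, transpose_rotGen]

/-- A skew-symmetric matrix in `𝔰𝔬(3,2)` commutes with the centre of the maximal compact
subalgebra. -/
theorem commute_centerB2 (X : splitB2)
    (hX : (X : Matrix (Unit ⊕ (Fin 2 ⊕ Fin 2)) (Unit ⊕ (Fin 2 ⊕ Fin 2)) ℝ)ᵀ = -X.1) :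
    Commute X.1 centerB2 := by
  have hm : ∀ i j, X.1 i j = -X.1 (swapB2 j) (swapB2 i) := isOrthogonalFor_splitB2.mirror X
  have hs : ∀ i j, X.1 i j = -X.1 j i := fun i j => congrFun (congrFun hX j) i
  obtain ⟨A, B, C, D, hA⟩ : ∃ A B C D, X.1 = Matrix.fromBlocks A B C D :=
    ⟨_, _, _, _, (Matrix.fromBlocks_toBlocks X.1).symm⟩
  obtain ⟨D₁, D₂, D₃, D₄, rfl⟩ : ∃ D₁ D₂ D₃ D₄, D = Matrix.fromBlocks D₁ D₂ D₃ D₄ :=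
    ⟨_, _, _, _, (Matrix.fromBlocks_toBlocks D).symm⟩
  rw [hA] at hm hs ⊢
  have b : ∀ i, B () (Sum.inr i) = B () (Sum.inl i) := fun i => by
    have h1 := hm (.inl ()) (.inr (.inl i))
    have h2 := hs (.inl ()) (.inr (.inr i))
    simp [swapB2] at h1 h2
    linarith
  have c : ∀ i, C (Sum.inr i) () = C (Sum.inl i) () := fun i => by
    have h1 := hm (.inr (.inl i)) (.inl ())
    have h2 := hs (.inr (.inr i)) (.inl ())
    simp [swapB2] at h1 h2
    linarith
  have d1 : ∀ i j, D₁ i j = -D₁ j i := fun i j => by simpa using hs (.inr (.inl i)) (.inr (.inl j))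
  have d2 : ∀ i j, D₂ i j = -D₂ j i := fun i j => by
    simpa [swapB2] using hm (.inr (.inl i)) (.inr (.inr j))
  have d3 : ∀ i j, D₃ i j = D₂ i j := fun i j => by
    have h1 := hs (.inr (.inr i)) (.inr (.inl j))
    simp at h1
    rw [h1, ← d2]
  have d4 : ∀ i j, D₄ i j = D₁ i j := fun i j => by
    have h1 := hm (.inr (.inr i)) (.inr (.inr j))
    simp [swapB2] at h1
    rw [h1, ← d1]
  have e1 : ∀ i, D₁ i i = 0 := fun i => by linarith [d1 i i]
  have e2 : ∀ i, D₂ i i = 0 := fun i => by linarith [d2 i i]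
  refine Matrix.ext fun i j => ?_
  rcases i with i | i | i <;> rcases j with j | j | j <;> fin_cases i <;> fin_cases j <;>
    simp [centerB2, Matrix.mul_apply, Fin.sum_univ_two, rotGen, b, c, d3, d4, e1, e2] <;>
    linarith [d1 0 1, d2 0 1]

/-- The two long roots are `M`-equivalent up to sign, and so are the two short ones: the elements of
`M` commute with `centerB2`, so they act by the same sign on all isotropic coordinates. -/
theorem exists_hasPairedRoots_splitB2 : ∃ χ, HasPairedRoots splitB2 χ := by
  have h := isOrthogonalFor_splitB2
  choose s hs hσ hC hact using fun m =>
    h.exists_signs (C := centerB2) commute_centerB2 (Or.inr transpose_centerB2) m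
  have hconst : ∀ m i j, s m (.inr i) = s m (.inr j) := by
    intro m
    have h1 : s m (.inr (.inl 0)) = s m (.inr (.inl 1)) :=
      hC m _ _ (by simp [centerB2, rotGen])
    have h2 : ∀ i : Fin 2, s m (.inr (.inr i)) = s m (.inr (.inl i)) := fun i =>
      hσ m (.inr (.inl i))
    have h3 : ∀ i, s m (.inr i) = s m (.inr (.inl 0)) := by
      rintro (i | i) <;> fin_cases i <;> simp [h1, h2]
    intro i j
    rw [h3 i, h3 j]
  refine exists_hasPairedRoots id (fun i j => j ≠ i ∧ j ≠ swapB2 i) ?_ s hs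
    (fun m i j _ Y => hact m Y i j) h.exists_entry ?_ h.entryRoot_mem_roots
    (fun ε : Unit ⊕ (Fin 2 ⊕ Fin 2) → ℤ => ε = Sum.elim (fun _ => 1) (fun _ => -1)) ?_ ?_
  · exact fun i j hij => ⟨hij.1.symm, fun e => hij.2 (by rw [e, h.involutive])⟩
  · exact eq_zero_of_entry_eq_zero (r := id) (σ := swapB2) h.mirror h.entryRoot_unique
      h.exists_entry h.entryRoot_mem_roots
  · rintro ε rfl
    have hZ : (Matrix.fromBlocks 0 0 0 (doubleRotGen 0 1) :
        Matrix (Unit ⊕ (Fin 2 ⊕ Fin 2)) (Unit ⊕ (Fin 2 ⊕ Fin 2)) ℝ) ∈ splitB2 := by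
      refine (h.mem_iff _).2 ?_
      rintro (i | i) (j | j)
      · simp [swapB2]
      · simp [swapB2]
      · simp [swapB2]
      · exact doubleRotGen_mirror 0 1 i j
    have h01 : (0 : Fin 2) ≠ 1 := by decide
    refine exists_groupM_of_skew hZ ?_ ?_ ?_
    · simp [Matrix.fromBlocks_transpose, Matrix.fromBlocks_neg, transpose_doubleRotGen]
    · simp [Matrix.fromBlocks_multiply, Matrix.fromBlocks_neg, doubleRotGen_cube h01]
    · have e := one_add_doubleRotGen_sq h01
      rw [← Matrix.fromBlocks_one, Matrix.fromBlocks_multiply, Matrix.fromBlocks_smul,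
        Matrix.fromBlocks_add]
      simp only [Matrix.zero_mul, Matrix.mul_zero, add_zero, zero_add, smul_zero]
      rw [e, ← Matrix.diagonal_one, Matrix.fromBlocks_diagonal]
      congr 1
      ext (i | i | i)
      · simp
      · fin_cases i <;> simp [flipSign, foldSum]
      · fin_cases i <;> simp [flipSign, foldSum]
  · have hlong : ∀ i j k l : Fin 2 ⊕ Fin 2, j ≠ i ∧ j ≠ i.swap → l ≠ k ∧ l ≠ k.swap →
        ((k = i ∨ k = i.swap) ∧ (l = j ∨ l = j.swap)) ∨
        ((k = j ∨ k = j.swap) ∧ (l = i ∨ l = i.swap)) := by decide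
    have hshort : ∀ j : Fin 2 ⊕ Fin 2, ∃ j', j' ≠ j ∧ j' ≠ j.swap ∧
        ∀ k, k = j ∨ k = j.swap ∨ k = j' ∨ k = j'.swap := by decide
    have hmir : ∀ j : Fin 2 ⊕ Fin 2, entryRoot splitB2 (.inl ()) (.inr j.swap) =
        entryRoot splitB2 (.inr j) (.inl ()) := fun j => h.entryRoot_mirror (.inr j) (.inl ())
    have hmir' : ∀ j : Fin 2 ⊕ Fin 2, entryRoot splitB2 (.inr j.swap) (.inl ()) =
        entryRoot splitB2 (.inl ()) (.inr j) := fun j => h.entryRoot_mirror (.inl ()) (.inr j)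
    rintro (i | i) (j | j) hij
    · exact absurd rfl hij.1
    · obtain ⟨j', h1, h2, hcov⟩ := hshort j
      refine ⟨.inl (), .inr j', ⟨by simp, by simp [swapB2]⟩, fun e => ?_, fun e => ?_,
        fun m => by rw [hconst m j' j], ?_⟩
      · rcases h.entryRoot_unique _ _ _ _ hij ⟨by simp, by simp [swapB2]⟩ e with ⟨-, e⟩ | ⟨e, -⟩
        · exact h1 (Sum.inr_injective e)
        · simp [swapB2] at e
      · rcases h.entryRoot_unique _ _ _ _ ⟨by simp, by simp [swapB2]⟩ ⟨by simp, by simp [swapB2]⟩ e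
          with ⟨e, -⟩ | ⟨-, e⟩
        · simp at e
        · exact h2 (Sum.inr_injective e)
      · rintro (k | k) (l | l) hkl hε
        · exact absurd rfl hkl.1
        · rcases hcov l with rfl | rfl | rfl | rfl
          · exact Or.inl rfl
          · exact Or.inr (Or.inl (hmir j))
          · exact Or.inr (Or.inr (Or.inl rfl))
          · exact Or.inr (Or.inr (Or.inr (hmir j')))
        · rcases hcov k with rfl | rfl | rfl | rfl
          · exact Or.inr (Or.inl rfl)
          · exact Or.inl (hmir' j)
          · exact Or.inr (Or.inr (Or.inr rfl))
          · exact Or.inr (Or.inr (Or.inl (hmir' j')))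
        · exact absurd (hε _ rfl) (by simp)
    · obtain ⟨i', h1, h2, hcov⟩ := hshort i
      refine ⟨.inr i', .inl (), ⟨by simp, by simp [swapB2]⟩, fun e => ?_, fun e => ?_,
        fun m => by rw [hconst m i' i], ?_⟩
      · rcases h.entryRoot_unique _ _ _ _ hij ⟨by simp, by simp [swapB2]⟩ e with ⟨e, -⟩ | ⟨e, -⟩
        · exact h1 (Sum.inr_injective e)
        · simp [swapB2] at e
      · rcases h.entryRoot_unique _ _ _ _ ⟨by simp, by simp [swapB2]⟩ ⟨by simp, by simp [swapB2]⟩ e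
          with ⟨e, -⟩ | ⟨e, -⟩
        · simp at e
        · exact h2 (Sum.inr_injective e)
      · rintro (k | k) (l | l) hkl hε
        · exact absurd rfl hkl.1
        · rcases hcov l with rfl | rfl | rfl | rfl
          · exact Or.inr (Or.inl rfl)
          · exact Or.inl (hmir i)
          · exact Or.inr (Or.inr (Or.inr rfl))
          · exact Or.inr (Or.inr (Or.inl (hmir i')))
        · rcases hcov k with rfl | rfl | rfl | rfl
          · exact Or.inl rfl
          · exact Or.inr (Or.inl (hmir' i))
          · exact Or.inr (Or.inr (Or.inl rfl))
          · exact Or.inr (Or.inr (Or.inr (hmir' i')))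
        · exact absurd (hε _ rfl) (by simp)
    · have hT : ∀ i j : Fin 2 ⊕ Fin 2,
          ((.inr j : Unit ⊕ (Fin 2 ⊕ Fin 2)) ≠ .inr i ∧ .inr j ≠ swapB2 (.inr i)) ↔
            j ≠ i ∧ j ≠ i.swap := by
        intro i j
        simp [swapB2]
      have hsw : ∀ i j : Fin 2 ⊕ Fin 2, j ≠ i ∧ j ≠ i.swap → (j.swap ≠ i ∧ j.swap ≠ i.swap) ∧
          j.swap ≠ j ∧ i.swap ≠ i ∧ (i ≠ j ∧ i ≠ j.swap) := by decide
      rw [hT] at hij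
      obtain ⟨h1, h2, h3, h4⟩ := hsw i j hij
      refine ⟨.inr i, .inr j.swap, (hT _ _).2 h1, fun e => ?_, fun e => ?_,
        fun m => by rw [hconst m j.swap j], ?_⟩
      · rcases h.entryRoot_unique _ _ _ _ ((hT _ _).2 hij) ((hT _ _).2 h1) e with ⟨-, e⟩ | ⟨e, -⟩
        · exact h2 (Sum.inr_injective e)
        · exact h4.2 (Sum.inr_injective e)
      · rcases h.entryRoot_unique _ _ _ _ ((hT _ _).2 h4) ((hT _ _).2 h1) e with ⟨e, -⟩ | ⟨e, -⟩
        · exact h4.1 (Sum.inr_injective e)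
        · exact h3 (Sum.inr_injective e).symm
      · rintro (k | k) (l | l) hkl hε
        · exact absurd rfl hkl.1
        · exact absurd (hε _ rfl) (by simp)
        · exact absurd (hε _ rfl) (by simp)
        · exact entryRoot_mem_class (r := Sum.inr) (σ := Sum.swap) Sum.swap_swap
            (fun i j => h.entryRoot_mirror (.inr i) (.inr j))
            (hlong i j k l hij ((hT _ _).1 hkl))

end TypeB2

/-! ### Type `A₃` -/

section TypeA

theorem mem_sl_iff {n : Type} [Fintype n] [DecidableEq n] (X : Matrix n n ℝ) :
    X ∈ LieAlgebra.SpecialLinear.sl n ℝ ↔ X.trace = 0 := Iff.rfl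

/-- The exponential of a skew-symmetric matrix is the square of an orthogonal matrix. -/
theorem det_exp_of_skew {n : Type} [Fintype n] [DecidableEq n] {X : Matrix n n ℝ}
    (hX : Xᵀ = -X) : (NormedSpace.exp X).det = 1 := by
  have hY : ((1 / 2 : ℝ) • X)ᵀ = -((1 / 2 : ℝ) • X) := by
    rw [Matrix.transpose_smul, hX, smul_neg]
  have e : X = (1 / 2 : ℝ) • X + (1 / 2 : ℝ) • X := by module
  have h := congrArg Matrix.det (exp_mul_transpose_of_skew hY)
  rw [Matrix.det_mul, Matrix.det_transpose, Matrix.det_one] at h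
  rw [e, Matrix.exp_add_of_commute _ _ (Commute.refl _), Matrix.det_mul, h]

/-- The diagonal of an element of `𝔞` on which all roots of `𝔰𝔩(4,ℝ)` take different values. -/
def regularA : Fin 4 → ℤ := ![-11, -7, 5, 13]

theorem exists_regularA : ∃ H : cartan (LieAlgebra.SpecialLinear.sl (Fin 4) ℝ), ∀ i,
    (H : Matrix (Fin 4) (Fin 4) ℝ) i i = (regularA i : ℝ) := by
  refine ⟨⟨⟨Matrix.diagonal fun i => (regularA i : ℝ), ?_⟩, Matrix.isDiag_diagonal _⟩,
    fun i => Matrix.diagonal_apply_eq _ _⟩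
  rw [mem_sl_iff, Matrix.trace_diagonal]
  exact_mod_cast (by unfold regularA; decide : ∑ i, regularA i = 0)

theorem entryRoot_unique_typeA {i j k l : Fin 4} (hij : i ≠ j)
    (h : entryRoot (LieAlgebra.SpecialLinear.sl (Fin 4) ℝ) k l = entryRoot _ i j) :
    k = i ∧ l = j := by
  have hreg : ∀ i j k l : Fin 4, i ≠ j →
      regularA k - regularA l = regularA i - regularA j → k = i ∧ l = j := by
    unfold regularA
    decide
  obtain ⟨H, hH⟩ := exists_regularA
  have e := LinearMap.congr_fun h H
  rw [entryRoot_apply, entryRoot_apply, hH, hH, hH, hH] at e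
  exact hreg i j k l hij (by exact_mod_cast e)

theorem exists_signs_typeA (m : groupM (LieAlgebra.SpecialLinear.sl (Fin 4) ℝ)) :
    ∃ s : Fin 4 → ℝ, (∀ i, s i * s i = 1) ∧ ∏ i, s i = 1 ∧
      ∀ (Y : LieAlgebra.SpecialLinear.sl (Fin 4) ℝ) i j,
        (((m : _ ≃ₗ[ℝ] _) Y : LieAlgebra.SpecialLinear.sl (Fin 4) ℝ) :
          Matrix (Fin 4) (Fin 4) ℝ) i j =
        s i * s j * (Y : Matrix (Fin 4) (Fin 4) ℝ) i j := by
  obtain ⟨k, hk, hdet, hY, hk0⟩ := exists_matrix_of_groupM (fun k => k.det = 1) Matrix.det_one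
    (fun k l hk hl => by rw [Matrix.det_mul, hk, hl, one_mul])
    (fun k _ hk => by rw [Matrix.det_transpose, hk]) (fun X hX => det_exp_of_skew hX) m
  obtain ⟨H, hH⟩ := exists_regularA
  have hinj : Function.Injective regularA := by
    unfold regularA
    decide
  have hk0' : ∀ i a, a ≠ i → k i a = 0 := fun i a ha => hk0 i a ⟨H, by
    rw [hH, hH]
    exact_mod_cast fun e => ha (hinj e).symm⟩
  have hkd : k = Matrix.diagonal fun i => k i i := by
    ext i j
    by_cases hij : i = j
    · rw [hij, Matrix.diagonal_apply_eq]
    · rw [Matrix.diagonal_apply_ne _ hij, hk0' i j (Ne.symm hij)]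
  refine ⟨fun i => k i i, fun i => mul_self_of_row hk (hk0' i), ?_, fun Y i j => ?_⟩
  · rw [← Matrix.det_diagonal, ← hkd]
    exact hdet
  · rw [hY, conj_apply_of_row (hk0' i) (hk0' j)]

theorem entryRoot_mem_roots_typeA {i j : Fin 4} (hij : i ≠ j) :
    entryRoot (LieAlgebra.SpecialLinear.sl (Fin 4) ℝ) i j ∈ roots _ := by
  constructor
  · intro e
    have h : entryRoot (LieAlgebra.SpecialLinear.sl (Fin 4) ℝ) i i = entryRoot _ i j :=
      (LinearMap.ext fun H => sub_self _ : entryRoot _ i i = 0).trans e.symm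
    exact hij (entryRoot_unique_typeA hij h).2
  · refine (Submodule.ne_bot_iff _).2 ⟨⟨Matrix.single i j 1, ?_⟩, ?_, fun e => ?_⟩
    · rw [mem_sl_iff, Matrix.trace_single_eq_of_ne _ _ _ hij]
    · refine (mem_rootSpace_iff _ _).2 fun k l hkl => ?_
      by_cases h : i = k ∧ j = l
      · rw [h.1, h.2]
      · exact absurd (Matrix.single_apply_of_ne _ _ _ _ _ h) hkl
    · have := congrFun (congrFun (congrArg Subtype.val e) i) j
      change Matrix.single i j (1 : ℝ) i j = 0 at this
      rw [Matrix.single_apply_same] at this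
      exact one_ne_zero this

/-- Roots `ε_i - ε_j` and `± (ε_{i'} - ε_{j'})` are `M`-equivalent if `{i', j'}` is the complement
of `{i, j}`, as the determinant of an element of `M` is `1`. -/
theorem exists_hasPairedRoots_typeA :
    ∃ χ, HasPairedRoots (LieAlgebra.SpecialLinear.sl (Fin 4) ℝ) χ := by
  choose s hs hprod hact using exists_signs_typeA
  refine exists_hasPairedRoots id (fun i j => i ≠ j) (fun i j h => h.symm) s hs
    (fun m i j _ Y => hact m Y i j) ?_ ?_ (fun i j hij => entryRoot_mem_roots_typeA hij)
    (fun ε => ∃ a b, a ≠ b ∧ ε = flipSign a b) ?_ ?_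
  · intro α hα X hX hX0
    obtain ⟨i, j, hij⟩ := exists_entry_ne_zero hX0
    refine ⟨i, j, ?_, hij⟩
    rintro rfl
    exact hα (((mem_rootSpace_iff _ _).1 hX i i hij).symm.trans
      (LinearMap.ext fun H => sub_self _))
  · intro i j hij X hX h0
    by_contra hne
    obtain ⟨k, l, hkl⟩ := exists_entry_ne_zero hne
    obtain ⟨rfl, rfl⟩ := entryRoot_unique_typeA hij ((mem_rootSpace_iff _ _).1 hX k l hkl)
    exact hkl h0
  · rintro ε ⟨a, b, hab, rfl⟩
    refine exists_groupM_of_skew (Z := rotGen a b) ?_ (transpose_rotGen a b) (rotGen_cube hab)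
      (one_add_rotGen_sq hab)
    rw [mem_sl_iff, rotGen, Matrix.trace_sub, Matrix.trace_single_eq_of_ne _ _ _ hab,
      Matrix.trace_single_eq_of_ne _ _ _ hab.symm, sub_zero]
  · intro i j hij
    have hcompl : ∀ i j : Fin 4, i ≠ j → ∃ i' j', i' ≠ j' ∧ i' ≠ i ∧ i' ≠ j ∧ j' ≠ i ∧ j' ≠ j ∧
        ∀ k l, k ≠ l → ((k = i ∨ k = j) ↔ (l = i ∨ l = j)) →
          (k = i ∧ l = j) ∨ (k = j ∧ l = i) ∨ (k = i' ∧ l = j') ∨ (k = j' ∧ l = i') := by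
      decide
    obtain ⟨i', j', h1, h2, h3, h4, h5, h6⟩ := hcompl i j hij
    refine ⟨i', j', h1, fun e => h2 (entryRoot_unique_typeA hij e).1,
      fun e => h3 (entryRoot_unique_typeA hij.symm e).1, fun m => ?_, fun k l hkl hε => ?_⟩
    · have hcard : ({i, j, i', j'} : Finset (Fin 4)) = Finset.univ := by
        refine Finset.eq_univ_of_card _ ?_
        simp [hij, h1, h2.symm, h3.symm, h4.symm, h5.symm]
      have hp : s m i * s m j * (s m i' * s m j') = 1 := by
        rw [← hprod m, ← hcard, Finset.prod_insert, Finset.prod_insert, Finset.prod_pair h1]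
        · ring
        · simp [h3.symm, h5.symm]
        · simp [hij, h2.symm, h4.symm]
      calc s m i' * s m j' = (s m i * s m i) * (s m j * s m j) * (s m i' * s m j') := by
            rw [hs, hs, one_mul, one_mul]
        _ = s m i * s m j * (s m i * s m j * (s m i' * s m j')) := by ring
        _ = s m i * s m j := by rw [hp, mul_one]
    · have hiff : (k = i ∨ k = j) ↔ (l = i ∨ l = j) := by
        have e := hε _ ⟨i, j, hij, rfl⟩
        simp only [flipSign] at e
        grind
      rcases h6 k l hkl hiff with
        ⟨rfl, rfl⟩ | ⟨rfl, rfl⟩ | ⟨rfl, rfl⟩ | ⟨rfl, rfl⟩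
      · exact Or.inl rfl
      · exact Or.inr (Or.inl rfl)
      · exact Or.inr (Or.inr (Or.inl rfl))
      · exact Or.inr (Or.inr (Or.inr rfl))

end TypeA

/-! ### Type `G₂` -/

section TypeG

/-- The matrix of the cross product `v ↦ p × v` in `ℝ³`. -/
def crossMat (p : Fin 3 → ℝ) : Matrix (Fin 3) (Fin 3) ℝ :=
  !![0, -p 2, p 1; p 2, 0, -p 0; -p 1, p 0, 0]

/-- The derivation of the split octonions with `𝔰𝔩(3)`-component `A` and components `p`, `q` in `ℝ³`
and its dual. -/
def zornDer (A : Matrix (Fin 3) (Fin 3) ℝ) (p q : Fin 3 → ℝ) : Matrix ZornIdx ZornIdx ℝ :=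
  Matrix.fromBlocks 0
    (Matrix.of fun a => Sum.elim (fun j => ![-q j, q j] a) fun j => ![-p j, p j] a)
    (Matrix.of (Sum.elim (fun i => ![p i, -p i]) fun i => ![q i, -q i]))
    (Matrix.fromBlocks A (crossMat q) (crossMat p) (-Aᵀ))

section Product

variable (x y : ZornIdx → ℝ)

theorem zornMul_inl_zero : zornMul x y (.inl 0) =
    x (.inl 0) * y (.inl 0) + ∑ i, x (.inr (.inl i)) * y (.inr (.inr i)) := rfl

theorem zornMul_inl_one : zornMul x y (.inl 1) =
    x (.inl 1) * y (.inl 1) + ∑ i, x (.inr (.inr i)) * y (.inr (.inl i)) := rfl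

theorem zornMul_inr_inl (i : Fin 3) : zornMul x y (.inr (.inl i)) =
    x (.inl 0) * y (.inr (.inl i)) + y (.inl 1) * x (.inr (.inl i)) -
      (x (.inr (.inr (i + 1))) * y (.inr (.inr (i + 2))) -
        x (.inr (.inr (i + 2))) * y (.inr (.inr (i + 1)))) := by
  fin_cases i <;> simp [zornMul, crossProduct, Matrix.vecHead, Matrix.vecTail]

theorem zornMul_inr_inr (i : Fin 3) : zornMul x y (.inr (.inr i)) =
    y (.inl 0) * x (.inr (.inr i)) + x (.inl 1) * y (.inr (.inr i)) +
      (x (.inr (.inl (i + 1))) * y (.inr (.inl (i + 2))) -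
        x (.inr (.inl (i + 2))) * y (.inr (.inl (i + 1)))) := by
  fin_cases i <;> simp [zornMul, crossProduct, Matrix.vecHead, Matrix.vecTail]

end Product

section Derivation

variable (A : Matrix (Fin 3) (Fin 3) ℝ) (p q : Fin 3 → ℝ) (x : ZornIdx → ℝ)

theorem crossMat_mulVec (v : Fin 3 → ℝ) (i : Fin 3) :
    (crossMat p *ᵥ v) i = p (i + 1) * v (i + 2) - p (i + 2) * v (i + 1) := by
  fin_cases i <;> simp [crossMat, Matrix.mulVec, dotProduct, Fin.sum_univ_three] <;> ring

theorem zornDer_mulVec_inl_zero : (zornDer A p q *ᵥ x) (.inl 0) =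
    -∑ j, (q j * x (.inr (.inl j)) + p j * x (.inr (.inr j))) := by
  simp [zornDer, Matrix.mulVec, dotProduct, Fintype.sum_sum_type, Finset.sum_add_distrib]
  ring

theorem zornDer_mulVec_inl_one : (zornDer A p q *ᵥ x) (.inl 1) =
    ∑ j, (q j * x (.inr (.inl j)) + p j * x (.inr (.inr j))) := by
  simp [zornDer, Matrix.mulVec, dotProduct, Fintype.sum_sum_type, Finset.sum_add_distrib]

theorem zornDer_mulVec_inr_inl (i : Fin 3) : (zornDer A p q *ᵥ x) (.inr (.inl i)) =
    p i * (x (.inl 0) - x (.inl 1)) + ∑ j, A i j * x (.inr (.inl j)) +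
      (q (i + 1) * x (.inr (.inr (i + 2))) - q (i + 2) * x (.inr (.inr (i + 1)))) := by
  rw [← crossMat_mulVec q (fun i => x (.inr (.inr i)))]
  simp [zornDer, Matrix.mulVec, dotProduct, Fintype.sum_sum_type]
  ring

theorem zornDer_mulVec_inr_inr (i : Fin 3) : (zornDer A p q *ᵥ x) (.inr (.inr i)) =
    q i * (x (.inl 0) - x (.inl 1)) - ∑ j, A j i * x (.inr (.inr j)) +
      (p (i + 1) * x (.inr (.inl (i + 2))) - p (i + 2) * x (.inr (.inl (i + 1)))) := by
  rw [← crossMat_mulVec p (fun i => x (.inr (.inl i)))]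
  simp [zornDer, Matrix.mulVec, dotProduct, Fintype.sum_sum_type]
  ring

end Derivation

theorem zornDer_mem {A : Matrix (Fin 3) (Fin 3) ℝ} (hA : A.trace = 0) (p q : Fin 3 → ℝ) :
    zornDer A p q ∈ splitG2 := by
  have h : A 2 2 = -A 0 0 - A 1 1 := by
    rw [Matrix.trace_fin_three] at hA
    linarith
  have e0 : (0 : Fin 3) + 1 = 1 ∧ (0 : Fin 3) + 2 = 2 ∧ (1 : Fin 3) + 1 = 2 ∧ (1 : Fin 3) + 2 = 0 ∧
    (2 : Fin 3) + 1 = 0 ∧ (2 : Fin 3) + 2 = 1 := by decide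
  obtain ⟨e1, e2, e3, e4, e5, e6⟩ := e0
  intro x y
  ext i
  rw [Pi.add_apply]
  rcases i with i | i | i
  · fin_cases i
    · simp only [Fin.zero_eta, zornDer_mulVec_inl_zero, zornMul_inl_zero, zornMul_inr_inl,
        zornMul_inr_inr, zornDer_mulVec_inr_inl, zornDer_mulVec_inr_inr, Fin.sum_univ_three,
        e1, e2, e3, e4, e5, e6, h]
      ring
    · simp only [Fin.mk_one, zornDer_mulVec_inl_one, zornMul_inl_one, zornMul_inr_inl,
        zornMul_inr_inr, zornDer_mulVec_inr_inl, zornDer_mulVec_inr_inr, Fin.sum_univ_three,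
        e1, e2, e3, e4, e5, e6, h]
      ring
  · simp only [zornDer_mulVec_inr_inl, zornMul_inl_zero, zornMul_inl_one, zornMul_inr_inl,
      zornMul_inr_inr, zornDer_mulVec_inl_zero, zornDer_mulVec_inl_one, zornDer_mulVec_inr_inr,
      Fin.sum_univ_three]
    fin_cases i <;>
      simp only [Fin.zero_eta, Fin.mk_one, Fin.reduceFinMk, e1, e2, e3, e4, e5, e6, h] <;> ring
  · simp only [zornDer_mulVec_inr_inr, zornMul_inl_zero, zornMul_inl_one, zornMul_inr_inl,
      zornMul_inr_inr, zornDer_mulVec_inl_zero, zornDer_mulVec_inl_one, zornDer_mulVec_inr_inl,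
      Fin.sum_univ_three]
    fin_cases i <;>
      simp only [Fin.zero_eta, Fin.mk_one, Fin.reduceFinMk, e1, e2, e3, e4, e5, e6, h] <;> ring

/-- The derivation rule for the product of two basis vectors, in coordinates. -/
theorem derivation_apply {X : Matrix ZornIdx ZornIdx ℝ} (hX : X ∈ splitG2) (i j k : ZornIdx) :
    ∑ l, X k l * zornMul (Pi.single i 1) (Pi.single j 1) l =
      zornMul (fun l => X l i) (Pi.single j 1) k + zornMul (Pi.single i 1) (fun l => X l j) k := by
  have h : ∀ i, X *ᵥ Pi.single i 1 = fun l => X l i := fun i => by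
    rw [Matrix.mulVec_single_one]
    rfl
  have e := congrFun (hX (Pi.single i 1) (Pi.single j 1)) k
  rw [h, h] at e
  exact e

/-- Every derivation of the split octonions is of the form `zornDer A p q`: the derivation rule for
products of basis vectors determines its entries. -/
theorem exists_eq_zornDer {X : Matrix ZornIdx ZornIdx ℝ} (hX : X ∈ splitG2) :
    ∃ A p q, A.trace = 0 ∧ X = zornDer A p q := by
  have key := derivation_apply hX
  have haa := key (.inl 0) (.inl 0) (.inl 0)
  have hba := key (.inl 0) (.inl 0) (.inl 1)
  have hab := key (.inl 1) (.inl 1) (.inl 0)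
  have hbb := key (.inl 1) (.inl 1) (.inl 1)
  have hub := fun i => key (.inl 0) (.inl 1) (.inr (.inl i))
  have hvb := fun i => key (.inl 1) (.inl 0) (.inr (.inr i))
  have hau := fun i => key (.inr (.inl i)) (.inl 0) (.inl 0)
  have hbu := fun i => key (.inl 1) (.inr (.inl i)) (.inl 1)
  have hav := fun i => key (.inl 0) (.inr (.inr i)) (.inl 0)
  have hbv := fun i => key (.inr (.inr i)) (.inl 1) (.inl 1)
  have hvv := fun i j => key (.inr (.inl i)) (.inr (.inr j)) (.inl 0)
  have hvu := fun i j => key (.inl 0) (.inr (.inl j)) (.inr (.inr i))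
  have huv := fun i j => key (.inl 1) (.inr (.inr j)) (.inr (.inl i))
  have htr := key (.inr (.inl 0)) (.inr (.inl 1)) (.inr (.inr 2))
  simp [zornMul_inl_zero, zornMul_inl_one, zornMul_inr_inl, zornMul_inr_inr,
    Fintype.sum_sum_type, Fin.sum_univ_two] at haa hba hab hbb hub hvb
  simp [zornMul_inl_zero, zornMul_inl_one, zornMul_inr_inl, zornMul_inr_inr,
    Fintype.sum_sum_type, Fin.sum_univ_two, Pi.single_apply] at hau hbu hav hbv hvv hvu huv
  simp [zornMul_inl_zero, zornMul_inl_one, zornMul_inr_inl, zornMul_inr_inr,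
    Fintype.sum_sum_type, Fin.sum_univ_two, Fin.sum_univ_three, Pi.single_apply] at htr
  simp only [haa, ite_self] at hvv
  have hvb' : ∀ i, X (.inr (.inr i)) (.inl 1) = -X (.inr (.inr i)) (.inl 0) := fun i => by
    linarith [hvb i]
  refine ⟨Matrix.of fun i j => X (.inr (.inl i)) (.inr (.inl j)),
    fun i => X (.inr (.inl i)) (.inl 0),
    fun i => X (.inr (.inr i)) (.inl 0), ?_, ?_⟩
  · rw [Matrix.trace_fin_three]
    simp only [Matrix.of_apply]
    linarith [hvv 2 2]
  · refine Matrix.ext fun i j => ?_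
    rcases i with i | i | i <;> rcases j with j | j | j
    · fin_cases i <;> fin_cases j <;> simp [zornDer] <;> linarith
    · fin_cases i <;> simp [zornDer] <;> linarith [hau j, hbu j, hvb j]
    · fin_cases i <;> simp [zornDer] <;> linarith [hav j, hbv j, hub j]
    · fin_cases j <;> simp [zornDer]; linarith [hub i]
    · simp [zornDer]
    · rw [huv]
      fin_cases i <;> fin_cases j <;> simp [zornDer, crossMat, hvb']
    · fin_cases j <;> simp [zornDer]; linarith [hvb i]
    · rw [hvu]
      fin_cases i <;> fin_cases j <;> simp [zornDer, crossMat]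
    · simp [zornDer]
      linarith [hvv i j]

theorem splitG2_mirror (X : splitG2) (i j : Fin 3 ⊕ Fin 3) :
    (X : Matrix ZornIdx ZornIdx ℝ) (.inr i) (.inr j) =
      -(X : Matrix ZornIdx ZornIdx ℝ) (.inr j.swap) (.inr i.swap) := by
  obtain ⟨A, p, q, -, h⟩ := exists_eq_zornDer X.2
  have hc : ∀ p i j, crossMat p i j = -crossMat p j i := by
    intro p i j
    fin_cases i <;> fin_cases j <;> simp [crossMat]
  rw [h]
  rcases i with i | i <;> rcases j with j | j
  · simp [zornDer]
  · exact hc q i j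
  · exact hc p i j
  · simp [zornDer]

theorem cartan_splitG2_inl (H : cartan splitG2) (a : Fin 2) :
    (H : Matrix ZornIdx ZornIdx ℝ) (.inl a) (.inl a) = 0 := by
  obtain ⟨A, p, q, -, h⟩ := exists_eq_zornDer (H : splitG2).2
  rw [h]
  rfl

theorem cartan_splitG2_swap (H : cartan splitG2) (i : Fin 3 ⊕ Fin 3) :
    (H : Matrix ZornIdx ZornIdx ℝ) (.inr i.swap) (.inr i.swap) =
      -(H : Matrix ZornIdx ZornIdx ℝ) (.inr i) (.inr i) := by
  rw [splitG2_mirror, Sum.swap_swap]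

theorem cartan_splitG2_sum (H : cartan splitG2) {i j k : Fin 3} (hij : i ≠ j) (hki : k ≠ i)
    (hkj : k ≠ j) : (H : Matrix ZornIdx ZornIdx ℝ) (.inr (.inl i)) (.inr (.inl i)) +
      (H : Matrix ZornIdx ZornIdx ℝ) (.inr (.inl j)) (.inr (.inl j)) +
      (H : Matrix ZornIdx ZornIdx ℝ) (.inr (.inl k)) (.inr (.inl k)) = 0 := by
  obtain ⟨A, p, q, hA, h⟩ := exists_eq_zornDer (H : splitG2).2
  have hcard : ({i, j, k} : Finset (Fin 3)) = Finset.univ := by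
    refine Finset.eq_univ_of_card _ ?_
    simp [hij, hki.symm, hkj.symm]
  rw [h, ← hA, Matrix.trace, ← hcard, Finset.sum_insert, Finset.sum_pair hkj.symm, ← add_assoc]
  · rfl
  · simp [hij, hki.symm]

/-- The diagonal of an element of `𝔞` on which all roots of `G₂` take different values. -/
def regularG : ZornIdx → ℤ := Sum.elim ![0, 0] (Sum.elim ![1, 3, -4] ![-1, -3, 4])

theorem exists_regularG : ∃ H : cartan splitG2, ∀ i,
    (H : Matrix ZornIdx ZornIdx ℝ) i i = (regularG i : ℝ) := by
  let A : Matrix (Fin 3) (Fin 3) ℝ := Matrix.diagonal ![1, 3, -4]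
  have hA : A.trace = 0 := by
    rw [Matrix.trace_diagonal, Fin.sum_univ_three]
    simp
    norm_num
  refine ⟨⟨⟨zornDer A 0 0, zornDer_mem hA 0 0⟩, ?_⟩, ?_⟩
  · intro i j hij
    change zornDer A 0 0 i j = 0
    rcases i with i | i | i <;> rcases j with j | j | j <;> fin_cases i <;> fin_cases j <;>
      simp [zornDer, crossMat, A] at hij ⊢
  · intro i
    change zornDer A 0 0 i i = _
    rcases i with i | i | i <;> fin_cases i <;> simp [zornDer, A, regularG]

theorem entryRoot_mirror_splitG2 (i j : Fin 3 ⊕ Fin 3) :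
    entryRoot splitG2 (.inr j.swap) (.inr i.swap) = entryRoot splitG2 (.inr i) (.inr j) := by
  refine LinearMap.ext fun H => ?_
  rw [entryRoot_apply, entryRoot_apply, cartan_splitG2_swap, cartan_splitG2_swap]
  ring

theorem entryRoot_unique_splitG2 (i j k l : Fin 3 ⊕ Fin 3) (hij : j ≠ i ∧ j ≠ i.swap)
    (hkl : l ≠ k ∧ l ≠ k.swap)
    (h : entryRoot splitG2 (.inr k) (.inr l) = entryRoot splitG2 (.inr i) (.inr j)) :
    (k = i ∧ l = j) ∨ (k = j.swap ∧ l = i.swap) := by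
  have hreg : ∀ i j k l : Fin 3 ⊕ Fin 3, (j ≠ i ∧ j ≠ i.swap) → (l ≠ k ∧ l ≠ k.swap) →
      regularG (.inr k) - regularG (.inr l) = regularG (.inr i) - regularG (.inr j) →
      (k = i ∧ l = j) ∨ (k = j.swap ∧ l = i.swap) := by
    unfold regularG
    decide
  obtain ⟨H, hH⟩ := exists_regularG
  have e := LinearMap.congr_fun h H
  rw [entryRoot_apply, entryRoot_apply, hH, hH, hH, hH] at e
  exact hreg i j k l hij hkl (by exact_mod_cast e)

/-- A derivation whose entries at all places `(± i, ± j)` with `i ≠ j` vanish is diagonal. -/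
theorem exists_entry_splitG2 (α : Module.Dual ℝ (cartan splitG2)) (hα : α ≠ 0) (X : splitG2)
    (hX : X ∈ rootSpace splitG2 α) (hX0 : X ≠ 0) :
    ∃ i j : Fin 3 ⊕ Fin 3, (j ≠ i ∧ j ≠ i.swap) ∧
      (X : Matrix ZornIdx ZornIdx ℝ) (.inr i) (.inr j) ≠ 0 := by
  by_contra! hno
  obtain ⟨A, p, q, hA, h⟩ := exists_eq_zornDer X.2
  rw [h] at hno
  have hq : q = 0 := by
    funext i
    fin_cases i
    · simpa [zornDer, crossMat] using hno (.inl 2) (.inr 1) (by decide)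
    · simpa [zornDer, crossMat] using hno (.inl 0) (.inr 2) (by decide)
    · simpa [zornDer, crossMat] using hno (.inl 1) (.inr 0) (by decide)
  have hp : p = 0 := by
    funext i
    fin_cases i
    · simpa [zornDer, crossMat] using hno (.inr 2) (.inl 1) (by decide)
    · simpa [zornDer, crossMat] using hno (.inr 0) (.inl 2) (by decide)
    · simpa [zornDer, crossMat] using hno (.inr 1) (.inl 0) (by decide)
  have hdiag : ∀ i j, i ≠ j → A i j = 0 := fun i j hij =>
    hno (.inl i) (.inl j) ⟨fun e => hij (Sum.inl_injective e).symm, by simp⟩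
  have hXd : ∀ i j, i ≠ j → zornDer A p q i j = 0 := by
    intro i j hij
    rw [hp, hq]
    rcases i with i | i | i <;> rcases j with j | j | j
    · rfl
    · fin_cases i <;> simp [zornDer]
    · fin_cases i <;> simp [zornDer]
    · fin_cases j <;> simp [zornDer]
    · exact hdiag i j fun e => hij (by rw [e])
    · fin_cases i <;> fin_cases j <;> simp [zornDer, crossMat]
    · fin_cases j <;> simp [zornDer]
    · fin_cases i <;> fin_cases j <;> simp [zornDer, crossMat]
    · exact neg_eq_zero.2 (hdiag j i fun e => hij (by rw [e]))
  obtain ⟨i, j, hij⟩ := exists_entry_ne_zero hX0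
  have hij' : i = j := by
    by_contra hne
    exact hij (by rw [h, hXd i j hne])
  subst hij'
  exact hα (((mem_rootSpace_iff _ _).1 hX i i hij).symm.trans (LinearMap.ext fun H => sub_self _))

/-- The weights of `𝔞` on `ℝ³` have sum zero, so that the short roots `-ε_i - ε_j` and `ε_k`
coincide. -/
theorem entryRoot_short {i j k : Fin 3} (hij : i ≠ j) (hki : k ≠ i) (hkj : k ≠ j) :
    entryRoot splitG2 (.inr (.inr i)) (.inr (.inl j)) =
      entryRoot splitG2 (.inr (.inl k)) (.inl 0) := by
  refine LinearMap.ext fun H => ?_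
  have h := cartan_splitG2_swap H (.inl i)
  rw [Sum.swap_inl] at h
  rw [entryRoot_apply, entryRoot_apply, h, cartan_splitG2_inl]
  linarith [cartan_splitG2_sum H hij hki hkj]

theorem entryRoot_inl_one (i : ZornIdx) :
    entryRoot splitG2 i (.inl 1) = entryRoot splitG2 i (.inl 0) := by
  refine LinearMap.ext fun H => ?_
  rw [entryRoot_apply, entryRoot_apply, cartan_splitG2_inl, cartan_splitG2_inl]

theorem entryRoot_inl_inr (a : Fin 2) (i : Fin 3 ⊕ Fin 3) :
    entryRoot splitG2 (.inl a) (.inr i.swap) = entryRoot splitG2 (.inr i) (.inl 0) := by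
  refine LinearMap.ext fun H => ?_
  rw [entryRoot_apply, entryRoot_apply, cartan_splitG2_swap, cartan_splitG2_inl,
    cartan_splitG2_inl]
  ring

theorem crossMat_single_ne {k i j : Fin 3} (h : crossMat (Pi.single k 1) i j ≠ 0) :
    i ≠ j ∧ k ≠ i ∧ k ≠ j := by
  fin_cases k <;> fin_cases i <;> fin_cases j <;> simp [crossMat] at h ⊢

theorem crossMat_single_ne_zero {k i j : Fin 3} (hij : i ≠ j) (hki : k ≠ i) (hkj : k ≠ j) :
    crossMat (Pi.single k 1) i j ≠ 0 := by
  fin_cases k <;> fin_cases i <;> fin_cases j <;> simp [crossMat] at hij hki hkj ⊢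

theorem rootSpace_ne_bot_of_entry {n : Type} [Fintype n] [DecidableEq n]
    {𝔤 : LieSubalgebra ℝ (Matrix n n ℝ)} {i j : n} {X : Matrix n n ℝ} (hX : X ∈ 𝔤)
    (hij : X i j ≠ 0) (h : ∀ k l, X k l ≠ 0 → entryRoot 𝔤 k l = entryRoot 𝔤 i j) :
    rootSpace 𝔤 (entryRoot 𝔤 i j) ≠ ⊥ := by
  refine (Submodule.ne_bot_iff _).2 ⟨⟨X, hX⟩, (mem_rootSpace_iff _ _).2 h, fun e => hij ?_⟩
  exact congrFun (congrFun (congrArg Subtype.val e) i) j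

theorem entryRoot_ne_zero_splitG2 (i j : Fin 3 ⊕ Fin 3) (hij : j ≠ i ∧ j ≠ i.swap) :
    entryRoot splitG2 (.inr i) (.inr j) ≠ 0 := by
  have hreg : ∀ i j : Fin 3 ⊕ Fin 3, (j ≠ i ∧ j ≠ i.swap) →
      regularG (.inr i) - regularG (.inr j) ≠ 0 := by
    unfold regularG
    decide
  obtain ⟨H, hH⟩ := exists_regularG
  intro e
  have e := LinearMap.congr_fun e H
  rw [entryRoot_apply, hH, hH, LinearMap.zero_apply] at e
  exact hreg i j hij (by exact_mod_cast e)

theorem rootSpace_ne_bot_splitG2 (i j : Fin 3 ⊕ Fin 3) (hij : j ≠ i ∧ j ≠ i.swap) :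
    rootSpace splitG2 (entryRoot splitG2 (.inr i) (.inr j)) ≠ ⊥ := by
  have hlong : ∀ i j : Fin 3, i ≠ j →
      rootSpace splitG2 (entryRoot splitG2 (.inr (.inl i)) (.inr (.inl j))) ≠ ⊥ := by
    intro i j hij
    refine rootSpace_ne_bot_of_entry (X := zornDer (Matrix.single i j 1) 0 0)
      (zornDer_mem (Matrix.trace_single_eq_of_ne _ _ _ hij) 0 0) ?_ ?_
    · change Matrix.single i j (1 : ℝ) i j ≠ 0
      rw [Matrix.single_apply_same]
      exact one_ne_zero
    · have hs : ∀ k l, Matrix.single i j (1 : ℝ) k l ≠ 0 → i = k ∧ j = l := fun k l hkl => by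
        by_contra hne
        exact hkl (Matrix.single_apply_of_ne _ _ _ _ _ hne)
      rintro (k | k | k) (l | l | l) hkl
      · exact absurd rfl hkl
      · fin_cases k <;> simp [zornDer] at hkl
      · fin_cases k <;> simp [zornDer] at hkl
      · fin_cases l <;> simp [zornDer] at hkl
      · obtain ⟨rfl, rfl⟩ := hs k l hkl
        rfl
      · fin_cases k <;> fin_cases l <;> simp [zornDer, crossMat] at hkl
      · fin_cases l <;> simp [zornDer] at hkl
      · fin_cases k <;> fin_cases l <;> simp [zornDer, crossMat] at hkl
      · obtain ⟨rfl, rfl⟩ := hs l k (neg_ne_zero.1 hkl)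
        exact entryRoot_mirror_splitG2 (.inl i) (.inl j)
  have hthird : ∀ i j : Fin 3, i ≠ j → ∃ k, k ≠ i ∧ k ≠ j := by decide
  have hsingle : ∀ k l : Fin 3, (Pi.single k 1 : Fin 3 → ℝ) l ≠ 0 → l = k := by
    intro k l h
    by_contra hne
    exact h (Pi.single_eq_of_ne hne _)
  rcases i with i | i <;> rcases j with j | j
  · exact hlong i j fun e => hij.1 (by rw [e])
  · have hne : i ≠ j := fun e => hij.2 (by rw [e]; rfl)
    obtain ⟨k, hki, hkj⟩ := hthird i j hne
    have hroot : ∀ {i j}, i ≠ j → k ≠ i → k ≠ j →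
        entryRoot splitG2 (.inr (.inl i)) (.inr (.inr j)) =
        entryRoot splitG2 (.inr (.inr k)) (.inl 0) := fun {i j} hne hki hkj => by
      rw [← neg_entryRoot, entryRoot_short hne.symm hkj hki, neg_entryRoot]
      exact entryRoot_inl_inr 0 (.inr k)
    refine rootSpace_ne_bot_of_entry (X := zornDer 0 0 (Pi.single k 1))
      (zornDer_mem (Matrix.trace_zero _ _) _ _) (crossMat_single_ne_zero hne hki hkj) ?_
    rw [hroot hne hki hkj]
    rintro (a | a | a) (b | b | b) h
    · exact absurd rfl h
    · have hb : b = k := hsingle k b fun e => h (by fin_cases a <;> simp [zornDer, e])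
      rw [hb]
      exact entryRoot_inl_inr a (.inr k)
    · fin_cases a <;> simp [zornDer] at h
    · fin_cases b <;> simp [zornDer] at h
    · simp [zornDer] at h
    · obtain ⟨h1, h2, h3⟩ := crossMat_single_ne h
      exact hroot h1 h2 h3
    · have ha : a = k := hsingle k a fun e => h (by fin_cases b <;> simp [zornDer, e])
      rw [ha]
      fin_cases b
      · rfl
      · exact entryRoot_inl_one _
    · fin_cases a <;> fin_cases b <;> simp [zornDer, crossMat] at h
    · simp [zornDer] at h
  · have hne : i ≠ j := fun e => hij.2 (by rw [e]; rfl)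
    obtain ⟨k, hki, hkj⟩ := hthird i j hne
    refine rootSpace_ne_bot_of_entry (X := zornDer 0 (Pi.single k 1) 0)
      (zornDer_mem (Matrix.trace_zero _ _) _ _) (crossMat_single_ne_zero hne hki hkj) ?_
    rw [entryRoot_short hne hki hkj]
    rintro (a | a | a) (b | b | b) h
    · exact absurd rfl h
    · fin_cases a <;> simp [zornDer] at h
    · have hb : b = k := hsingle k b fun e => h (by fin_cases a <;> simp [zornDer, e])
      rw [hb]
      exact entryRoot_inl_inr a (.inl k)
    · have ha : a = k := hsingle k a fun e => h (by fin_cases b <;> simp [zornDer, e])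
      rw [ha]
      fin_cases b
      · rfl
      · exact entryRoot_inl_one _
    · simp [zornDer] at h
    · fin_cases a <;> fin_cases b <;> simp [zornDer, crossMat] at h
    · fin_cases b <;> simp [zornDer] at h
    · obtain ⟨h1, h2, h3⟩ := crossMat_single_ne h
      exact entryRoot_short h1 h2 h3
    · simp [zornDer] at h
  · rw [← entryRoot_mirror_splitG2]
    exact hlong j i fun e => hij.1 (by rw [e])

/-- The elements of `M` act on `ℝ³` and on its dual by the same signs: this follows from their
compatibility with the cross products. -/
theorem exists_signs_splitG2 (m : groupM splitG2) :
    ∃ s : Fin 3 ⊕ Fin 3 → ℝ, (∀ i, s i * s i = 1) ∧ (∀ i, s i.swap = s i) ∧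
      ∀ (Y : splitG2) (i j : Fin 3 ⊕ Fin 3),
        (((m : splitG2 ≃ₗ[ℝ] splitG2) Y : splitG2) : Matrix ZornIdx ZornIdx ℝ) (.inr i) (.inr j) =
        s i * s j * (Y : Matrix ZornIdx ZornIdx ℝ) (.inr i) (.inr j) := by
  -- `𝔞` does not separate the first two coordinates, where `k` need not be diagonal
  obtain ⟨k, hk, -, hY, hk0⟩ := exists_matrix_of_groupM (fun _ => True) trivial
    (fun _ _ _ _ => trivial) (fun _ _ _ => trivial) (fun _ _ => trivial) m
  obtain ⟨H, hH⟩ := exists_regularG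
  have hreg : ∀ (i : Fin 3 ⊕ Fin 3) a, a ≠ .inr i → regularG (.inr i) ≠ regularG a := by
    unfold regularG
    decide
  have hrow : ∀ (i : Fin 3 ⊕ Fin 3) a, a ≠ .inr i → k (.inr i) a = 0 := fun i a ha =>
    hk0 _ _ ⟨H, by
      rw [hH, hH]
      exact_mod_cast hreg i a ha⟩
  have hcol : ∀ (a : Fin 2) (i : Fin 3 ⊕ Fin 3), k (.inl a) (.inr i) = 0 := fun a i =>
    hk0 _ _ ⟨H, by
      rw [hH, hH]
      exact_mod_cast (hreg i (.inl a) (by simp)).symm⟩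
  have hs : ∀ i : Fin 3 ⊕ Fin 3, k (.inr i) (.inr i) * k (.inr i) (.inr i) = 1 := fun i =>
    mul_self_of_row hk (hrow i)
  have hact : ∀ (Y : splitG2) (i j : Fin 3 ⊕ Fin 3),
      (((m : splitG2 ≃ₗ[ℝ] splitG2) Y : splitG2) : Matrix ZornIdx ZornIdx ℝ) (.inr i) (.inr j) =
        k (.inr i) (.inr i) * k (.inr j) (.inr j) *
          (Y : Matrix ZornIdx ZornIdx ℝ) (.inr i) (.inr j) := fun Y i j => by
    rw [hY, conj_apply_of_row (hrow i) (hrow j)]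
  have hact' : ∀ (Y : splitG2) (i : Fin 3 ⊕ Fin 3),
      (((m : splitG2 ≃ₗ[ℝ] splitG2) Y : splitG2) : Matrix ZornIdx ZornIdx ℝ) (.inr i) (.inl 0) =
        k (.inr i) (.inr i) *
          ((Y : Matrix ZornIdx ZornIdx ℝ) (.inr i) (.inl 0) * k (.inl 0) (.inl 0) +
          (Y : Matrix ZornIdx ZornIdx ℝ) (.inr i) (.inl 1) * k (.inl 0) (.inl 1)) := by
    intro Y i
    have h1 : ∀ l, (k * (Y : Matrix ZornIdx ZornIdx ℝ)) (.inr i) l =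
        k (.inr i) (.inr i) * (Y : Matrix ZornIdx ZornIdx ℝ) (.inr i) l := fun l => by
      rw [Matrix.mul_apply, Finset.sum_eq_single (.inr i)]
      · intro a _ ha
        rw [hrow i a ha, zero_mul]
      · simp
    rw [hY, Matrix.mul_apply, Fintype.sum_sum_type, Fin.sum_univ_two]
    simp only [Matrix.transpose_apply, hcol, mul_zero, Finset.sum_const_zero, add_zero, h1]
    ring
  set κ := k (.inl 0) (.inl 0) - k (.inl 0) (.inl 1) with hκ
  -- comparing the images of two derivations with the general form of a derivation relates the signs
  let Y₁ : splitG2 := ⟨zornDer 0 1 0, zornDer_mem (Matrix.trace_zero _ _) _ _⟩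
  let Y₂ : splitG2 := ⟨zornDer 0 0 1, zornDer_mem (Matrix.trace_zero _ _) _ _⟩
  obtain ⟨A₁, p, q₁, -, h₁⟩ := exists_eq_zornDer ((m : splitG2 ≃ₗ[ℝ] splitG2) Y₁).2
  obtain ⟨A₂, p₂, q, -, h₂⟩ := exists_eq_zornDer ((m : splitG2 ≃ₗ[ℝ] splitG2) Y₂).2
  have hp : ∀ i, p i = k (.inr (.inl i)) (.inr (.inl i)) * κ := by
    intro i
    have e := hact' Y₁ (.inl i)
    rw [h₁] at e
    change p i = _ * (1 * _ + -1 * _) at e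
    rw [e, hκ]
    ring
  have hq : ∀ i, q i = k (.inr (.inr i)) (.inr (.inr i)) * κ := by
    intro i
    have e := hact' Y₂ (.inr i)
    rw [h₂] at e
    change q i = _ * (1 * _ + -1 * _) at e
    rw [e, hκ]
    ring
  have hp' : ∀ i j, crossMat p i j = k (.inr (.inr i)) (.inr (.inr i)) *
      k (.inr (.inl j)) (.inr (.inl j)) * crossMat 1 i j := by
    intro i j
    have e := hact Y₁ (.inr i) (.inl j)
    rw [h₁] at e
    exact e
  have hq' : ∀ i j, crossMat q i j = k (.inr (.inl i)) (.inr (.inl i)) *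
      k (.inr (.inr j)) (.inr (.inr j)) * crossMat 1 i j := by
    intro i j
    have e := hact Y₂ (.inl i) (.inr j)
    rw [h₂] at e
    exact e
  have hκ0 : κ ≠ 0 := by
    intro h0
    have e := hp' 2 1
    simp [crossMat, hp, h0] at e
    rcases e with e | e
    · have := hs (.inr 2)
      rw [e] at this
      simp at this
    · have := hs (.inl 1)
      rw [e] at this
      simp at this
  have huv : ∀ i : Fin 3,
      k (.inr (.inr i)) (.inr (.inr i)) = k (.inr (.inl i)) (.inr (.inl i)) := by
    intro i
    refine mul_right_cancel₀ hκ0 ?_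
    rw [← hp, ← hq]
    fin_cases i
    · have e1 := hp' 1 2
      have e2 := hq' 2 1
      simp [crossMat] at e1 e2
      change q 0 = p 0
      rw [e1, e2, mul_comm]
    · have e1 := hp' 2 0
      have e2 := hq' 0 2
      simp [crossMat] at e1 e2
      change q 1 = p 1
      linarith
    · have e1 := hp' 0 1
      have e2 := hq' 1 0
      simp [crossMat] at e1 e2
      change q 2 = p 2
      linarith
  refine ⟨fun i => k (.inr i) (.inr i), hs, ?_, hact⟩
  rintro (i | i)
  · exact huv i
  · exact (huv i).symm

/-- Up to sign, the class of the root `ε_i - ε_j` consists of `ε_i - ε_j` and the short root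
`ε_i + ε_j`. -/
theorem exists_hasPairedRoots_splitG2 : ∃ χ, HasPairedRoots splitG2 χ := by
  choose s hs hσ hact using exists_signs_splitG2
  have hroot : ∀ i j : Fin 3 ⊕ Fin 3, (j ≠ i ∧ j ≠ i.swap) →
      entryRoot splitG2 (.inr i) (.inr j) ∈ roots splitG2 := fun i j hij =>
    ⟨entryRoot_ne_zero_splitG2 i j hij, rootSpace_ne_bot_splitG2 i j hij⟩
  refine exists_hasPairedRoots Sum.inr (fun i j => j ≠ i ∧ j ≠ i.swap) ?_ s hs
    (fun m i j _ Y => hact m Y i j) exists_entry_splitG2 ?_ hroot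
    (fun ε => ∃ a b, a ≠ b ∧ ε = flipSign a b ∘ foldSum) ?_ ?_
  · exact fun i j hij => ⟨hij.1.symm, fun e => hij.2 (by rw [e, Sum.swap_swap])⟩
  · exact eq_zero_of_entry_eq_zero (r := Sum.inr) (σ := Sum.swap) splitG2_mirror
      entryRoot_unique_splitG2 exists_entry_splitG2 hroot
  · rintro ε ⟨a, b, hab, rfl⟩
    have hZ : zornDer (rotGen a b) 0 0 = Matrix.fromBlocks 0 0 0 (doubleRotGen a b) := by
      refine Matrix.ext fun i j => ?_
      have hr := transpose_rotGen a b
      rcases i with i | i | i <;> rcases j with j | j | j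
      · rfl
      · fin_cases i <;> simp [zornDer]
      · fin_cases i <;> simp [zornDer]
      · fin_cases j <;> simp [zornDer]
      · simp [zornDer, doubleRotGen]
      · fin_cases i <;> fin_cases j <;> simp [zornDer, crossMat, doubleRotGen]
      · fin_cases j <;> simp [zornDer]
      · fin_cases i <;> fin_cases j <;> simp [zornDer, crossMat, doubleRotGen]
      · simp [zornDer, doubleRotGen, hr]
    obtain ⟨m, hm⟩ := exists_groupM_of_skew (𝔤 := splitG2) (Z := zornDer (rotGen a b) 0 0)
      (ε := Sum.elim 1 fun i => ((flipSign a b (foldSum i) : ℤ) : ℝ))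
      (zornDer_mem (by
        rw [rotGen, Matrix.trace_sub, Matrix.trace_single_eq_of_ne _ _ _ hab,
          Matrix.trace_single_eq_of_ne _ _ _ hab.symm, sub_zero]) 0 0)
      (by
        rw [hZ]
        simp [Matrix.fromBlocks_transpose, Matrix.fromBlocks_neg, transpose_doubleRotGen])
      (by
        rw [hZ]
        simp [Matrix.fromBlocks_multiply, Matrix.fromBlocks_neg, doubleRotGen_cube hab])
      (by
        rw [hZ, ← Matrix.fromBlocks_one, Matrix.fromBlocks_multiply, Matrix.fromBlocks_smul,
          Matrix.fromBlocks_add]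
        simp only [Matrix.zero_mul, Matrix.mul_zero, add_zero, zero_add, smul_zero]
        rw [one_add_doubleRotGen_sq hab, ← Matrix.diagonal_one, Matrix.fromBlocks_diagonal]
        rfl)
    exact ⟨m, fun Y i j => hm Y (.inr i) (.inr j)⟩
  · refine exists_partner_of_swap (r := Sum.inr) entryRoot_mirror_splitG2 entryRoot_unique_splitG2
      hσ ?_
    intro x y u v hxy huv h
    have hsep : ∀ x y u v : Fin 3, x ≠ y → u ≠ v →
        ((u = x ∨ u = y) ↔ (v = x ∨ v = y)) → (u = x ∧ v = y) ∨ (u = y ∧ v = x) := by decide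
    have e := h x y hxy
    simp only [flipSign] at e
    exact hsep x y u v hxy huv (by grind)

end TypeG

theorem IsSpecialType.exists_hasPairedRoots {n : Type} [Fintype n] [DecidableEq n]
    {𝔤 : LieSubalgebra ℝ (Matrix n n ℝ)} (h𝔤 : IsSpecialType n 𝔤) : ∃ χ, HasPairedRoots 𝔤 χ := by
  cases h𝔤 with
  | A3 => exact exists_hasPairedRoots_typeA
  | B2 => exact exists_hasPairedRoots_splitB2
  | G2 => exact exists_hasPairedRoots_splitG2
  | D l hl => exact exists_hasPairedRoots_typeD hl

end

end RealFlag

open RealFlag in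
theorem corollary5 {n : Type} [Fintype n] [DecidableEq n] (𝔤 : LieSubalgebra ℝ (Matrix n n ℝ))
    (h𝔤 : IsSpecialType n 𝔤)
    (P : Set (Module.Dual ℝ (cartan 𝔤))) (hP : IsPositiveSystem 𝔤 P)
    (X : Module.Dual ℝ (cartan 𝔤) → 𝔤)
    (hX : ∀ γ ∈ negRoots P, X γ ∈ rootSpace 𝔤 γ ∧ X γ ≠ 0)
    (d : ℕ) (α : Fin d → Module.Dual ℝ (cartan 𝔤)) (hα : ∀ j, α j ∈ negRoots P)
    (hd : ∀ γ ∈ negRoots P, ∃! j, γ ∈ mClass P (α j)) :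
    ∃ (β : Fin d → Module.Dual ℝ (cartan 𝔤))
      (b : ∀ j, Module.Basis (Fin 2) ℝ (classSpace P (α j)))
      (Φ : Moduli (isotropyRep P) ≃ ∀ j, Moduli (classRep P (α j)))
      (Ψ : ∀ j, Moduli (classRep P (α j)) ≃ ParamSpace),
      (∀ j, β j ≠ α j ∧ mClass P (α j) = {α j, β j}) ∧
      (∀ j, (b j 0 : 𝔤) = X (α j) ∧ (b j 1 : 𝔤) = X (β j)) ∧
      (∀ J j, ∃! J', IsRestriction P (α j) J J') ∧
      (∀ j J', ∃ J, IsRestriction P (α j) J J') ∧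
      (∀ J j J', IsRestriction P (α j) J J' → Φ (Moduli.mk J) j = Moduli.mk J') ∧
      (∀ j (J' : InvariantGCS (classRep P (α j))),
        (∃ a x y : ℝ, a ^ 2 = x * y - 1 ∧
          genMatrix (b j) J'.toEnd = noncomplexMatrix a x y ∧
          (Ψ j (Moduli.mk J')).1 = (0, x)) ∨
        (∃ b' c : ℝ, c ≠ 0 ∧
          genMatrix (b j) J'.toEnd = complexMatrix b' c ∧
          (Ψ j (Moduli.mk J')).1 = (c, b'))) ∧
      Nonempty (@ContinuousMap.HomotopyEquiv (Moduli (isotropyRep P)) (Fin d → Circle)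
        (TopologicalSpace.induced
          (fun (q : Moduli (isotropyRep P)) (j : Fin d) => ((Ψ j (Φ q j) : ParamSpace) : ℝ × ℝ))
          inferInstance)
        inferInstance) := by
  obtain ⟨χ, h⟩ := h𝔤.exists_hasPairedRoots
  exact h.moduli P hP X hX d α hα hd
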